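/- Let $(M,g)$ be a compact connected Riemannian manifold ($C^\infty$, without boundary) with Levi-Civita connection $\nabla$ and Riemannian distance $\mathrm{dist}$. Let $\tau:M\to\mathbb R$ be a Morse–Bott function: $\tau$ is $C^\infty$, the connected components of its set of critical points are mutually isolated submanifolds of $M$ (the critical manifolds), and the rank of the Hessian of $\tau$ at every critical point equals the codimension of the critical manifold containing it. Suppose that $\tau$ has a geodesic gradient, that is, $v=\nabla\tau$ satisfies $\nabla_v v=\psi v$ wherever $v\ne 0$, for some function $\psi$, and that all critical manifolds of $\tau$ have codimension greater than $1$. Put $\tau_{\min}=\min\tau$, $\tau_{\max}=\max\tau$, $I=[\tau_{\min},\tau_{\max}]$, $I^\circ=(\tau_{\min},\tau_{\max})$ and $Q=g(\nabla\tau,\nabla\tau)$. Then $\tau$ is nonconstant, with range $I$, and: (i) $Q$ is a $C^\infty$ function of $\tau$: there is a $C^\infty$ function $\chi:I\to\mathbb R$ with $Q=\chi\circ\tau$; from now on $Q$ is also regarded as the function $\tau\mapsto\chi(\tau)$ on $I$. (ii) At every critical point $y$ the Hessian $\nabla d\tau$ has exactly one nonzero eigenvalue $a$, and $dQ/d\tau=2a$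 at $\tau(y)$ (a one-sided derivative if $\tau(y)$ is an endpoint of $I$). (iii) $Q>0$ on $I^\circ$, and the integral $\lambda=\int_I Q^{-1/2}\,d\tau$ is finite. (iv) $\lambda$ is the distance between the levels $\tau^{-1}(\tau_{\min})$ and $\tau^{-1}(\tau_{\max})$, that is, the infimum of $\mathrm{dist}(x,y)$ over $x,y\in M$ with $\tau(x)=\tau_{\min}$, $\tau(y)=\tau_{\max}$. (v) The assignment $\tau\mapsto s$ characterized by $ds/d\tau=Q^{-1/2}$ on $I^\circ$, continuity on $I$, and $s=0$ at $\tau=\tau_{\min}$ exists, and is a homeomorphism $I\to[0,\lambda]$ that maps $I^\circ$ $C^\infty$-diffeomorphically onto $(0,\lambda)$. (vi) For every $x\in M$, $s(\tau(x))$ is the distance from $x$ to the minimum level $\tau^{-1}(\tau_{\min})$. -/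

import Mathlib

open Bundle
open scoped Manifold ContDiff Topology

noncomputable section

namespace RiemGeom


section LeviCivita

variable {E : Type*} [NormedAddCommGroup E] [NormedSpace ℝ E] [FiniteDimensional ℝ E]
  {M : Type*} [TopologicalSpace M] [ChartedSpace E M]
  [RiemannianBundle (fun x : M ↦ TangentSpace 𝓘(ℝ, E) x)]

theorem complete_tangent (x : M) : CompleteSpace (TangentSpace 𝓘(ℝ, E) x) :=
  haveI : FiniteDimensional ℝ (TangentSpace 𝓘(ℝ, E) x) := inferInstanceAs (FiniteDimensional ℝ E)
  FiniteDimensional.complete ℝ _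

variable [IsManifold 𝓘(ℝ, E) ∞ M]
  [IsContMDiffRiemannianBundle 𝓘(ℝ, E) ∞ E (fun x : M ↦ TangentSpace 𝓘(ℝ, E) x)]

theorem mdiff_inner {X Y : Π x : M, TangentSpace 𝓘(ℝ, E) x} {x : M}
    (hX : MDiffAt (T% X) x) (hY : MDiffAt (T% Y) x) :
    MDiffAt (fun p ↦ inner ℝ (X p) (Y p)) x :=
  MDifferentiableAt.inner_bundle (IB := 𝓘(ℝ, E)) (F := E)
    (E := fun x : M ↦ TangentSpace 𝓘(ℝ, E) x) (b := fun p : M ↦ p) hX hY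

/-- Koszul's expression for `2 g(∇_X Y, Z)` at `x`. -/
def koszul (Y X Z : Π x : M, TangentSpace 𝓘(ℝ, E) x) (x : M) : ℝ :=
  mvfderiv 𝓘(ℝ, E) (fun p ↦ inner ℝ (Y p) (Z p)) x (X x)
    + mvfderiv 𝓘(ℝ, E) (fun p ↦ inner ℝ (X p) (Z p)) x (Y x)
    - mvfderiv 𝓘(ℝ, E) (fun p ↦ inner ℝ (X p) (Y p)) x (Z x)
    + inner ℝ (VectorField.mlieBracket 𝓘(ℝ, E) X Y x) (Z x)
    - inner ℝ (VectorField.mlieBracket 𝓘(ℝ, E) X Z x) (Y x)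
    - inner ℝ (VectorField.mlieBracket 𝓘(ℝ, E) Y Z x) (X x)

theorem koszul_tensorial_left {Y Z : Π x : M, TangentSpace 𝓘(ℝ, E) x} {x : M}
    (hY : MDiffAt (T% Y) x) (hZ : MDiffAt (T% Z) x) :
    TensorialAt 𝓘(ℝ, E) E (fun X ↦ koszul Y X Z x) x where
  smul {f X} hf hX := by
    have e1 : (fun p ↦ inner ℝ ((f • X) p) (Z p)) = f * (fun p ↦ inner ℝ (X p) (Z p)) := by
      ext p; simp [inner_smul_left]
    have e2 : (fun p ↦ inner ℝ ((f • X) p) (Y p)) = f * (fun p ↦ inner ℝ (X p) (Y p)) := by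
      ext p; simp [inner_smul_left]
    simp only [koszul, e1, e2]
    rw [mvfderiv_mul hf (mdiff_inner hX hZ), mvfderiv_mul hf (mdiff_inner hX hY),
      VectorField.mlieBracket_smul_left hf hX, VectorField.mlieBracket_smul_left hf hX]
    simp [inner_add_left, inner_smul_left, inner_smul_right]
    ring
  add {X X'} hX hX' := by
    have e1 : (fun p ↦ inner ℝ ((X + X') p) (Z p)) =
        (fun p ↦ inner ℝ (X p) (Z p)) + (fun p ↦ inner ℝ (X' p) (Z p)) := by
      ext p; simp [inner_add_left]
    have e2 : (fun p ↦ inner ℝ ((X + X') p) (Y p)) =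
        (fun p ↦ inner ℝ (X p) (Y p)) + (fun p ↦ inner ℝ (X' p) (Y p)) := by
      ext p; simp [inner_add_left]
    simp only [koszul, e1, e2]
    rw [mvfderiv_add (mdiff_inner hX hZ) (mdiff_inner hX' hZ),
      mvfderiv_add (mdiff_inner hX hY) (mdiff_inner hX' hY),
      VectorField.mlieBracket_add_left hX hX', VectorField.mlieBracket_add_left hX hX']
    simp [inner_add_left, inner_add_right]
    ring

theorem koszul_tensorial_right {Y X : Π x : M, TangentSpace 𝓘(ℝ, E) x} {x : M}
    (hY : MDiffAt (T% Y) x) (hX : MDiffAt (T% X) x) :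
    TensorialAt 𝓘(ℝ, E) E (fun Z ↦ koszul Y X Z x) x where
  smul {f Z} hf hZ := by
    have e1 : (fun p ↦ inner ℝ (X p) ((f • Z) p)) = f * (fun p ↦ inner ℝ (X p) (Z p)) := by
      ext p; simp [inner_smul_right]
    have e2 : (fun p ↦ inner ℝ (Y p) ((f • Z) p)) = f * (fun p ↦ inner ℝ (Y p) (Z p)) := by
      ext p; simp [inner_smul_right]
    simp only [koszul, e1, e2]
    rw [mvfderiv_mul hf (mdiff_inner hX hZ), mvfderiv_mul hf (mdiff_inner hY hZ),
      VectorField.mlieBracket_smul_right hf hZ, VectorField.mlieBracket_smul_right hf hZ]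
    simp [inner_add_left, inner_smul_left, inner_smul_right]
    rw [real_inner_comm (Y x) (Z x), real_inner_comm (X x) (Z x)]
    ring
  add {Z Z'} hZ hZ' := by
    have e1 : (fun p ↦ inner ℝ (X p) ((Z + Z') p)) =
        (fun p ↦ inner ℝ (X p) (Z p)) + (fun p ↦ inner ℝ (X p) (Z' p)) := by
      ext p; simp [inner_add_right]
    have e2 : (fun p ↦ inner ℝ (Y p) ((Z + Z') p)) =
        (fun p ↦ inner ℝ (Y p) (Z p)) + (fun p ↦ inner ℝ (Y p) (Z' p)) := by
      ext p; simp [inner_add_right]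
    simp only [koszul, e1, e2]
    rw [mvfderiv_add (mdiff_inner hX hZ) (mdiff_inner hX hZ'),
      mvfderiv_add (mdiff_inner hY hZ) (mdiff_inner hY hZ'),
      VectorField.mlieBracket_add_right hZ hZ', VectorField.mlieBracket_add_right hZ hZ']
    simp [inner_add_left, inner_add_right]
    ring

/-- The bilinear form `(u, w) ↦ g(∇_u Y, w)` on `T_x M`, for a field `Y` differentiable at `x`. -/
def covForm (Y : Π x : M, TangentSpace 𝓘(ℝ, E) x) (x : M) (hY : MDiffAt (T% Y) x) :
    TangentSpace 𝓘(ℝ, E) x →L[ℝ] TangentSpace 𝓘(ℝ, E) x →L[ℝ] ℝ :=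
  (1 / 2 : ℝ) • TensorialAt.mkHom₂ (I := 𝓘(ℝ, E)) (F := E) (F' := E) (fun X Z ↦ koszul Y X Z x) x
    (fun _ hZ ↦ koszul_tensorial_left hY hZ) (fun _ hX ↦ koszul_tensorial_right hY hX)

open scoped Classical in
/-- The endomorphism `u ↦ ∇_u Y` of `T_x M`, obtained from `covForm` by the Riesz isomorphism
(and `0` if `Y` is not differentiable at `x`). -/
def leviCivitaFun (Y : Π x : M, TangentSpace 𝓘(ℝ, E) x) (x : M) :
    TangentSpace 𝓘(ℝ, E) x →L[ℝ] TangentSpace 𝓘(ℝ, E) x :=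
  haveI := complete_tangent (E := E) x
  if hY : MDiffAt (T% Y) x then
    InnerProductSpace.continuousLinearMapOfBilin (𝕜 := ℝ) (covForm Y x hY) else 0

theorem inner_leviCivitaFun {Y X Z : Π x : M, TangentSpace 𝓘(ℝ, E) x} {x : M}
    (hY : MDiffAt (T% Y) x) (hX : MDiffAt (T% X) x) (hZ : MDiffAt (T% Z) x) :
    inner ℝ (leviCivitaFun Y x (X x)) (Z x) = koszul Y X Z x / 2 := by
  have := complete_tangent (E := E) x
  have h := TensorialAt.mkHom₂_apply (I := 𝓘(ℝ, E)) (F := E) (F' := E)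
    (Φ := fun X Z ↦ koszul Y X Z x)
    (fun _ hZ ↦ koszul_tensorial_left hY hZ) (fun _ hX ↦ koszul_tensorial_right hY hX) hX hZ
  simp only [leviCivitaFun, hY, dif_pos]
  erw [InnerProductSpace.continuousLinearMapOfBilin_apply]
  simp [covForm, h]
  ring

/-- Two endomorphisms of `T_x M` agree if they pair equally with all differentiable fields. -/
theorem clm_ext {x : M} {A B : TangentSpace 𝓘(ℝ, E) x →L[ℝ] TangentSpace 𝓘(ℝ, E) x}
    (h : ∀ X Z : Π x : M, TangentSpace 𝓘(ℝ, E) x, MDiffAt (T% X) x → MDiffAt (T% Z) x →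
      inner ℝ (A (X x)) (Z x) = inner ℝ (B (X x)) (Z x)) : A = B := by
  ext u
  refine ext_inner_right ℝ fun w ↦ ?_
  simpa using h (FiberBundle.extend E u) (FiberBundle.extend E w)
    (FiberBundle.mdifferentiableAt_extend ..) (FiberBundle.mdifferentiableAt_extend ..)

/-- The Levi-Civita connection, `leviCivita Y x u = (∇_u Y)(x)`. -/
def leviCivita : CovariantDerivative 𝓘(ℝ, E) E (fun x : M ↦ TangentSpace 𝓘(ℝ, E) x) where
  toFun := leviCivitaFun
  isCovariantDerivativeOnUniv :=
    { add := by
        intro Y Y' x hY hY' _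
        refine clm_ext fun X Z hX hZ ↦ ?_
        have e1 : (fun p ↦ inner ℝ ((Y + Y') p) (Z p)) =
            (fun p ↦ inner ℝ (Y p) (Z p)) + (fun p ↦ inner ℝ (Y' p) (Z p)) := by
          ext p; simp [inner_add_left]
        have e2 : (fun p ↦ inner ℝ (X p) ((Y + Y') p)) =
            (fun p ↦ inner ℝ (X p) (Y p)) + (fun p ↦ inner ℝ (X p) (Y' p)) := by
          ext p; simp [inner_add_right]
        rw [inner_leviCivitaFun (mdifferentiableAt_add_section hY hY') hX hZ,
          add_apply, inner_add_left,
          inner_leviCivitaFun hY hX hZ, inner_leviCivitaFun hY' hX hZ]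
        simp only [koszul, e1, e2]
        rw [mvfderiv_add (mdiff_inner hY hZ) (mdiff_inner hY' hZ),
          mvfderiv_add (mdiff_inner hX hY) (mdiff_inner hX hY'),
          VectorField.mlieBracket_add_left hY hY', VectorField.mlieBracket_add_right hY hY']
        simp [inner_add_left, inner_add_right]
        ring
      leibniz := by
        intro Y f x hY hf _
        refine clm_ext fun X Z hX hZ ↦ ?_
        have e1 : (fun p ↦ inner ℝ ((f • Y) p) (Z p)) = f * (fun p ↦ inner ℝ (Y p) (Z p)) := by
          ext p; simp [inner_smul_left]
        have e2 : (fun p ↦ inner ℝ (X p) ((f • Y) p)) = f * (fun p ↦ inner ℝ (X p) (Y p)) := by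
          ext p; simp [inner_smul_right]
        rw [inner_leviCivitaFun (hf.smul_section hY) hX hZ,
          add_apply, inner_add_left, smul_apply,
          inner_smul_left, inner_leviCivitaFun hY hX hZ]
        simp only [koszul, e1, e2]
        rw [mvfderiv_mul hf (mdiff_inner hY hZ), mvfderiv_mul hf (mdiff_inner hX hY),
          VectorField.mlieBracket_smul_left hf hY, VectorField.mlieBracket_smul_right hf hY]
        simp [inner_add_left, inner_smul_left, inner_smul_right]
        rw [real_inner_comm (Y x) (X x)]
        ring }

/-- `∇` is compatible with the metric: `X g(Y, Z) = g(∇_X Y, Z) + g(Y, ∇_X Z)`. -/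
theorem leviCivita_metric {X Y Z : Π x : M, TangentSpace 𝓘(ℝ, E) x} {x : M}
    (hX : MDiffAt (T% X) x) (hY : MDiffAt (T% Y) x) (hZ : MDiffAt (T% Z) x) :
    mvfderiv 𝓘(ℝ, E) (fun p ↦ inner ℝ (Y p) (Z p)) x (X x) =
      inner ℝ (leviCivita Y x (X x)) (Z x) + inner ℝ (Y x) (leviCivita Z x (X x)) := by
  have h1 := inner_leviCivitaFun hY hX hZ
  have h2 := inner_leviCivitaFun hZ hX hY
  change _ = inner ℝ (leviCivitaFun Y x (X x)) (Z x) + inner ℝ (Y x) (leviCivitaFun Z x (X x))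
  rw [real_inner_comm (leviCivitaFun Z x (X x)), h1, h2]
  have c : (fun p ↦ inner ℝ (Z p) (Y p)) = (fun p ↦ inner ℝ (Y p) (Z p)) := by
    ext p; exact real_inner_comm _ _
  simp only [koszul, c, VectorField.mlieBracket_swap_apply (V := Z) (W := Y), inner_neg_left]
  ring

/-- `∇` is torsion-free. -/
theorem leviCivita_torsion : (leviCivita (E := E) (M := M)).torsion = 0 := by
  have : CompleteSpace E := FiniteDimensional.complete ℝ E
  rw [CovariantDerivative.torsion_eq_zero_iff]
  intro X Y x hX hY
  refine ext_inner_right ℝ fun w ↦ ?_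
  obtain ⟨Z, hZ, rfl⟩ : ∃ Z : Π x : M, TangentSpace 𝓘(ℝ, E) x, MDiffAt (T% Z) x ∧ Z x = w :=
    ⟨FiberBundle.extend E w, FiberBundle.mdifferentiableAt_extend .., by simp⟩
  change inner ℝ (leviCivitaFun Y x (X x) - leviCivitaFun X x (Y x)) (Z x) = _
  rw [inner_sub_left, inner_leviCivitaFun hY hX hZ, inner_leviCivitaFun hX hY hZ]
  have c : (fun p ↦ inner ℝ (Y p) (X p)) = (fun p ↦ inner ℝ (X p) (Y p)) := by
    ext p; exact real_inner_comm _ _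
  simp only [koszul, c, VectorField.mlieBracket_swap_apply (V := Y) (W := X), inner_neg_left]
  ring

end LeviCivita

section Functions

variable (E : Type*) [NormedAddCommGroup E] [NormedSpace ℝ E] [FiniteDimensional ℝ E]
  {M : Type*} [TopologicalSpace M] [ChartedSpace E M]

/-- The set of critical points of `τ`. -/
def critSet (τ : M → ℝ) : Set M := {x | mvfderiv 𝓘(ℝ, E) τ x = 0}

/-- The connected component of the critical set of `τ` that contains the critical point `x`. -/
def critComponent (τ : M → ℝ) (x : M) : Set M := connectedComponentIn (critSet E τ) x

/-- `S` is an (embedded, `C^∞`) submanifold of `M` of codimension `k` at each of its points: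
near each point it is, in some chart of the smooth structure, an affine subspace of
codimension `k`. -/
def IsSubmanifoldOfCodim (k : ℕ) (S : Set M) : Prop :=
  ∀ y ∈ S, ∃ φ ∈ IsManifold.maximalAtlas 𝓘(ℝ, E) ∞ M, y ∈ φ.source ∧
    ∃ F : Submodule ℝ E, Module.finrank ℝ (E ⧸ F) = k ∧
      ∀ x ∈ φ.source, x ∈ S ↔ φ x - φ y ∈ F

variable [RiemannianBundle (fun x : M ↦ TangentSpace 𝓘(ℝ, E) x)]

/-- The gradient of `τ`: `g(grad τ, w) = dτ(w)`. -/
def grad (τ : M → ℝ) (x : M) : TangentSpace 𝓘(ℝ, E) x :=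
  haveI := complete_tangent (E := E) x
  (InnerProductSpace.toDual ℝ (TangentSpace 𝓘(ℝ, E) x)).symm (mvfderiv 𝓘(ℝ, E) τ x)

/-- `Q = g(grad τ, grad τ)`. -/
def gradSq (τ : M → ℝ) (x : M) : ℝ := inner ℝ (grad E τ x) (grad E τ x)

variable [IsManifold 𝓘(ℝ, E) ∞ M]
  [IsContMDiffRiemannianBundle 𝓘(ℝ, E) ∞ E (fun x : M ↦ TangentSpace 𝓘(ℝ, E) x)]

/-- The Hessian `∇dτ` at `x`, as the endomorphism `u ↦ ∇_u (grad τ)` of `T_x M` that corresponds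
to it via `g`. -/
def hess (τ : M → ℝ) (x : M) : TangentSpace 𝓘(ℝ, E) x →L[ℝ] TangentSpace 𝓘(ℝ, E) x :=
  leviCivita (grad E τ) x

/-- `v = grad τ` is a geodesic vector field: `∇_v v = ψ v` wherever `v ≠ 0`, for some
function `ψ`. -/
def HasGeodesicGradient (τ : M → ℝ) : Prop :=
  ∃ ψ : M → ℝ, ∀ x, grad E τ x ≠ 0 →
    leviCivita (grad E τ) x (grad E τ x) = ψ x • grad E τ x

/-- Morse–Bott functions: `C^∞` functions for which the connected components of the critical set
are mutually isolated submanifolds, the rank of the Hessian at each critical point being the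
codimension of the component that contains the point. -/
def IsMorseBott (τ : M → ℝ) : Prop :=
  ContMDiff 𝓘(ℝ, E) 𝓘(ℝ, ℝ) ∞ τ ∧
  ∀ x ∈ critSet E τ,
    (∃ U : Set M, IsOpen U ∧ U ∩ critSet E τ = critComponent E τ x) ∧
    ∃ k : ℕ, IsSubmanifoldOfCodim E k (critComponent E τ x) ∧
      ∀ y ∈ critComponent E τ x,
        Module.finrank ℝ (hess E τ y : TangentSpace 𝓘(ℝ, E) y →ₗ[ℝ] TangentSpace 𝓘(ℝ, E) y).range = k

end Functions

/-- `f` maps `A` homeomorphically onto `B`. -/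
def IsHomeoOn (f : ℝ → ℝ) (A B : Set ℝ) : Prop :=
  ∃ h : ℝ → ℝ, Set.MapsTo f A B ∧ Set.MapsTo h B A ∧ Set.InvOn h f A B ∧
    ContinuousOn f A ∧ ContinuousOn h B

/-- `f` maps `A` `C^∞`-diffeomorphically onto `B`. -/
def IsDiffeoOn (f : ℝ → ℝ) (A B : Set ℝ) : Prop :=
  ∃ h : ℝ → ℝ, Set.MapsTo f A B ∧ Set.MapsTo h B A ∧ Set.InvOn h f A B ∧
    ContDiffOn ℝ ∞ f A ∧ ContDiffOn ℝ ∞ h B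

end RiemGeom

end

open RiemGeom

/-!
Where `dτ ≠ 0`, the geodesic gradient condition makes `dQ` a multiple of `dτ`, so `Q` is locally
constant on the levels of `τ`. Differentiating the condition at a critical point shows that the
Hessian `A` satisfies `A² = a A`, so `τ` is definite across its critical manifolds; as these have
codimension greater than one, sublevel and superlevel sets are locally connected near them. Hence
the levels of `τ` are connected, `Q = χ ∘ τ`, and all critical points are extrema. Near an extremum,
`τ` is plus or minus a square `s²` along a transverse line, on which `Q` is even in `s`: this makes
`χ` smooth up to the endpoints, with derivative `2 a`, and makes `Q ^ (-1/2)` integrable.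

The primitive `s` of `Q ^ (-1/2)` turns `τ` into a function `s ∘ τ` whose gradient has norm one off
the extreme levels. It is therefore 1-Lipschitz, and following `-∇τ` decreases it at unit speed
until the minimum level is reached: `s ∘ τ` is the distance to that level. Integral curves are
avoided by minimizing `k * s ∘ τ + dist x` for `k > 1`: a minimum point must lie on the minimum
level.
-/

noncomputable section

namespace RiemGeom

open Filter Set

section ParametricIntegral

variable {E F : Type*} [NormedAddCommGroup E] [NormedSpace ℝ E] [NormedAddCommGroup F]
  [NormedSpace ℝ F]

theorem hasFDerivAt_intervalIntegral_of_contDiff {f : E × ℝ → F} (hf : ContDiff ℝ 1 f)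
    (a b : ℝ) (x : E) :
    HasFDerivAt (fun y ↦ ∫ t in a..b, f (y, t))
      (∫ t in a..b, (fderiv ℝ f (x, t)).comp (.inl ℝ E ℝ)) x := by
  have hf' : Continuous (fderiv ℝ f) := hf.continuous_fderiv one_ne_zero
  have hg : Continuous fun p : E × ℝ ↦ (fderiv ℝ f p).comp (.inl ℝ E ℝ) :=
    hf'.clm_comp continuous_const
  obtain ⟨C, hC⟩ := (isCompact_uIcc (a := a) (b := b)).exists_bound_of_continuousOn
    (f := fun t ↦ (fderiv ℝ f (x, t)).comp (.inl ℝ E ℝ)) (by fun_prop)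
  have hbound : ∀ᶠ y in 𝓝 x, ∀ t ∈ uIcc a b,
      ‖(fderiv ℝ f (y, t)).comp (.inl ℝ E ℝ)‖ < C + 1 := by
    refine isCompact_uIcc.eventually_forall_of_forall_eventually fun t ht ↦ ?_
    exact hg.norm.continuousAt.eventually_lt continuousAt_const
      ((hC t ht).trans_lt (lt_add_one C))
  refine intervalIntegral.hasFDerivAt_integral_of_dominated_of_fderiv_le
    (F' := fun y t ↦ (fderiv ℝ f (y, t)).comp (.inl ℝ E ℝ)) (bound := fun _ ↦ C + 1) hbound
    (.of_forall fun y ↦ Continuous.aestronglyMeasurable (by fun_prop))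
    (Continuous.intervalIntegrable (by fun_prop) _ _)
    (Continuous.aestronglyMeasurable (by fun_prop))
    (.of_forall fun t ht y hy ↦ (hy t (uIoc_subset_uIcc ht)).le) intervalIntegrable_const
    (.of_forall fun t _ y _ ↦ ?_)
  exact (hf.differentiable one_ne_zero (y, t)).hasFDerivAt.comp y (hasFDerivAt_prodMk_left y t)

theorem contDiff_intervalIntegral {n : ℕ} {f : ℝ × ℝ → F} (hf : ContDiff ℝ n f) (a b : ℝ) :
    ContDiff ℝ n fun x ↦ ∫ t in a..b, f (x, t) := by
  induction n generalizing F with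
  | zero =>
    have := hf.continuous
    exact contDiff_zero.2 (intervalIntegral.continuous_parametric_intervalIntegral_of_continuous'
      (by fun_prop) _ _)
  | succ n ih =>
    have h1 : ContDiff ℝ 1 f := hf.of_le (by exact_mod_cast Nat.le_add_left 1 n)
    push_cast at hf ⊢
    refine contDiff_succ_iff_hasFDerivAt.2 ⟨_,
      ih (f := fun p ↦ (fderiv ℝ f p).comp (.inl ℝ ℝ ℝ)) ?_,
      fun x ↦ hasFDerivAt_intervalIntegral_of_contDiff h1 a b x⟩
    exact (contDiff_succ_iff_fderiv.1 hf).2.2.clm_comp contDiff_const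

end ParametricIntegral

theorem exists_contDiff_eventuallyEq {E F : Type*} [NormedAddCommGroup E] [NormedSpace ℝ E]
    [HasContDiffBump E] [NormedAddCommGroup F] [NormedSpace ℝ F] {n : ℕ} {f : E → F} {x : E}
    (hf : ContDiffAt ℝ n f x) : ∃ g : E → F, ContDiff ℝ n g ∧ g =ᶠ[𝓝 x] f := by
  obtain ⟨u, hu, hfu⟩ := hf.contDiffOn le_rfl (by simp)
  obtain ⟨ε, hε, hball⟩ := Metric.mem_nhds_iff.1 hu
  let φ : ContDiffBump x := ⟨ε / 4, ε / 2, by positivity, by linarith⟩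
  refine ⟨fun y ↦ φ y • f y, contDiff_iff_contDiffAt.2 fun y ↦ ?_, ?_⟩
  · by_cases hy : y ∈ Metric.ball x ε
    · exact φ.contDiffAt.smul ((hfu.mono hball).contDiffAt (Metric.isOpen_ball.mem_nhds hy))
    · have hy' : y ∉ Metric.closedBall x (ε / 2) := fun h ↦
        hy (Metric.closedBall_subset_ball (by linarith) h)
      refine contDiffAt_const.congr_of_eventuallyEq (f := fun _ ↦ (0 : F)) ?_
      filter_upwards [Metric.isClosed_closedBall.isOpen_compl.mem_nhds hy'] with z hz
      rw [φ.zero_of_le_dist (not_le.1 (Metric.mem_closedBall.not.1 hz)).le, zero_smul]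
  · filter_upwards [φ.eventuallyEq_one] with y hy
    simp [hy]

theorem eventually_differentiableAt {E F : Type*} [NormedAddCommGroup E]
    [NormedSpace ℝ E] [NormedAddCommGroup F] [NormedSpace ℝ F] {f : E → F} {x : E}
    (hf : ContDiffAt ℝ ∞ f x) : ∀ᶠ y in 𝓝 x, DifferentiableAt ℝ f y :=
  ((hf.of_le (m := 1) (by simp)).eventually (by simp)).mono
    fun _ hy ↦ hy.differentiableAt one_ne_zero

section DSlope

variable {F : Type*} [NormedAddCommGroup F] [NormedSpace ℝ F]

theorem dslope_eq_integral_deriv [CompleteSpace F] {f : ℝ → F} (hf : ContDiff ℝ 1 f) (a x : ℝ) :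
    dslope f a x = ∫ t in (0 : ℝ)..1, deriv f (a + (x - a) * t) := by
  rcases eq_or_ne x a with rfl | hx
  · simp
  · have hx' := sub_ne_zero.2 hx
    have hint := intervalIntegral.integral_deriv_eq_sub (a := a) (b := x)
      (fun y _ ↦ hf.differentiable one_ne_zero y)
      ((hf.continuous_deriv le_rfl).intervalIntegrable _ _)
    rw [dslope_of_ne _ hx, slope_def_module, ← hint,
      intervalIntegral.integral_comp_add_mul (deriv f) hx']
    simp

theorem contDiffAt_dslope [CompleteSpace F] {f : ℝ → F} {a : ℝ} (hf : ContDiffAt ℝ ∞ f a) :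
    ContDiffAt ℝ ∞ (dslope f a) a := by
  refine contDiffAt_infty.2 fun n ↦ ?_
  obtain ⟨g, hg, hgf⟩ := exists_contDiff_eventuallyEq (contDiffAt_infty.1 hf (n + 1))
  have hg1 : ContDiff ℝ 1 g := hg.of_le (by exact_mod_cast Nat.le_add_left 1 n)
  have hdslope : dslope f a =ᶠ[𝓝 a] fun x ↦ ∫ t in (0 : ℝ)..1, deriv g (a + (x - a) * t) := by
    filter_upwards [hgf] with x hx
    rw [← dslope_eq_integral_deriv hg1]
    rcases eq_or_ne x a with rfl | hxa
    · simp [hgf.deriv_eq]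
    · simp [dslope_of_ne _ hxa, slope_def_module, hx, hgf.eq_of_nhds]
  push_cast at hg
  have hg' : ContDiff ℝ n (deriv g) := (contDiff_succ_iff_deriv.1 hg).2.2
  exact (contDiff_intervalIntegral (f := fun p : ℝ × ℝ ↦ deriv g (a + (p.1 - a) * p.2))
    (hg'.comp (by fun_prop)) 0 1).contDiffAt.congr_of_eventuallyEq hdslope

theorem contDiffAt_deriv {f : ℝ → F} {x : ℝ} (hf : ContDiffAt ℝ ∞ f x) :
    ContDiffAt ℝ ∞ (deriv f) x := by
  have := (hf.fderiv_right (m := ∞) (by simp)).clm_apply (contDiffAt_const (c := (1 : ℝ)))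
  simpa only [fderiv_apply_one_eq_deriv] using this

theorem deriv_dslope_same [CompleteSpace F] {f : ℝ → F} {a : ℝ} (hf : ContDiffAt ℝ ∞ f a) :
    deriv (dslope f a) a = (2 : ℝ)⁻¹ • deriv (deriv f) a := by
  have hs := contDiffAt_dslope hf
  have hderiv : deriv f =ᶠ[𝓝 a] fun x ↦ dslope f a x + (x - a) • deriv (dslope f a) x := by
    filter_upwards [eventually_differentiableAt hs] with x hx
    have hprod := (((hasDerivAt_id x).sub_const a).smul hx.hasDerivAt).add_const (f a)
    have hf_eq : (fun x ↦ (x - a) • dslope f a x + f a) = f := by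
      ext y
      rw [sub_smul_dslope, sub_add_cancel]
    rw [← show _ = deriv f x from congrArg (deriv · x) hf_eq]
    refine hprod.deriv.trans ?_
    simp [add_comm]
  have h2 : HasDerivAt (fun x ↦ dslope f a x + (x - a) • deriv (dslope f a) x)
      (deriv (dslope f a) a + ((a - a) • deriv (deriv (dslope f a)) a
        + (1 : ℝ) • deriv (dslope f a) a)) a :=
    (hs.differentiableAt (by simp)).hasDerivAt.add (((hasDerivAt_id a).sub_const a).smul
      ((contDiffAt_deriv hs).differentiableAt (by simp)).hasDerivAt)
  rw [hderiv.deriv_eq, h2.deriv, sub_self, zero_smul, zero_add, one_smul, ← two_smul ℝ,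
    inv_smul_smul₀ two_ne_zero]

theorem sub_eq_sq_mul_dslope_dslope {f : ℝ → ℝ} {a : ℝ} (h : deriv f a = 0) (x : ℝ) :
    f x - f a = (x - a) ^ 2 * dslope (dslope f a) a x := by
  have h1 := sub_smul_dslope f a x
  have h2 := sub_smul_dslope (dslope f a) a x
  rw [dslope_same, h, sub_zero] at h2
  rw [← h1, ← h2, smul_eq_mul, smul_eq_mul]
  ring

theorem tendsto_sub_div_sq {f : ℝ → ℝ} {a : ℝ} (hf : ContDiffAt ℝ ∞ f a) (h : deriv f a = 0) :
    Tendsto (fun x ↦ (f x - f a) / (x - a) ^ 2) (𝓝[≠] a) (𝓝 (deriv (deriv f) a / 2)) := by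
  have hlim := (contDiffAt_dslope (contDiffAt_dslope hf)).continuousAt.tendsto.mono_left
    (nhdsWithin_le_nhds (s := {a}ᶜ))
  rw [dslope_same, deriv_dslope_same hf, smul_eq_mul, inv_mul_eq_div] at hlim
  refine hlim.congr' ?_
  filter_upwards [self_mem_nhdsWithin] with x hx
  rw [sub_eq_sq_mul_dslope_dslope h, mul_div_cancel_left₀ _ (pow_ne_zero 2 (sub_ne_zero.2 hx))]

end DSlope

section EvenFunction

theorem tendsto_sqrt_zero : Tendsto Real.sqrt (𝓝 0) (𝓝 0) := by
  simpa using Real.continuous_sqrt.tendsto 0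

variable {f : ℝ → ℝ} (he : ∀ᶠ x in 𝓝 0, f (-x) = f x)

include he in
theorem eventually_deriv_neg_of_even : ∀ᶠ x in 𝓝 0, deriv f (-x) = -deriv f x := by
  filter_upwards [he.eventually_nhds] with x hx
  have hderiv : deriv (fun y ↦ f (-y)) x = deriv f x := EventuallyEq.deriv_eq hx
  rw [← hderiv, deriv_comp_neg, neg_neg]

include he in
theorem deriv_zero_of_even : deriv f 0 = 0 :=
  self_eq_neg.1 (by simpa using (eventually_deriv_neg_of_even he).self_of_nhds)

include he in
theorem eventually_dslope_deriv_neg_of_even :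
    ∀ᶠ x in 𝓝 0, dslope (deriv f) 0 (-x) = dslope (deriv f) 0 x := by
  filter_upwards [eventually_deriv_neg_of_even he] with x hx
  rcases eq_or_ne x 0 with rfl | hx0
  · simp
  · rw [dslope_of_ne _ hx0, dslope_of_ne _ (neg_ne_zero.2 hx0), slope_def_field, slope_def_field,
      hx, deriv_zero_of_even he, sub_zero, sub_zero, sub_zero, sub_zero, neg_div_neg_eq]

theorem hasDerivAt_comp_sqrt (h : deriv f 0 = 0) {u : ℝ} (hu : 0 < u)
    (hf : DifferentiableAt ℝ f (√u)) :
    HasDerivAt (fun u ↦ f (√u)) (dslope (deriv f) 0 (√u) / 2) u := by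
  refine (hf.hasDerivAt.comp u (Real.hasDerivAt_sqrt hu.ne')).congr_deriv ?_
  rw [dslope_of_ne _ (Real.sqrt_ne_zero'.2 hu), slope_def_field, h]
  ring

theorem hasDerivWithinAt_comp_sqrt_zero (hf : ContDiffAt ℝ ∞ f 0) (h : deriv f 0 = 0) :
    HasDerivWithinAt (fun u ↦ f (√u)) (dslope (deriv f) 0 (√0) / 2) (Ici 0) 0 := by
  rw [hasDerivWithinAt_iff_tendsto_slope, Ici_sdiff_left, Real.sqrt_zero, dslope_same]
  have hsqrt : Tendsto Real.sqrt (𝓝[>] 0) (𝓝[≠] 0) :=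
    tendsto_nhdsWithin_iff.2 ⟨tendsto_sqrt_zero.mono_left nhdsWithin_le_nhds,
      eventually_mem_nhdsWithin.mono fun u hu ↦ Real.sqrt_ne_zero'.2 hu⟩
  refine ((tendsto_sub_div_sq hf h).comp hsqrt).congr' ?_
  filter_upwards [self_mem_nhdsWithin] with u hu
  simp only [Function.comp, slope_def_field, sub_zero, Real.sqrt_zero,
    Real.sq_sqrt (mem_Ioi.1 hu).le]

/-- Whitney's theorem on even functions. -/
theorem contDiffWithinAt_comp_sqrt (hf : ContDiffAt ℝ ∞ f 0) (he : ∀ᶠ x in 𝓝 0, f (-x) = f x) :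
    ContDiffWithinAt ℝ ∞ (fun u ↦ f (√u)) (Ici 0) 0 := by
  refine contDiffWithinAt_infty.2 fun n ↦ ?_
  induction n generalizing f with
  | zero =>
    have hcont : ∀ᶠ u in 𝓝[≥] 0, ContinuousAt f (√u) := mem_nhdsWithin_of_mem_nhds
      (tendsto_sqrt_zero.eventually ((eventually_differentiableAt hf).mono
        fun _ hx ↦ hx.continuousAt))
    exact contDiffWithinAt_zero self_mem_Ici |>.2 ⟨_, hcont, fun u hu ↦
      (hu.2.comp Real.continuous_sqrt.continuousAt).continuousWithinAt⟩
  | succ n ih =>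
    have h0 := deriv_zero_of_even he
    push_cast
    refine (contDiffWithinAt_succ_iff_hasFDerivWithinAt' (by simp)).2
      ⟨{u | 0 ≤ u ∧ DifferentiableAt ℝ f (√u)}, ?_, fun u hu ↦ mem_insert_of_mem _ hu.1, by simp,
      fun u ↦ ContinuousLinearMap.toSpanSingletonCLE (𝕜 := ℝ) (dslope (deriv f) 0 (√u) / 2),
      ?_, ?_⟩
    · rw [insert_eq_of_mem self_mem_Ici]
      exact eventually_mem_nhdsWithin.and (mem_nhdsWithin_of_mem_nhds
        (tendsto_sqrt_zero.eventually (eventually_differentiableAt hf)))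
    · rintro u ⟨hu, hfu⟩
      rcases hu.eq_or_lt with rfl | hu
      · exact (hasDerivWithinAt_comp_sqrt_zero hf h0).hasFDerivWithinAt
      · exact (hasDerivAt_comp_sqrt h0 hu hfu).hasDerivWithinAt.hasFDerivWithinAt
    · exact (ContinuousLinearEquiv.contDiff _).contDiffAt.comp_contDiffWithinAt 0
        ((ih (contDiffAt_dslope (contDiffAt_deriv hf))
          (eventually_dslope_deriv_neg_of_even he)).div_const 2)

end EvenFunction

theorem exists_contDiffAt_rightInverse {σ : ℝ → ℝ} {x : ℝ} (hσ : ContDiffAt ℝ ∞ σ x)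
    (h : deriv σ x ≠ 0) :
    ∃ ρ : ℝ → ℝ, ContDiffAt ℝ ∞ ρ (σ x) ∧ ρ (σ x) = x ∧ ∀ᶠ s in 𝓝 (σ x), σ (ρ s) = s := by
  have hd : HasFDerivAt σ ((ContinuousLinearEquiv.unitsEquivAut ℝ (Units.mk0 _ h) :
      ℝ ≃L[ℝ] ℝ) : ℝ →L[ℝ] ℝ) x :=
    (hσ.differentiableAt (by simp)).hasDerivAt.hasFDerivAt.congr_fderiv (by ext; simp)
  exact ⟨hσ.localInverse hd (by simp), hσ.to_localInverse hd (by simp),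
    hσ.localInverse_apply_image hd (by simp),
    (hσ.hasStrictFDerivAt' hd (by simp)).eventually_right_inverse⟩

theorem exists_eventually_comp_eq_add_sq {T : ℝ → ℝ} {x : ℝ} (hT : ContDiffAt ℝ ∞ T x)
    (h1 : deriv T x = 0) (h2 : 0 < deriv (deriv T) x) :
    ∃ ρ : ℝ → ℝ, ContDiffAt ℝ ∞ ρ 0 ∧ ρ 0 = x ∧ ∀ᶠ s in 𝓝 0, T (ρ s) = T x + s ^ 2 := by
  set k := dslope (dslope T x) x
  have hk : ContDiffAt ℝ ∞ k x := contDiffAt_dslope (contDiffAt_dslope hT)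
  have hkx : 0 < k x := by
    simp only [k, dslope_same, deriv_dslope_same hT]
    positivity
  have hsqrt : ContDiffAt ℝ ∞ (fun y ↦ √(k y)) x := hk.sqrt hkx.ne'
  have hσ : ContDiffAt ℝ ∞ (fun y ↦ (y - x) * √(k y)) x := (by fun_prop : ContDiffAt ℝ ∞
    (fun y ↦ y - x) x).mul hsqrt
  have hσ' : deriv (fun y ↦ (y - x) * √(k y)) x ≠ 0 := by
    have := ((hasDerivAt_id x).sub_const x).mul (hsqrt.differentiableAt (by simp)).hasDerivAt
    rw [show deriv (fun y ↦ (y - x) * √(k y)) x = _ from this.deriv]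
    simpa using (Real.sqrt_pos.2 hkx).ne'
  obtain ⟨ρ, hρ, hρx, hinv⟩ := exists_contDiffAt_rightInverse hσ hσ'
  rw [sub_self, zero_mul] at hρ hρx hinv
  refine ⟨ρ, hρ, hρx, ?_⟩
  have hlim : Tendsto ρ (𝓝 0) (𝓝 x) := by simpa only [ContinuousAt, hρx] using hρ.continuousAt
  filter_upwards [hinv, hlim.eventually (hk.continuousAt.eventually (lt_mem_nhds hkx))]
    with s hs hpos
  have hsq : (ρ s - x) ^ 2 * k (ρ s) = s ^ 2 := by
    rw [← Real.sq_sqrt hpos.le, ← mul_pow, hs]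
  exact eq_add_of_sub_eq' ((sub_eq_sq_mul_dslope_dslope h1 _).trans hsq)

section Line

variable {E : Type*} [NormedAddCommGroup E] [NormedSpace ℝ E] {F : E → ℝ} {x : E}

theorem contDiffAt_line (hF : ContDiffAt ℝ ∞ F x) (w : E) :
    ContDiffAt ℝ ∞ (fun r : ℝ ↦ F (x + r • w)) 0 :=
  ContDiffAt.comp (0 : ℝ) (by simpa using hF) (by fun_prop)

theorem tendsto_line (x w : E) : Tendsto (fun r : ℝ ↦ x + r • w) (𝓝 0) (𝓝 x) := by
  have : Continuous fun r : ℝ ↦ x + r • w := by fun_prop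
  simpa using this.tendsto 0

theorem hasDerivAt_line {w : E} {r : ℝ} (hF : DifferentiableAt ℝ F (x + r • w)) :
    HasDerivAt (fun r : ℝ ↦ F (x + r • w)) (fderiv ℝ F (x + r • w) w) r :=
  hF.hasFDerivAt.comp_hasDerivAt r
    (by simpa using ((hasDerivAt_id r).smul_const w).const_add x)

theorem deriv_line (hF : DifferentiableAt ℝ F x) (w : E) :
    deriv (fun r : ℝ ↦ F (x + r • w)) 0 = fderiv ℝ F x w := by
  simpa using (hasDerivAt_line (x := x) (w := w) (r := 0) (by simpa using hF)).deriv

theorem deriv_deriv_line (hF : ContDiffAt ℝ ∞ F x) (w : E) :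
    deriv (deriv fun r : ℝ ↦ F (x + r • w)) 0 = fderiv ℝ (fderiv ℝ F) x w w := by
  have hderiv : deriv (fun r : ℝ ↦ F (x + r • w)) =ᶠ[𝓝 0] fun r ↦ fderiv ℝ F (x + r • w) w := by
    filter_upwards [(tendsto_line x w).eventually (eventually_differentiableAt hF)] with r hr
      using (hasDerivAt_line hr).deriv
  have hF' : HasFDerivAt (fun y ↦ fderiv ℝ F y w) ((fderiv ℝ (fderiv ℝ F) x).flip w) x := by
    simpa using ((hF.fderiv_right (m := ∞) (by simp)).differentiableAt
      (by simp)).hasFDerivAt.clm_apply (hasFDerivAt_const w x)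
  rw [hderiv.deriv_eq, deriv_line hF'.differentiableAt, hF'.fderiv]
  rfl

theorem tendsto_line_sub_div_sq (hF : ContDiffAt ℝ ∞ F x) (h : fderiv ℝ F x = 0) (w : E) :
    Tendsto (fun r : ℝ ↦ (F (x + r • w) - F x) / r ^ 2) (𝓝[≠] 0)
      (𝓝 (fderiv ℝ (fderiv ℝ F) x w w / 2)) := by
  have hderiv : deriv (fun r : ℝ ↦ F (x + r • w)) 0 = 0 := by
    rw [deriv_line (hF.differentiableAt (by simp)), h, zero_apply]
  simpa [deriv_deriv_line hF] using tendsto_sub_div_sq (contDiffAt_line hF w) hderiv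

variable {T q : E → ℝ} {χ : ℝ → ℝ}

theorem contDiffAt_of_eventually_eq_comp (hT : ContDiffAt ℝ ∞ T x) (hq : ContDiffAt ℝ ∞ q x)
    (hq_eq : ∀ᶠ y in 𝓝 x, q y = χ (T y)) (h : fderiv ℝ T x ≠ 0) : ContDiffAt ℝ ∞ χ (T x) := by
  obtain ⟨w, hw⟩ := DFunLike.ne_iff.1 h
  rw [← deriv_line (hT.differentiableAt (by simp))] at hw
  obtain ⟨ρ, hρ, hρ0, hinv⟩ := exists_contDiffAt_rightInverse (contDiffAt_line hT w) hw
  simp only [zero_smul, add_zero] at hρ hρ0 hinv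
  have hlim : Tendsto ρ (𝓝 (T x)) (𝓝 0) := by simpa only [ContinuousAt, hρ0] using hρ.continuousAt
  have hqρ : ContDiffAt ℝ ∞ (fun s ↦ q (x + ρ s • w)) (T x) :=
    ContDiffAt.comp (T x) (g := fun r : ℝ ↦ q (x + r • w))
      (by rw [hρ0]; exact contDiffAt_line hq w) hρ
  refine hqρ.congr_of_eventuallyEq ?_
  filter_upwards [hinv, hlim.eventually ((tendsto_line x w).eventually hq_eq)] with s hs hqs
  rw [hqs, hs]

/-- Along a line on which `T - T x` is the square of a parameter `s`, the function `q` is even in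
`s`, hence smooth in `s ^ 2`. -/
theorem contDiffWithinAt_Ici_of_eventually_eq_comp (hT : ContDiffAt ℝ ∞ T x)
    (hq : ContDiffAt ℝ ∞ q x) (hq_eq : ∀ᶠ y in 𝓝 x, q y = χ (T y)) (h1 : fderiv ℝ T x = 0) {w : E}
    (h2 : 0 < fderiv ℝ (fderiv ℝ T) x w w) : ContDiffWithinAt ℝ ∞ χ (Ici (T x)) (T x) := by
  rw [← deriv_deriv_line hT] at h2
  obtain ⟨ρ, hρ, hρ0, hTρ⟩ := exists_eventually_comp_eq_add_sq (contDiffAt_line hT w)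
    (by rw [deriv_line (hT.differentiableAt (by simp)), h1, zero_apply]) h2
  have hlim : Tendsto ρ (𝓝 0) (𝓝 0) := by simpa only [ContinuousAt, hρ0] using hρ.continuousAt
  set g : ℝ → ℝ := fun s ↦ q (x + ρ s • w)
  have hg : ContDiffAt ℝ ∞ g 0 :=
    ContDiffAt.comp (0 : ℝ) (g := fun r : ℝ ↦ q (x + r • w))
      (by rw [hρ0]; exact contDiffAt_line hq w) hρ
  have hgχ : ∀ᶠ s in 𝓝 0, g s = χ (T x + s ^ 2) := by
    filter_upwards [hTρ, hlim.eventually ((tendsto_line x w).eventually hq_eq)] with s hs hqs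
    simp only [g, hqs, hs, zero_smul, add_zero]
  have heven : ∀ᶠ s in 𝓝 0, g (-s) = g s := by
    have hneg : Tendsto (Neg.neg : ℝ → ℝ) (𝓝 0) (𝓝 0) := by simpa using tendsto_neg (0 : ℝ)
    filter_upwards [hgχ, hneg.eventually hgχ] with s hs hs'
    rw [hs, hs', neg_sq]
  have hsub : Tendsto (fun t ↦ t - T x) (𝓝[≥] T x) (𝓝[≥] 0) := by
    refine tendsto_nhdsWithin_iff.2
      ⟨?_, eventually_mem_nhdsWithin.mono fun t ht ↦ mem_Ici.2 (sub_nonneg.2 ht)⟩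
    exact (continuous_sub_right (T x)).tendsto' _ _ (sub_self _) |>.mono_left nhdsWithin_le_nhds
  refine ((contDiffWithinAt_comp_sqrt hg heven).comp_of_eq (T x) (t := Ici 0)
    (g := fun u ↦ g √u) (f := fun t ↦ t - T x) (by fun_prop) (fun t ht ↦ sub_nonneg.2 ht)
    (sub_self _)).congr_of_eventuallyEq_of_mem ?_ self_mem_Ici
  filter_upwards [hsub.eventually (mem_nhdsWithin_of_mem_nhds (tendsto_sqrt_zero.eventually hgχ)),
    self_mem_nhdsWithin] with t hgt ht
  rw [Function.comp, hgt, Real.sq_sqrt (sub_nonneg.2 ht), add_sub_cancel]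

theorem contDiffWithinAt_Iic_of_eventually_eq_comp (hT : ContDiffAt ℝ ∞ T x)
    (hq : ContDiffAt ℝ ∞ q x) (hq_eq : ∀ᶠ y in 𝓝 x, q y = χ (T y)) (h1 : fderiv ℝ T x = 0) {w : E}
    (h2 : fderiv ℝ (fderiv ℝ T) x w w < 0) : ContDiffWithinAt ℝ ∞ χ (Iic (T x)) (T x) := by
  have hneg : ContDiffWithinAt ℝ ∞ (fun t ↦ χ (-t)) (Ici (-T x)) (-T x) := by
    have hT' : fderiv ℝ (-T) = -fderiv ℝ T := funext fun y ↦ fderiv_neg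
    refine contDiffWithinAt_Ici_of_eventually_eq_comp (T := -T) (w := w) hT.neg hq
      (by simpa using hq_eq) ?_ ?_
    · rw [hT', Pi.neg_apply, h1, neg_zero]
    · rw [hT', fderiv_neg]
      simpa using h2
  simpa [Function.comp_def] using hneg.comp (T x) (t := Ici (-T x)) (f := Neg.neg)
    contDiff_neg.contDiffWithinAt fun t ht ↦ neg_le_neg (mem_Iic.1 ht)

end Line

section Level

theorem eq_of_isPreconnected {M X : Type*} [TopologicalSpace M] {f : M → X} {W : Set M}
    (hW : IsPreconnected W) (hf : ∀ a ∈ W, ∀ᶠ q in 𝓝[W] a, f q = f a) {x y : M} (hx : x ∈ W)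
    (hy : y ∈ W) : f x = f y := by
  let _ : TopologicalSpace X := ⊥
  have : DiscreteTopology X := ⟨rfl⟩
  exact hW.constant (fun a ha ↦ tendsto_nhds_of_eventually_eq (hf a ha)) hx hy

variable {M : Type*} [TopologicalSpace M]

/-- The condition on `τ` at `p` under which components of sublevel sets of `τ` cannot merge at `p`:
all local minima near `p` lie on the level of `p`, and unless `p` itself is a local minimum, the
strict sublevel set of `p` is locally connected at `p` and dense in the closed one. -/
structure SublevelConnectedAt (τ : M → ℝ) (p : M) : Prop where
  eq_of_isLocalMin : ∀ᶠ q in 𝓝 p, IsLocalMin τ q → τ q = τ p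
  exists_isPreconnected : ¬ IsLocalMin τ p →
    ∀ U ∈ 𝓝 p, ∃ W ∈ 𝓝 p, W ⊆ U ∧ IsPreconnected (W ∩ {q | τ q < τ p})
  mem_closure : ¬ IsLocalMin τ p → ∀ᶠ q in 𝓝 p, τ q ≤ τ p → q ∈ closure {z | τ z < τ p}

/-- `B` extends the part `P` of the level `t₀` of `τ` to a relatively clopen part of the set where
`τ` has values in `S`, without local minima above the level `t₀`. Only the points of `B` at which
`τ` has values in `S` matter. -/
structure IsClopenExtension (τ : M → ℝ) (t₀ : ℝ) (P : Set M) (S : Set ℝ) (B : Set M) : Prop where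
  eventually_mem_iff : ∀ a, τ a ∈ S → ∀ᶠ q in 𝓝 a, τ q ∈ S → (q ∈ B ↔ a ∈ B)
  mem_iff : ∀ a, τ a = t₀ → (a ∈ B ↔ a ∈ P)
  not_isLocalMin : ∀ a ∈ B, τ a ∈ S → t₀ < τ a → ¬ IsLocalMin τ a

variable {τ : M → ℝ} {t₀ t s : ℝ} {S S' : Set ℝ} {P B C : Set M}

namespace IsClopenExtension

theorem mono (hB : IsClopenExtension τ t₀ P S B) (h : S' ⊆ S) :
    IsClopenExtension τ t₀ P S' B where
  eventually_mem_iff a ha := (hB.eventually_mem_iff a (h ha)).mono fun _ hq hqS ↦ hq (h hqS)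
  mem_iff := hB.mem_iff
  not_isLocalMin a ha haS := hB.not_isLocalMin a ha (h haS)

theorem compl_eventually_mem_iff (hB : IsClopenExtension τ t₀ P S B) (a : M) (ha : τ a ∈ S) :
    ∀ᶠ q in 𝓝 a, τ q ∈ S → (q ∈ Bᶜ ↔ a ∈ Bᶜ) :=
  (hB.eventually_mem_iff a ha).mono fun _ hq hqS ↦ not_congr (hq hqS)

end IsClopenExtension

theorem isClosed_inter_preimage (hτ : Continuous τ) (hS : IsClosed S)
    (hB : ∀ a, τ a ∈ S → ∀ᶠ q in 𝓝 a, τ q ∈ S → (q ∈ B ↔ a ∈ B)) : IsClosed (B ∩ τ ⁻¹' S) := by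
  refine isClosed_iff_frequently.2 fun a ha ↦ ?_
  have haS : τ a ∈ S := (hS.preimage hτ).mem_of_frequently_of_tendsto (ha.mono fun _ h ↦ h.2)
    tendsto_id
  obtain ⟨q, hq, hqB⟩ := (ha.and_eventually (hB a haS)).exists
  exact ⟨(hqB hq.2).1 hq.1, haS⟩

namespace IsClopenExtension

section Compact

variable [CompactSpace M]

theorem mem_of_mem (hτ : Continuous τ) (hB : IsClopenExtension τ t₀ P (Icc t₀ t) B)
    (hC : IsClopenExtension τ t₀ P (Icc t₀ t) C) {x : M} (hx : τ x ∈ Icc t₀ t) (hxB : x ∈ B) :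
    x ∈ C := by
  by_contra hxC
  have hclosed : IsClosed (B ∩ τ ⁻¹' Icc t₀ t ∩ (Cᶜ ∩ τ ⁻¹' Icc t₀ t)) :=
    (isClosed_inter_preimage hτ isClosed_Icc hB.eventually_mem_iff).inter
      (isClosed_inter_preimage hτ isClosed_Icc hC.compl_eventually_mem_iff)
  obtain ⟨p, ⟨⟨hpB, hp⟩, hpC, -⟩, hmin⟩ := hclosed.isCompact.exists_isMinOn
    ⟨x, ⟨hxB, hx⟩, hxC, hx⟩ hτ.continuousOn
  have hpt : t₀ < τ p := hp.1.lt_of_ne' fun hpt ↦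
    hpC ((hC.mem_iff p hpt).2 ((hB.mem_iff p hpt).1 hpB))
  refine hB.not_isLocalMin p hpB hp hpt ?_
  filter_upwards [hB.eventually_mem_iff p hp, hC.eventually_mem_iff p hp,
    hτ.continuousAt.eventually (lt_mem_nhds hpt)] with q hqB hqC hqt
  by_contra! hlt
  have hq : τ q ∈ Icc t₀ t := ⟨hqt.le, hlt.le.trans hp.2⟩
  exact hlt.not_ge (hmin ⟨⟨(hqB hq).2 hpB, hq⟩, fun h ↦ hpC ((hqC hq).1 h), hq⟩)

theorem exists_Ico (hτ : Continuous τ) (ht : t₀ < t)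
    (h : ∀ s ∈ Ico t₀ t, ∃ B, IsClopenExtension τ t₀ P (Icc t₀ s) B) :
    ∃ B, IsClopenExtension τ t₀ P (Ico t₀ t) B := by
  choose! F hF using h
  have hmem : ∀ x s, t₀ ≤ τ x → τ x ≤ s → s < t → (x ∈ F (τ x) ↔ x ∈ F s) := fun x s h0 hs hst ↦
    have h1 := hF (τ x) ⟨h0, hs.trans_lt hst⟩
    have h2 := (hF s ⟨h0.trans hs, hst⟩).mono (Icc_subset_Icc_right hs)
    ⟨h1.mem_of_mem hτ h2 ⟨h0, le_rfl⟩, h2.mem_of_mem hτ h1 ⟨h0, le_rfl⟩⟩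
  refine ⟨{x | x ∈ F (τ x)}, fun a ha ↦ ?_, fun a ha ↦ ?_, fun a haF ha ↦ ?_⟩
  · obtain ⟨s, has, hst⟩ := exists_between ha.2
    have hs : t₀ ≤ s := ha.1.trans has.le
    filter_upwards [(hF s ⟨hs, hst⟩).eventually_mem_iff a ⟨ha.1, has.le⟩,
      hτ.continuousAt.eventually (gt_mem_nhds has)] with q hq hqs hqt
    exact (hmem q s hqt.1 hqs.le hst).trans
      ((hq ⟨hqt.1, hqs.le⟩).trans (hmem a s ha.1 has.le hst).symm)
  · exact (hmem a t₀ ha.ge ha.le ht).trans ((hF t₀ ⟨le_rfl, ht⟩).mem_iff a ha)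
  · exact (hF (τ a) ha).not_isLocalMin a haF ⟨ha.1, le_rfl⟩

end Compact

theorem mem_closure_iff_of_lt (hB : IsClopenExtension τ t₀ P (Ico t₀ t) B)
    {a : M} (ha : τ a ∈ Ico t₀ t) : a ∈ closure (B ∩ τ ⁻¹' Ico t₀ t) ↔ a ∈ B := by
  refine ⟨fun h ↦ ?_, fun h ↦ subset_closure ⟨h, ha⟩⟩
  obtain ⟨q, hq, hqB⟩ :=
    ((mem_closure_iff_frequently.1 h).and_eventually (hB.eventually_mem_iff a ha)).exists
  exact (hqB hq.2).1 hq.1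

theorem not_isLocalMin_of_mem_closure {a : M} (h : a ∈ closure (B ∩ τ ⁻¹' Ico t₀ t))
    (ha : τ a = t) : ¬ IsLocalMin τ a := fun hmin ↦ by
  obtain ⟨q, hq, hqB⟩ := ((mem_closure_iff_frequently.1 h).and_eventually hmin).exists
  exact (ha.symm.trans_le hqB).not_gt hq.2.2

theorem eventually_mem_closure (hτ : Continuous τ) (ht : t₀ < t)
    (hB : IsClopenExtension τ t₀ P (Ico t₀ t) B) {a : M} (hloc : SublevelConnectedAt τ a)
    (ha : τ a = t) (h : a ∈ closure (B ∩ τ ⁻¹' Ico t₀ t)) :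
    ∀ᶠ q in 𝓝 a, τ q ≤ t → q ∈ closure (B ∩ τ ⁻¹' Ico t₀ t) := by
  have hnm := not_isLocalMin_of_mem_closure h ha
  obtain ⟨W, hWa, hWt, hW⟩ := hloc.exists_isPreconnected hnm {q | t₀ < τ q}
    (hτ.continuousAt.eventually (lt_mem_nhds (ha ▸ ht)))
  rw [ha] at hW
  have hmem : ∀ z ∈ W ∩ {q | τ q < t}, τ z ∈ Ico t₀ t := fun z hz ↦ ⟨(hWt hz.1).le, hz.2⟩
  obtain ⟨b, hb, hbW⟩ := ((mem_closure_iff_frequently.1 h).and_eventually hWa).exists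
  have hWB : W ∩ {q | τ q < t} ⊆ B := fun z hz ↦ by
    refine (eq_of_isPreconnected (f := (· ∈ B)) hW (fun c hc ↦ ?_) hz ⟨hbW, hb.2.2⟩).mpr hb.1
    filter_upwards [nhdsWithin_le_nhds (hB.eventually_mem_iff c (hmem c hc)),
      self_mem_nhdsWithin] with q hq hqW
    exact propext (hq (hmem q hqW))
  filter_upwards [hloc.mem_closure hnm, eventually_mem_nhds_iff.2 hWa] with q hq hqW hqt
  have hsub : W ∩ {q | τ q < t} ⊆ B ∩ τ ⁻¹' Ico t₀ t := fun z hz ↦ ⟨hWB hz, hmem z hz⟩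
  rw [ha] at hq
  refine closure_mono hsub (mem_closure_iff_frequently.2 ?_)
  exact ((mem_closure_iff_frequently.1 (hq hqt)).and_eventually hqW).mono fun z hz ↦ hz.symm

theorem closure_Icc (hτ : Continuous τ) (hloc : ∀ p, SublevelConnectedAt τ p) (ht : t₀ < t)
    (hB : IsClopenExtension τ t₀ P (Ico t₀ t) B) :
    IsClopenExtension τ t₀ P (Icc t₀ t) (closure (B ∩ τ ⁻¹' Ico t₀ t)) where
  eventually_mem_iff a ha := by
    rcases ha.2.lt_or_eq with hat | hat
    · filter_upwards [hB.eventually_mem_iff a ⟨ha.1, hat⟩,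
        hτ.continuousAt.eventually (gt_mem_nhds hat)] with q hq hqt hqS
      rw [hB.mem_closure_iff_of_lt ⟨ha.1, hat⟩, hB.mem_closure_iff_of_lt ⟨hqS.1, hqt⟩]
      exact hq ⟨hqS.1, hqt⟩
    · by_cases h : a ∈ closure (B ∩ τ ⁻¹' Ico t₀ t)
      · exact (hB.eventually_mem_closure hτ ht (hloc a) hat h).mono fun q hq hqS ↦
          iff_of_true (hq hqS.2) h
      · exact (isClosed_closure.isOpen_compl.eventually_mem h).mono fun q hq _ ↦ iff_of_false hq h
  mem_iff a ha := (hB.mem_closure_iff_of_lt ⟨ha.ge, ha.trans_lt ht⟩).trans (hB.mem_iff a ha)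
  not_isLocalMin a haB ha hat := by
    rcases ha.2.lt_or_eq with h | h
    · exact hB.not_isLocalMin a ((hB.mem_closure_iff_of_lt ⟨ha.1, h⟩).1 haB) ⟨ha.1, h⟩ hat
    · exact not_isLocalMin_of_mem_closure haB h

variable [CompactSpace M] [T2Space M]

theorem exists_gt (hτ : Continuous τ) (hloc : ∀ p, SublevelConnectedAt τ p) (ht : t₀ ≤ t)
    (hB : IsClopenExtension τ t₀ P (Icc t₀ t) B) :
    ∃ t' > t, ∃ B', IsClopenExtension τ t₀ P (Icc t₀ t') B' := by
  obtain ⟨U, V, hU, hV, hBU, hBV, hUV⟩ := SeparatedNhds.of_isCompact_isCompact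
    (isClosed_inter_preimage hτ isClosed_Icc hB.eventually_mem_iff).isCompact
    (isClosed_inter_preimage hτ isClosed_Icc hB.compl_eventually_mem_iff).isCompact
    (disjoint_compl_right.mono inter_subset_left inter_subset_left)
  have hmem : ∀ x, τ x ∈ Icc t₀ t → (x ∈ U ↔ x ∈ B) ∧ x ∈ U ∪ V := fun x hx ↦ by
    by_cases hxB : x ∈ B
    · exact ⟨iff_of_true (hBU ⟨hxB, hx⟩) hxB, Or.inl (hBU ⟨hxB, hx⟩)⟩
    · exact ⟨iff_of_false (hUV.notMem_of_mem_right (hBV ⟨hxB, hx⟩)) hxB, Or.inr (hBV ⟨hxB, hx⟩)⟩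
  obtain ⟨t', htt', hsub⟩ := mem_nhdsGE_iff_exists_Icc_subset.1 <| mem_nhdsWithin_of_mem_nhds <|
    hτ.isClosedMap.eventually_nhds_fiber t
      (p := fun x ↦ x ∈ U ∪ V ∧ (IsLocalMin τ x → τ x = t)) fun p hp ↦
      ((hU.union hV).eventually_mem (hmem p ⟨ht.trans hp.ge, hp.le⟩).2).and
        ((hloc p).eq_of_isLocalMin.mono fun q hq hmin ↦ (hq hmin).trans hp)
  refine ⟨t', htt', U, fun a ha ↦ ?_, fun a ha ↦ ?_, fun a haU ha hat hmin ↦ ?_⟩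
  · have haUV : a ∈ U ∪ V := (le_total (τ a) t).elim (fun h ↦ (hmem a ⟨ha.1, h⟩).2)
      fun h ↦ (hsub ⟨h, ha.2⟩ a rfl).1
    rcases haUV with h | h
    · exact (hU.eventually_mem h).mono fun q hq _ ↦ iff_of_true hq h
    · exact (hV.eventually_mem h).mono fun q hq _ ↦
        iff_of_false (hUV.notMem_of_mem_right hq) (hUV.notMem_of_mem_right h)
  · exact (hmem a ⟨ha.ge, ha.trans_le ht⟩).1.trans (hB.mem_iff a ha)
  · have hle : τ a ≤ t := (le_total (τ a) t).elim id fun h ↦ ((hsub ⟨h, ha.2⟩ a rfl).2 hmin).le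
    exact hB.not_isLocalMin a ((hmem a ⟨ha.1, hle⟩).1.1 haU) ⟨ha.1, hle⟩ hat hmin

theorem exists_Icc (hτ : Continuous τ) (hloc : ∀ p, SublevelConnectedAt τ p)
    (hP : ∀ a, τ a = t₀ → ∀ᶠ q in 𝓝 a, τ q = t₀ → (q ∈ P ↔ a ∈ P)) (ht : t₀ ≤ t) :
    ∃ B, IsClopenExtension τ t₀ P (Icc t₀ t) B := by
  set A : Set ℝ := {s | ∃ B, IsClopenExtension τ t₀ P (Icc t₀ s) B}
  have hdown : ∀ s ∈ A, ∀ r ≤ s, r ∈ A := fun s ⟨B, hB⟩ r hr ↦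
    ⟨B, hB.mono (Icc_subset_Icc_right hr)⟩
  have hbase : t₀ ∈ A := ⟨P, fun a ha ↦ by simpa using hP a (by simpa using ha), fun _ _ ↦ Iff.rfl,
    fun a _ ha hat ↦ absurd ha.2 hat.not_ge⟩
  have hclosed : IsClosed (A ∩ Icc t₀ t) := by
    refine isClosed_of_closure_subset fun r hr ↦ ?_
    have hr' : r ∈ Icc t₀ t := closure_minimal inter_subset_right isClosed_Icc hr
    refine ⟨?_, hr'⟩
    rcases hr'.1.eq_or_lt with rfl | h0
    · exact hbase
    obtain ⟨B, hB⟩ := exists_Ico hτ h0 fun s hs ↦ by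
      obtain ⟨r', hsr, hr'A, -⟩ := mem_closure_iff.1 hr (Ioi s) isOpen_Ioi hs.2
      exact hdown r' hr'A s (le_of_lt hsr)
    exact ⟨_, hB.closure_Icc hτ hloc h0⟩
  refine hclosed.Icc_subset_of_forall_exists_gt hbase (fun s ⟨⟨B, hB⟩, hs⟩ y hy ↦ ?_) ⟨ht, le_rfl⟩
  obtain ⟨s', hss', hs'⟩ := hB.exists_gt hτ hloc hs.1
  exact ⟨min s' y, hdown s' hs' _ (min_le_left _ _), lt_min hss' hy, min_le_right _ _⟩

theorem exists_Ici (hτ : Continuous τ) (hloc : ∀ p, SublevelConnectedAt τ p)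
    (hP : ∀ a, τ a = t₀ → ∀ᶠ q in 𝓝 a, τ q = t₀ → (q ∈ P ↔ a ∈ P)) :
    ∃ B, IsClopenExtension τ t₀ P (Ici t₀) B := by
  obtain ⟨m, hm⟩ := (isCompact_range hτ).bddAbove
  obtain ⟨B, hB⟩ := exists_Icc hτ hloc hP (le_max_left t₀ m)
  have hmem : ∀ x, t₀ ≤ τ x → τ x ∈ Icc t₀ (max t₀ m) := fun x hx ↦
    ⟨hx, le_max_of_le_right (hm ⟨x, rfl⟩)⟩
  exact ⟨B, fun a ha ↦ (hB.eventually_mem_iff a (hmem a ha)).mono fun q hq hqt ↦ hq (hmem q hqt),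
    hB.mem_iff, fun a haB ha ↦ hB.not_isLocalMin a haB (hmem a ha)⟩

end IsClopenExtension

/-- A component of a level of `τ` sweeps out components of the sets `t₀ ≤ τ` and `τ ≤ t₀`, which
never merge with those swept out by the rest of the level, so a separation of the level would
separate `M`. -/
theorem isPreconnected_level [CompactSpace M] [T2Space M] [ConnectedSpace M] (hτ : Continuous τ)
    (hloc : ∀ p, SublevelConnectedAt τ p) (hloc' : ∀ p, SublevelConnectedAt (fun x ↦ -τ x) p)
    (t₀ : ℝ) : IsPreconnected {x | τ x = t₀} := by
  rw [isPreconnected_iff_subset_of_fully_disjoint_closed (isClosed_eq hτ continuous_const)]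
  intro P Q hP hQ hPQ hd
  have hclopen : ∀ a, τ a = t₀ → ∀ᶠ q in 𝓝 a, τ q = t₀ → (q ∈ P ↔ a ∈ P) := fun a ha ↦ by
    rcases hPQ ha with h | h
    · filter_upwards [hQ.isOpen_compl.mem_nhds (hd.notMem_of_mem_left h)] with q hq hqt
      exact iff_of_true ((hPQ hqt).resolve_right hq) h
    · filter_upwards [hP.isOpen_compl.mem_nhds (hd.notMem_of_mem_right h)] with q hq _
      exact iff_of_false hq (hd.notMem_of_mem_right h)
  obtain ⟨B, hB⟩ := IsClopenExtension.exists_Ici hτ hloc hclopen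
  obtain ⟨C, hC⟩ := IsClopenExtension.exists_Ici (t₀ := -t₀) hτ.neg hloc' (by simpa using hclopen)
  let D : Set M := {x | t₀ ≤ τ x ∧ x ∈ B ∨ τ x ≤ t₀ ∧ x ∈ C}
  have hBC : ∀ x, τ x = t₀ → (x ∈ B ↔ x ∈ C) := fun x hx ↦
    (hB.mem_iff x hx).trans (hC.mem_iff x (congrArg _ hx)).symm
  have hDB : ∀ x, t₀ ≤ τ x → (x ∈ D ↔ x ∈ B) := fun x hx ↦
    ⟨Or.rec And.right fun h ↦ (hBC x (h.1.antisymm hx)).2 h.2, fun h ↦ Or.inl ⟨hx, h⟩⟩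
  have hDC : ∀ x, τ x ≤ t₀ → (x ∈ D ↔ x ∈ C) := fun x hx ↦
    ⟨Or.rec (fun h ↦ (hBC x (hx.antisymm h.1)).1 h.2) And.right, fun h ↦ Or.inr ⟨hx, h⟩⟩
  have hup : ∀ a, ∀ᶠ q in 𝓝 a, t₀ ≤ τ q → (q ∈ D ↔ a ∈ D) := fun a ↦ by
    rcases le_or_gt t₀ (τ a) with ha | ha
    · exact (hB.eventually_mem_iff a ha).mono fun q hq hqt ↦
        (hDB q hqt).trans ((hq hqt).trans (hDB a ha).symm)
    · exact (hτ.continuousAt.eventually (gt_mem_nhds ha)).mono fun q hq hqt ↦ absurd hq hqt.not_gt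
  have hdown : ∀ a, ∀ᶠ q in 𝓝 a, τ q ≤ t₀ → (q ∈ D ↔ a ∈ D) := fun a ↦ by
    rcases le_or_gt (τ a) t₀ with ha | ha
    · exact (hC.eventually_mem_iff a (neg_le_neg ha)).mono fun q hq hqt ↦
        (hDC q hqt).trans ((hq (neg_le_neg hqt)).trans (hDC a ha).symm)
    · exact (hτ.continuousAt.eventually (lt_mem_nhds ha)).mono fun q hq hqt ↦ absurd hqt hq.not_ge
  have hD : ∀ x y, x ∈ D ↔ y ∈ D := fun x y ↦ iff_of_eq <|
    eq_of_isPreconnected (f := (· ∈ D)) isPreconnected_univ (fun a _ ↦ by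
      rw [nhdsWithin_univ]
      filter_upwards [hup a, hdown a] with q hq hq'
      exact propext ((le_total t₀ (τ q)).elim hq hq')) (mem_univ x) (mem_univ y)
  have hDP : ∀ x, τ x = t₀ → (x ∈ D ↔ x ∈ P) := fun x hx ↦
    (hDB x hx.ge).trans (hB.mem_iff x hx)
  by_contra! hcon
  obtain ⟨⟨x, hx, hxP⟩, ⟨y, hy, hyQ⟩⟩ := And.imp not_subset.1 not_subset.1 hcon
  exact hxP ((hDP x hx).1 ((hD x y).2 ((hDP y hy).2 ((hPQ hy).resolve_right hyQ))))

end Level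

section LocalModels

namespace SublevelConnectedAt

theorem of_isLocalMin {X : Type*} [TopologicalSpace X] {f : X → ℝ} {x : X} (hx : IsLocalMin f x)
    (h : ∀ᶠ y in 𝓝 x, IsLocalMin f y → f y = f x) : SublevelConnectedAt f x where
  eq_of_isLocalMin := h
  exists_isPreconnected h' := absurd hx h'
  mem_closure h' := absurd hx h'

theorem of_openPartialHomeomorph {X Y : Type*} [TopologicalSpace X] [TopologicalSpace Y]
    (φ : OpenPartialHomeomorph X Y) {f : Y → ℝ} {g : X → ℝ} {x : X} (hx : x ∈ φ.source)
    (hfg : ∀ q ∈ φ.source, f (φ q) = g q) (h : SublevelConnectedAt f (φ x)) :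
    SublevelConnectedAt g x := by
  have hsource : ∀ᶠ q in 𝓝 x, q ∈ φ.source := φ.open_source.eventually_mem hx
  have hsymm : ∀ q ∈ φ.source, ∀ᶠ z in 𝓝 (φ q), g (φ.symm z) = f z := fun q hq ↦ by
    filter_upwards [φ.open_target.eventually_mem (φ.map_source hq)] with z hz
    rw [← hfg _ (φ.map_target hz), φ.right_inv hz]
  have hmin : ∀ q ∈ φ.source, (IsLocalMin f (φ q) ↔ IsLocalMin g q) := fun q hq ↦ by
    refine ⟨fun h ↦ ?_, fun h ↦ ?_⟩
    · filter_upwards [(φ.continuousAt hq).eventually h, φ.open_source.eventually_mem hq]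
        with z hz hzs
      rwa [← hfg q hq, ← hfg z hzs]
    · filter_upwards [(φ.tendsto_symm hq).eventually h, hsymm q hq] with z hz hzs
      rwa [hfg q hq, ← hzs]
  refine ⟨?_, fun hx' U hU ↦ ?_, fun hx' ↦ ?_⟩
  · filter_upwards [(φ.continuousAt hx).eventually h.eq_of_isLocalMin, hsource] with q hq hqs hqmin
    rw [← hfg q hqs, hq ((hmin q hqs).2 hqmin), hfg x hx]
  · obtain ⟨W, hW, hWU, hWc⟩ := h.exists_isPreconnected (mt (hmin x hx).1 hx')
      (φ.symm ⁻¹' U ∩ φ.target)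
      (inter_mem (φ.tendsto_symm hx hU) (φ.open_target.mem_nhds (φ.map_source hx)))
    refine ⟨φ.symm '' W, ?_, image_subset_iff.2 fun y hy ↦ (hWU hy).1, ?_⟩
    · filter_upwards [φ.continuousAt hx hW, hsource] with q hq hqs
      exact ⟨φ q, hq, φ.left_inv hqs⟩
    · have himage : φ.symm '' W ∩ {q | g q < g x} = φ.symm '' (W ∩ {q | f q < f (φ x)}) := by
        rw [← image_inter_preimage]
        refine congrArg _ (ext fun z ↦ and_congr_right fun hz ↦ ?_)
        have hzt := (hWU hz).2
        rw [mem_preimage, mem_ofPred_eq, mem_ofPred_eq, ← hfg _ (φ.map_target hzt), hfg x hx,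
          φ.right_inv hzt]
      rw [himage]
      exact hWc.image _ (φ.symm.continuousOn.mono fun y hy ↦ (hWU hy.1).2)
  · filter_upwards [(φ.continuousAt hx).eventually (h.mem_closure (mt (hmin x hx).1 hx')), hsource]
      with q hq hqs hle
    have hcl := hq (by rwa [hfg q hqs, hfg x hx])
    refine mem_closure_iff_frequently.2 ((φ.tendsto_symm hqs).frequently ?_)
    refine ((mem_closure_iff_frequently.1 hcl).and_eventually (hsymm q hqs)).mono fun z hz ↦ ?_
    rw [mem_ofPred_eq, hz.2, ← hfg x hx]
    exact hz.1

theorem fst {G : Type*} [NormedAddCommGroup G] [NormedSpace ℝ G] (p : ℝ × G) :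
    SublevelConnectedAt Prod.fst p := by
  have hmin : ∀ q : ℝ × G, ¬ IsLocalMin Prod.fst q := fun q hq ↦ by
    simpa using DFunLike.congr_fun (hq.hasFDerivAt_eq_zero hasFDerivAt_fst) (1, 0)
  refine ⟨.of_forall fun q hq ↦ absurd hq (hmin q), fun _ U hU ↦ ?_,
    fun _ ↦ .of_forall fun q hq ↦ ?_⟩
  · obtain ⟨r, hr, hrU⟩ := Metric.mem_nhds_iff.1 hU
    exact ⟨Metric.ball p r, Metric.ball_mem_nhds p hr, hrU, ((convex_ball p r).inter
      (convex_halfSpace_lt ⟨fun _ _ ↦ rfl, fun _ _ ↦ rfl⟩ p.1)).isPreconnected⟩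
  · exact mem_closure_iff_frequently.2 <| (not_eventually.1 (hmin q)).mono fun z hz ↦
      (not_le.1 hz).trans_le hq

end SublevelConnectedAt

variable {E : Type*} [NormedAddCommGroup E] [NormedSpace ℝ E]

theorem sublevelConnectedAt_of_hasStrictFDerivAt [FiniteDimensional ℝ E] {f : E → ℝ} {x : E}
    {f' : E →L[ℝ] ℝ} (hf : HasStrictFDerivAt f f' x) (hf' : f' ≠ 0) :
    SublevelConnectedAt f x := by
  have : CompleteSpace E := FiniteDimensional.complete ℝ E
  have hrange : f'.range = ⊤ := LinearMap.range_eq_top.2 <| LinearMap.surjective <|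
    ContinuousLinearMap.coe_injective.ne hf'
  exact .of_openPartialHomeomorph (hf.implicitToOpenPartialHomeomorph f f' hrange)
    (hf.mem_implicitToOpenPartialHomeomorph_source hrange)
    (fun y _ ↦ hf.implicitToOpenPartialHomeomorph_fst hrange y) (.fst _)

theorem isPreconnected_ball_inter_sub_notMem {F : Submodule ℝ E} (hF : 1 < Module.rank ℝ (E ⧸ F))
    (x : E) {r : ℝ} (hr : 0 < r) : IsPreconnected (Metric.ball x r ∩ {y | y - x ∉ F}) := by
  set φ := OpenPartialHomeomorph.univBall x r with hφ
  have hφF : ∀ z, φ z - x ∈ F ↔ z ∈ F := fun z ↦ by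
    have hz : φ z = (r • (√(1 + ‖z‖ ^ 2))⁻¹ • z) + x := by
      rw [hφ, OpenPartialHomeomorph.univBall, dif_pos hr]
      rfl
    rw [hz, add_sub_cancel_right, smul_smul]
    exact F.smul_mem_iff (by positivity)
  have himage : Metric.ball x r ∩ {y | y - x ∉ F} = φ '' (F : Set E)ᶜ := by
    rw [← OpenPartialHomeomorph.univBall_target x hr, ← hφ]
    ext y
    refine ⟨fun hy ↦ ⟨φ.symm y, fun h ↦ hy.2 ?_, φ.right_inv hy.1⟩, ?_⟩
    · rwa [← φ.right_inv hy.1, hφF]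
    · rintro ⟨z, hz, rfl⟩
      exact ⟨φ.map_source (by simp [hφ]), mt (hφF z).1 hz⟩
  rw [himage]
  exact (isConnected_compl_of_one_lt_codim hF).isPreconnected.image _
    (OpenPartialHomeomorph.continuous_univBall x r).continuousOn

theorem eventually_forall_neg {X : Type*} [TopologicalSpace X] [FiniteDimensional ℝ E]
    {G : Submodule ℝ E} {B : X → E →L[ℝ] E →L[ℝ] ℝ} {x : X} (hB : ContinuousAt B x)
    (hneg : ∀ g ∈ G, g ≠ 0 → B x g g < 0) : ∀ᶠ y in 𝓝 x, ∀ g ∈ G, g ≠ 0 → B y g g < 0 := by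
  have hK : IsCompact (Metric.sphere (0 : E) 1 ∩ G) :=
    (isCompact_sphere 0 1).inter_right G.closed_of_finiteDimensional
  have hcont : ∀ g : E, ContinuousAt (fun z : X × E ↦ B z.1 z.2 z.2) (x, g) := fun g ↦
    ((hB.comp continuousAt_fst).clm_apply continuousAt_snd).clm_apply continuousAt_snd
  filter_upwards [hK.eventually_forall_of_forall_eventually (P := fun y g ↦ B y g g < 0)
    fun g hg ↦ (hcont g).eventually <| gt_mem_nhds <|
      hneg g hg.2 (ne_zero_of_mem_unit_sphere ⟨g, hg.1⟩)] with y hy g hg hg0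
  have h := hy (‖g‖⁻¹ • g) ⟨by simp [norm_smul, hg0], G.smul_mem _ hg⟩
  have hpos : 0 < ‖g‖⁻¹ := by positivity
  simpa [hpos, pos_iff_neg_of_mul_neg, mul_neg_iff, hpos.not_gt] using h

theorem lt_of_fderiv_fderiv_neg {f : E → ℝ} {s : Set E} {x y : E} (hs : Convex ℝ s)
    (hf : ∀ z ∈ s, DifferentiableAt ℝ f z) (hf' : ∀ z ∈ s, DifferentiableAt ℝ (fderiv ℝ f) z)
    (hx : x ∈ s) (hy : y ∈ s) (h0 : fderiv ℝ f x (y - x) = 0)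
    (hneg : ∀ z ∈ s, fderiv ℝ (fderiv ℝ f) z (y - x) (y - x) < 0) : f y < f x := by
  have hline : ∀ t ∈ Icc (0 : ℝ) 1, x + t • (y - x) ∈ s := fun t ↦ hs.add_smul_sub_mem hx hy
  have h1 : ∀ t ∈ Icc (0 : ℝ) 1, HasDerivAt (fun t : ℝ ↦ f (x + t • (y - x)))
      (fderiv ℝ f (x + t • (y - x)) (y - x)) t := fun t ht ↦ hasDerivAt_line (hf _ (hline t ht))
  have h2 : ∀ t ∈ Icc (0 : ℝ) 1, HasDerivAt (fun t : ℝ ↦ fderiv ℝ f (x + t • (y - x)) (y - x))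
      (fderiv ℝ (fderiv ℝ f) (x + t • (y - x)) (y - x) (y - x)) t := fun t ht ↦ by
    generalize y - x = w at hline ht ⊢
    have hd : HasFDerivAt (fun z ↦ fderiv ℝ f z w)
        ((fderiv ℝ (fderiv ℝ f) (x + t • w)).flip w) (x + t • w) := by
      simpa using (hf' _ (hline t ht)).hasFDerivAt.clm_apply (hasFDerivAt_const w (x + t • w))
    simpa [hd.fderiv] using hasDerivAt_line hd.differentiableAt
  obtain ⟨c, hc, hfc⟩ := exists_hasDerivAt_eq_slope _ _ zero_lt_one
    (fun t ht ↦ (h1 t ht).continuousAt.continuousWithinAt) fun t ht ↦ h1 t (Ioo_subset_Icc_self ht)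
  have hsub : Icc 0 c ⊆ Icc (0 : ℝ) 1 := Icc_subset_Icc_right hc.2.le
  obtain ⟨d, hd, hfd⟩ := exists_hasDerivAt_eq_slope _ _ hc.1
    (fun t ht ↦ (h2 t (hsub ht)).continuousAt.continuousWithinAt)
    fun t ht ↦ h2 t (hsub (Ioo_subset_Icc_self ht))
  simp only [one_smul, add_sub_cancel, zero_smul, add_zero, h0, sub_zero, div_one] at hfc hfd
  have := hneg _ (hline d (hsub (Ioo_subset_Icc_self hd)))
  rw [hfd, hfc, div_neg_iff] at this
  linarith [this.resolve_left fun h ↦ h.2.not_gt hc.1]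

variable {f : E → ℝ} {x : E} {F : Submodule ℝ E} {a : ℝ}

/-- The model of a critical point in the chart of a critical manifold: near `x` the critical set
of `f` is the affine subspace `x + F`, of codimension greater than one, and transversally to `F`
the second derivative of `f` is definite, with the sign of `a`. -/
structure IsDefiniteCritical (f : E → ℝ) (x : E) (F : Submodule ℝ E) (a : ℝ) : Prop where
  contDiffAt : ContDiffAt ℝ ∞ f x
  one_lt_rank : 1 < Module.rank ℝ (E ⧸ F)
  eventually_fderiv_eq_zero_iff : ∀ᶠ y in 𝓝 x, (fderiv ℝ f y = 0 ↔ y - x ∈ F)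
  definite : ∀ w ∉ F, 0 < a * fderiv ℝ (fderiv ℝ f) x w w

namespace IsDefiniteCritical

theorem fderiv_eq_zero (h : IsDefiniteCritical f x F a) : fderiv ℝ f x = 0 :=
  h.eventually_fderiv_eq_zero_iff.self_of_nhds.2 (by simp)

theorem ne_top (h : IsDefiniteCritical f x F a) : F ≠ ⊤ := by
  rintro rfl
  simpa [rank_subsingleton'] using h.one_lt_rank

theorem exists_notMem (h : IsDefiniteCritical f x F a) : ∃ w, w ∉ F := by
  simpa [Submodule.eq_top_iff'] using h.ne_top

theorem ne_zero (h : IsDefiniteCritical f x F a) : a ≠ 0 := by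
  obtain ⟨w, hw⟩ := h.exists_notMem
  exact left_ne_zero_of_mul (h.definite w hw).ne'

theorem fderiv_fderiv_pos (h : IsDefiniteCritical f x F a) (ha : 0 < a) {w : E} (hw : w ∉ F) :
    0 < fderiv ℝ (fderiv ℝ f) x w w :=
  pos_of_mul_pos_right (h.definite w hw) ha.le

theorem fderiv_fderiv_neg (h : IsDefiniteCritical f x F a) (ha : a < 0) {w : E} (hw : w ∉ F) :
    fderiv ℝ (fderiv ℝ f) x w w < 0 :=
  neg_of_mul_pos_right (h.definite w hw) ha.le

theorem neg (h : IsDefiniteCritical f x F a) : IsDefiniteCritical (fun y ↦ -f y) x F (-a) := by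
  have hneg : fderiv ℝ (fun y ↦ -f y) = fun y ↦ -fderiv ℝ f y := funext fun _ ↦ fderiv_fun_neg
  refine ⟨h.contDiffAt.neg, h.one_lt_rank, ?_, fun w hw ↦ ?_⟩
  · simpa only [hneg, neg_eq_zero] using h.eventually_fderiv_eq_zero_iff
  · rw [hneg, fderiv_fun_neg]
    simpa using h.definite w hw

variable [FiniteDimensional ℝ E]

theorem eventually_eq_and_lt (h : IsDefiniteCritical f x F a) (ha : a < 0) :
    ∀ᶠ y in 𝓝 x, (y - x ∈ F → f y = f x) ∧ (y - x ∉ F → f y < f x) := by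
  obtain ⟨G, hFG⟩ := F.exists_isCompl
  have hf2 : ContDiffAt ℝ ∞ (fderiv ℝ f) x := h.contDiffAt.fderiv_right (by simp)
  have hnegG := eventually_forall_neg (G := G) (hf2.fderiv_right (m := ∞) (by simp)).continuousAt
    fun g hg hg0 ↦ h.fderiv_fderiv_neg ha fun hgF ↦
      hg0 (Submodule.disjoint_def.1 hFG.disjoint g hgF hg)
  obtain ⟨r, hr, hball⟩ := Metric.eventually_nhds_iff_ball.1
    ((eventually_differentiableAt h.contDiffAt).and
      ((eventually_differentiableAt hf2).and (hnegG.and h.eventually_fderiv_eq_zero_iff)))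
  have hxr := Metric.mem_ball_self (x := x) hr
  have heq : ∀ y ∈ Metric.ball x r, y - x ∈ F → f y = f x := fun y hy hyF ↦ by
    obtain ⟨z, hz, hfz⟩ := domain_mvt (fun z hz ↦ (hball z hz).1.hasFDerivAt.hasFDerivWithinAt)
      (convex_ball x r) hxr hy
    obtain ⟨t, ht, rfl⟩ := segment_eq_image' ℝ x y ▸ hz
    have hzF := (hball _ ((convex_ball x r).add_smul_sub_mem hxr hy ht)).2.2.2.2
      (by simpa using F.smul_mem t hyF)
    simp only [hzF, zero_apply] at hfz
    exact sub_eq_zero.1 hfz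
  -- `p y` is the projection of `y` to the critical subspace `x + F` along `G`
  let p : E → E := fun y ↦ x + LinearMap.toContinuousLinearMap (F.projection G hFG) (y - x)
  have hpF : ∀ y, p y - x ∈ F := fun y ↦ by
    simpa [p] using Submodule.projection_apply_mem hFG (y - x)
  have hpG : ∀ y, y - p y ∈ G := fun y ↦ by
    simpa [p, sub_sub] using Submodule.sub_projection_mem hFG (y - x)
  have hpc : Continuous p := by fun_prop
  filter_upwards [Metric.ball_mem_nhds x hr, hpc.continuousAt.preimage_mem_nhds
    (show Metric.ball x r ∈ 𝓝 (p x) by simpa [p] using Metric.ball_mem_nhds x hr)] with y hy hpy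
  refine ⟨heq y hy, fun hyF ↦ ?_⟩
  rw [← heq (p y) hpy (hpF y)]
  refine lt_of_fderiv_fderiv_neg (convex_ball x r) (fun z hz ↦ (hball z hz).1)
    (fun z hz ↦ (hball z hz).2.1) hpy hy (by rw [(hball _ hpy).2.2.2.2 (hpF y), zero_apply])
    fun z hz ↦ (hball z hz).2.2.1 _ (hpG y) fun h ↦ hyF ?_
  rw [sub_eq_zero.1 h]
  exact hpF y

theorem sublevelConnectedAt_of_neg (h : IsDefiniteCritical f x F a) (ha : a < 0) :
    SublevelConnectedAt f x := by
  have hlt := h.eventually_eq_and_lt ha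
  refine ⟨?_, fun _ U hU ↦ ?_, fun _ ↦ ?_⟩
  · filter_upwards [hlt, h.eventually_fderiv_eq_zero_iff] with y hy hyF hmin
    exact hy.1 (hyF.1 hmin.fderiv_eq_zero)
  · obtain ⟨r, hr, hball⟩ := Metric.eventually_nhds_iff_ball.1 (hlt.and hU)
    refine ⟨Metric.ball x r, Metric.ball_mem_nhds x hr, fun y hy ↦ (hball y hy).2, ?_⟩
    convert isPreconnected_ball_inter_sub_notMem h.one_lt_rank x hr using 1
    refine ext fun y ↦ and_congr_right fun hy ↦ ⟨fun h1 h2 ↦ ?_, (hball y hy).1.2⟩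
    exact h1.ne ((hball y hy).1.1 h2)
  · have hdense : Dense {y | y - x ∉ F} := by
      have : Dense (F : Set E)ᶜ := interior_eq_empty_iff_dense_compl.1 <|
        not_nonempty_iff_eq_empty.1 (mt F.eq_top_of_nonempty_interior' h.ne_top)
      exact this.preimage (Homeomorph.subRight x).isOpenMap
    filter_upwards [hlt.eventually_nhds] with y hy _
    refine mem_closure_iff_frequently.2 ?_
    exact ((mem_closure_iff_frequently.1 (hdense y)).and_eventually hy).mono fun z hz ↦ hz.2.2 hz.1

theorem isLocalMax (h : IsDefiniteCritical f x F a) (ha : a < 0) : IsLocalMax f x := by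
  filter_upwards [h.eventually_eq_and_lt ha] with y hy
  by_cases hyF : y - x ∈ F
  · exact (hy.1 hyF).le
  · exact (hy.2 hyF).le

theorem isLocalMin (h : IsDefiniteCritical f x F a) (ha : 0 < a) : IsLocalMin f x := by
  simpa using (h.neg.isLocalMax (neg_neg_of_pos ha)).neg

theorem eventually_fderiv_eq_zero_of_eq (h : IsDefiniteCritical f x F a) :
    ∀ᶠ y in 𝓝 x, f y = f x → fderiv ℝ f y = 0 := by
  have key : ∀ {f : E → ℝ} {a : ℝ}, IsDefiniteCritical f x F a → a < 0 →
      ∀ᶠ y in 𝓝 x, f y = f x → fderiv ℝ f y = 0 := fun h ha ↦ by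
    filter_upwards [h.eventually_eq_and_lt ha, h.eventually_fderiv_eq_zero_iff] with y hy hyF heq
    exact hyF.2 (not_not.1 fun hn ↦ (hy.2 hn).ne heq)
  rcases h.ne_zero.lt_or_gt with ha | ha
  · exact key h ha
  · simpa using key h.neg (neg_neg_of_pos ha)

theorem sublevelConnectedAt (h : IsDefiniteCritical f x F a) : SublevelConnectedAt f x := by
  rcases h.ne_zero.lt_or_gt with ha | ha
  · exact h.sublevelConnectedAt_of_neg ha
  · refine .of_isLocalMin (h.isLocalMin ha) ?_
    filter_upwards [h.neg.eventually_eq_and_lt (neg_neg_of_pos ha),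
      h.eventually_fderiv_eq_zero_iff] with y hy hyF hmin
    exact neg_injective (hy.1 (hyF.1 hmin.fderiv_eq_zero))

end IsDefiniteCritical

end LocalModels

section Proportional

variable {E : Type*} [NormedAddCommGroup E] [NormedSpace ℝ E]

theorem eventually_eq_of_fderiv_eq_smul [CompleteSpace E] {f q : E → ℝ} {x : E}
    (hf : ContDiffAt ℝ ∞ f x) (h0 : fderiv ℝ f x ≠ 0)
    (hq : ∀ᶠ y in 𝓝 x, DifferentiableAt ℝ q y)
    (h : ∀ᶠ y in 𝓝 x, ∃ c : ℝ, fderiv ℝ q y = c • fderiv ℝ f y) :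
    ∀ᶠ y in 𝓝 x, f y = f x → q y = q x := by
  let Φ := (hf.hasStrictFDerivAt (by simp)).implicitFunctionDataOfComplemented f (fderiv ℝ f x)
    (LinearMap.range_eq_top.2 <| LinearMap.surjective <| ContinuousLinearMap.coe_injective.ne h0)
    (ContinuousLinearMap.ker_closedComplemented_of_finiteDimensional_range _)
  have hΦ : ContDiffAt ℝ ∞ Φ.rightFun Φ.pt :=
    (ContinuousLinearMap.contDiff _).contDiffAt.comp _ (contDiffAt_id.sub contDiffAt_const)
  -- `g` parametrizes the level of `f` through `x`
  let g := Φ.implicitFunction (f x)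
  have hg : ContDiffAt ℝ ∞ g (Φ.rightFun x) :=
    (Φ.contDiffAt_implicitFunction hf hΦ (by simp)).comp (f := fun k ↦ (f x, k)) _
      (contDiffAt_const.prodMk contDiffAt_id)
  have hgx : g (Φ.rightFun x) = x := Φ.implicitFunction_apply_image.self_of_nhds
  have hgd := eventually_differentiableAt hg
  have hfg : ∀ᶠ k in 𝓝 (Φ.rightFun x), f (g k) = f x :=
    Φ.leftFun_implicitFunction.curry_nhds.self_of_nhds
  have hqg : ∀ᶠ k in 𝓝 (Φ.rightFun x), DifferentiableAt ℝ (q ∘ g) k ∧ fderiv ℝ (q ∘ g) k = 0 := by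
    have hgt : Tendsto g (𝓝 (Φ.rightFun x)) (𝓝 x) := by simpa [hgx] using hg.continuousAt.tendsto
    filter_upwards [hgd, hfg.eventually_nhds, hgt.eventually (eventually_differentiableAt hf),
      hgt.eventually hq, hgt.eventually h] with k hgk hfgk hfk hqk ⟨c, hc⟩
    have hfg0 : (fderiv ℝ f (g k)).comp (fderiv ℝ g k) = 0 := by
      rw [← fderiv_comp k hfk hgk]
      exact (show f ∘ g =ᶠ[𝓝 k] fun _ ↦ f x from hfgk).fderiv_eq.trans (fderiv_const_apply _)
    rw [fderiv_comp k hqk hgk, hc, ContinuousLinearMap.smul_comp, hfg0, smul_zero]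
    exact ⟨hqk.comp k hgk, rfl⟩
  obtain ⟨r, hr, hball⟩ := Metric.eventually_nhds_iff_ball.1 hqg
  filter_upwards [Φ.leftFun_eq_iff_implicitFunction,
    hΦ.continuousAt.preimage_mem_nhds (Metric.ball_mem_nhds _ hr)] with y hy hyr hfy
  have hconst := (convex_ball _ r).is_const_of_fderivWithin_eq_zero
    (fun k hk ↦ (hball k hk).1.differentiableWithinAt)
    (fun k hk ↦ (fderivWithin_of_isOpen Metric.isOpen_ball hk).trans (hball k hk).2) hyr
    (Metric.mem_ball_self hr)
  have hgy : g (Φ.rightFun y) = y := hy.1 hfy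
  rwa [Function.comp_apply, Function.comp_apply, hgy, hgx] at hconst

theorem fderiv_clm_apply_of_eq_zero {c : E → E →L[ℝ] ℝ} {n : E → E} {x : E}
    (hc : ContDiffAt ℝ ∞ c x) (hn : ContDiffAt ℝ ∞ n x) (hcx : c x = 0) (hnx : n x = 0) :
    fderiv ℝ (fun y ↦ c y (n y)) x = 0 := by
  rw [fderiv_clm_apply (hc.differentiableAt (by simp)) (hn.differentiableAt (by simp)), hcx, hnx]
  simp

theorem fderiv_fderiv_apply {f : E → ℝ} {x : E} (hf : ContDiffAt ℝ ∞ f x) (u w : E) :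
    fderiv ℝ (fderiv ℝ f) x w u = fderiv ℝ (fun y ↦ fderiv ℝ f y u) x w := by
  have h : DifferentiableAt ℝ (fderiv ℝ f) x :=
    (hf.fderiv_right (m := ∞) (by simp)).differentiableAt (by simp)
  rw [fderiv_clm_apply h (differentiableAt_const u)]
  simp

theorem fderiv_fderiv_clm_apply_of_eq_zero {c : E → E →L[ℝ] ℝ} {n : E → E} {x : E}
    (hc : ContDiffAt ℝ ∞ c x) (hn : ContDiffAt ℝ ∞ n x) (hcx : c x = 0) (hnx : n x = 0)
    (w u : E) :
    fderiv ℝ (fderiv ℝ fun y ↦ c y (n y)) x w u =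
      fderiv ℝ c x w (fderiv ℝ n x u) + fderiv ℝ c x u (fderiv ℝ n x w) := by
  have h1 : (fun y ↦ fderiv ℝ (fun y ↦ c y (n y)) y u) =ᶠ[𝓝 x]
      fun y ↦ c y (fderiv ℝ n y u) + fderiv ℝ c y u (n y) := by
    filter_upwards [eventually_differentiableAt hc, eventually_differentiableAt hn] with y hcy hny
    rw [fderiv_clm_apply hcy hny]
    simp
  have hn' : DifferentiableAt ℝ (fun y ↦ fderiv ℝ n y u) x :=
    ((hn.fderiv_right (m := ∞) (by simp)).clm_apply contDiffAt_const).differentiableAt (by simp)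
  have hc' : DifferentiableAt ℝ (fun y ↦ fderiv ℝ c y u) x :=
    ((hc.fderiv_right (m := ∞) (by simp)).clm_apply contDiffAt_const).differentiableAt (by simp)
  have hcd := hc.differentiableAt (by simp)
  have hnd := hn.differentiableAt (by simp)
  rw [fderiv_fderiv_apply (hc.clm_apply hn), h1.fderiv_eq,
    fderiv_fun_add (hcd.clm_apply hn') (hc'.clm_apply hnd), fderiv_clm_apply hcd hn',
    fderiv_clm_apply hc' hnd]
  simp [hcx, hnx]

theorem tendsto_line_fderiv {f : E → ℝ} {x : E} (hf : ContDiffAt ℝ ∞ f x)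
    (h0 : fderiv ℝ f x = 0) (w u : E) :
    Tendsto (fun r : ℝ ↦ r⁻¹ * fderiv ℝ f (x + r • w) u) (𝓝[≠] 0)
      (𝓝 (fderiv ℝ (fderiv ℝ f) x w u)) := by
  have h : DifferentiableAt ℝ (fun y ↦ fderiv ℝ f y u) (x + (0 : ℝ) • w) := by
    simpa using
      ((hf.fderiv_right (m := ∞) (by simp)).clm_apply contDiffAt_const).differentiableAt (by simp)
  simpa [h0, fderiv_fderiv_apply hf] using hasDerivAt_iff_tendsto_slope_zero.1 (hasDerivAt_line h)

theorem fderiv_fderiv_mul_comm_of_fderiv_eq_smul {f q : E → ℝ} {x : E} (hf : ContDiffAt ℝ ∞ f x)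
    (hq : ContDiffAt ℝ ∞ q x) (hfx : fderiv ℝ f x = 0) (hqx : fderiv ℝ q x = 0)
    (h : ∀ᶠ y in 𝓝 x, ∃ c : ℝ, fderiv ℝ q y = c • fderiv ℝ f y) (w u z : E) :
    fderiv ℝ (fderiv ℝ q) x w u * fderiv ℝ (fderiv ℝ f) x w z =
      fderiv ℝ (fderiv ℝ q) x w z * fderiv ℝ (fderiv ℝ f) x w u := by
  refine tendsto_nhds_unique_of_eventuallyEq
    ((tendsto_line_fderiv hq hqx w u).mul (tendsto_line_fderiv hf hfx w z))
    ((tendsto_line_fderiv hq hqx w z).mul (tendsto_line_fderiv hf hfx w u)) ?_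
  filter_upwards [((tendsto_line x w).mono_left nhdsWithin_le_nhds).eventually h] with r ⟨c, hc⟩
  simp only [hc, smul_apply, smul_eq_mul]
  ring

end Proportional

section Algebra

variable {V : Type*} [NormedAddCommGroup V] [InnerProductSpace ℝ V]

theorem exists_apply_apply_eq_smul_of_isSymmetric {H : V →ₗ[ℝ] V} (hH : H.IsSymmetric)
    (h : ∀ w u z, inner ℝ (H w) (H u) * inner ℝ (H w) z = inner ℝ (H w) (H z) * inner ℝ (H w) u) :
    ∃ a : ℝ, ∀ w, H (H w) = a • H w := by
  obtain ⟨a, ha⟩ := LinearMap.exists_eq_smul_id_of_forall_notLinearIndependent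
    (f := H.restrict (p := H.range) (q := H.range) fun v _ ↦ ⟨v, rfl⟩) <| by
      rintro ⟨_, w, rfl⟩ hli
      have hw : inner ℝ (H w) (H w) ≠ 0 :=
        inner_self_ne_zero.2 fun h0 ↦ hli.ne_zero 0 (Subtype.ext h0)
      have hdep : inner ℝ (H w) (H (H w)) • H w + -inner ℝ (H w) (H w) • H (H w) = 0 := by
        refine ext_inner_right ℝ fun u ↦ ?_
        rw [inner_add_left, real_inner_smul_left, real_inner_smul_left, hH (H w) u, inner_zero_left]
        linarith [h w u (H w)]
      exact hw (neg_eq_zero.1 (LinearIndependent.pair_iff.1 hli _ _ (Subtype.ext hdep)).2)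
  exact ⟨a, fun w ↦ congrArg Subtype.val (LinearMap.congr_fun ha ⟨H w, w, rfl⟩)⟩

end Algebra

section ChartFields

variable {E : Type*} [NormedAddCommGroup E] [NormedSpace ℝ E]
  {M : Type*} [TopologicalSpace M] [ChartedSpace E M]

/-- The vector field on `M` whose components in the chart `φ` are given by `n`. -/
def chartField (φ : OpenPartialHomeomorph M E) (n : E → E) (x : M) :
    TangentSpace 𝓘(ℝ, E) x :=
  VectorField.mpullback 𝓘(ℝ, E) 𝓘(ℝ, E) φ
    (fun z : E ↦ (show TangentSpace 𝓘(ℝ, E) z from n z)) x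

/-- The coordinate field of the chart `φ` in the direction `w`. -/
def coordField (φ : OpenPartialHomeomorph M E) (w : E) :
    Π x : M, TangentSpace 𝓘(ℝ, E) x :=
  chartField φ fun _ ↦ w

theorem chartField_eq_coordField (φ : OpenPartialHomeomorph M E) (n : E → E) (x : M) :
    chartField φ n x = coordField φ (n (φ x)) x := rfl

theorem coordField_apply (φ : OpenPartialHomeomorph M E) (w : E) (x : M) :
    coordField φ w x = (mfderiv 𝓘(ℝ, E) 𝓘(ℝ, E) φ x).inverse w := rfl

variable {φ : OpenPartialHomeomorph M E}

section Smooth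

variable (hφ : φ ∈ IsManifold.maximalAtlas 𝓘(ℝ, E) ∞ M)

include hφ

theorem contMDiffAt_chart {x : M} (hx : x ∈ φ.source) :
    ContMDiffAt 𝓘(ℝ, E) 𝓘(ℝ, E) ∞ φ x :=
  (contMDiffOn_of_mem_maximalAtlas hφ).contMDiffAt (φ.open_source.mem_nhds hx)

theorem contMDiffAt_chart_symm {x : E} (hx : x ∈ φ.target) :
    ContMDiffAt 𝓘(ℝ, E) 𝓘(ℝ, E) ∞ φ.symm x :=
  (contMDiffOn_symm_of_mem_maximalAtlas hφ).contMDiffAt (φ.open_target.mem_nhds hx)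

theorem mdifferentiable_chart : φ.MDifferentiable 𝓘(ℝ, E) 𝓘(ℝ, E) :=
  ⟨(contMDiffOn_of_mem_maximalAtlas hφ).mdifferentiableOn (by simp),
    (contMDiffOn_symm_of_mem_maximalAtlas hφ).mdifferentiableOn (by simp)⟩

theorem isInvertible_mfderiv_chart {x : M} (hx : x ∈ φ.source) :
    (mfderiv 𝓘(ℝ, E) 𝓘(ℝ, E) φ x).IsInvertible :=
  ⟨(mdifferentiable_chart hφ).mfderiv hx, rfl⟩

theorem mfderiv_coordField {x : M} (hx : x ∈ φ.source) (w : E) :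
    mfderiv 𝓘(ℝ, E) 𝓘(ℝ, E) φ x (coordField φ w x) = w := by
  rw [coordField_apply]
  exact (isInvertible_mfderiv_chart hφ hx).self_apply_inverse w

theorem exists_coordField_eq {x : M} (hx : x ∈ φ.source) (u : TangentSpace 𝓘(ℝ, E) x) :
    ∃ w : E, coordField φ w x = u :=
  ⟨mfderiv 𝓘(ℝ, E) 𝓘(ℝ, E) φ x u, (isInvertible_mfderiv_chart hφ hx).inverse_apply_self u⟩

theorem coordField_injective {x : M} (hx : x ∈ φ.source) {w : E} (h : coordField φ w x = 0) :
    w = 0 := by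
  have := mfderiv_coordField hφ hx w
  rw [h, map_zero] at this
  exact this.symm

theorem mfderiv_chart_symm {x : M} (hx : x ∈ φ.source) (w : E) :
    mfderiv 𝓘(ℝ, E) 𝓘(ℝ, E) φ.symm (φ x) w = coordField φ w x := by
  have h := (mdifferentiable_chart hφ).symm_comp_deriv hx
  have h1 := congrArg (fun L ↦ L (coordField φ w x)) h
  simp only [ContinuousLinearMap.comp_apply] at h1
  rw [mfderiv_coordField hφ hx] at h1
  exact h1

theorem contDiffAt_comp_chart_symm {g : M → ℝ} {x : E} (hx : x ∈ φ.target)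
    (hg : ContMDiffAt 𝓘(ℝ, E) 𝓘(ℝ, ℝ) ∞ g (φ.symm x)) :
    ContDiffAt ℝ ∞ (g ∘ φ.symm) x :=
  (hg.comp x (contMDiffAt_chart_symm hφ hx)).contDiffAt

theorem mvfderiv_coordField {g : M → ℝ} {x : M} (hx : x ∈ φ.source)
    (hg : MDifferentiableAt 𝓘(ℝ, E) 𝓘(ℝ, ℝ) g x) (w : E) :
    mvfderiv 𝓘(ℝ, E) g x (coordField φ w x) = fderiv ℝ (g ∘ φ.symm) (φ x) w := by
  have h1 : MDifferentiableAt 𝓘(ℝ, E) 𝓘(ℝ, E) φ.symm (φ x) :=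
    (contMDiffAt_chart_symm hφ (φ.map_source hx)).mdifferentiableAt (by simp)
  have h2 := mvfderiv_comp_apply_of_eq (I := 𝓘(ℝ, E)) (I' := 𝓘(ℝ, E)) (f := φ.symm) (g := g)
    (φ x) hg h1 (φ.left_inv hx) w
  have h3 : mvfderiv 𝓘(ℝ, E) (g ∘ φ.symm) (φ x) = fderiv ℝ (g ∘ φ.symm) (φ x) :=
    mfderiv_eq_fderiv
  rw [h3] at h2
  exact (congrArg (mvfderiv 𝓘(ℝ, E) g x) (mfderiv_chart_symm hφ hx w).symm).trans h2.symm

theorem fderiv_comp_chart_symm_apply {g : M → ℝ} (hg : MDifferentiable 𝓘(ℝ, E) 𝓘(ℝ, ℝ) g) {x : E}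
    (hx : x ∈ φ.target) (w : E) :
    fderiv ℝ (g ∘ φ.symm) x w = mvfderiv 𝓘(ℝ, E) g (φ.symm x) (coordField φ w (φ.symm x)) := by
  rw [mvfderiv_coordField hφ (φ.map_target hx) (hg _), φ.right_inv hx]

theorem fderiv_comp_chart_symm_eq_zero_iff {τ : M → ℝ} (hτ : MDifferentiable 𝓘(ℝ, E) 𝓘(ℝ, ℝ) τ)
    {x : E} (hx : x ∈ φ.target) :
    fderiv ℝ (τ ∘ φ.symm) x = 0 ↔ φ.symm x ∈ critSet E τ := by
  have h := fderiv_comp_chart_symm_apply hφ hτ hx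
  constructor
  · intro h0
    refine ContinuousLinearMap.ext fun u ↦ ?_
    obtain ⟨w, rfl⟩ := exists_coordField_eq hφ (φ.map_target hx) u
    rw [← h, h0]
    rfl
  · intro h0
    ext w
    rw [h, show mvfderiv 𝓘(ℝ, E) τ (φ.symm x) = 0 from h0]
    rfl

variable [IsManifold 𝓘(ℝ, E) ∞ M]

theorem contMDiffAt_chartField [FiniteDimensional ℝ E] {x : M} (hx : x ∈ φ.source) {n : E → E}
    (hn : ContDiffAt ℝ ∞ n (φ x)) :
    ContMDiffAt 𝓘(ℝ, E) 𝓘(ℝ, E).tangent ∞ (T% (chartField φ n)) x := by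
  have : CompleteSpace E := FiniteDimensional.complete ℝ E
  refine ContMDiffAt.mpullback_vectorField_preimage (n := ∞) ?_ (contMDiffAt_chart hφ hx)
    (isInvertible_mfderiv_chart hφ hx) (by simp)
  exact contMDiffAt_vectorSpace_iff_contDiffAt.2 hn

theorem mdifferentiableAt_chartField [FiniteDimensional ℝ E] {x : M} (hx : x ∈ φ.source)
    {n : E → E} (hn : ContDiffAt ℝ ∞ n (φ x)) :
    MDiffAt (T% (chartField φ n)) x :=
  (contMDiffAt_chartField hφ hx hn).mdifferentiableAt (by simp)

theorem mdifferentiableAt_coordField [FiniteDimensional ℝ E] {x : M} (hx : x ∈ φ.source) (w : E) :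
    MDiffAt (T% (coordField φ w)) x :=
  mdifferentiableAt_chartField hφ hx contDiffAt_const

theorem mlieBracket_coordField [FiniteDimensional ℝ E] {x : M} (hx : x ∈ φ.source) (u w : E) :
    VectorField.mlieBracket 𝓘(ℝ, E) (coordField φ u) (coordField φ w) x = 0 := by
  have : CompleteSpace E := FiniteDimensional.complete ℝ E
  have h : ∀ w : E, MDiffAt (T% fun z : E ↦ (show TangentSpace 𝓘(ℝ, E) z from w)) (φ x) :=
    fun w ↦ (contMDiffAt_vectorSpace_iff_contDiffAt.2
      (contDiffAt_const (n := 1))).mdifferentiableAt (by simp)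
  have : IsManifold 𝓘(ℝ, E) (minSmoothness ℝ 2) M := by
    rw [minSmoothness_of_isRCLikeNormedField]
    infer_instance
  have h2 : minSmoothness ℝ 2 ≤ (∞ : ℕ∞ω) := by
    rw [minSmoothness_of_isRCLikeNormedField]
    exact ENat.LEInfty.out
  have := VectorField.mpullback_mlieBracket (h u) (h w) (contMDiffAt_chart hφ hx) h2
  have h0 : VectorField.mlieBracket 𝓘(ℝ, E)
      (fun z : E ↦ (show TangentSpace 𝓘(ℝ, E) z from u))
      (fun z : E ↦ (show TangentSpace 𝓘(ℝ, E) z from w)) (φ x) = 0 := by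
    rw [← VectorField.mlieBracketWithin_univ, VectorField.mlieBracketWithin_eq_lieBracketWithin]
    change fderivWithin ℝ (fun _ : E ↦ w) univ (φ x) u
      - fderivWithin ℝ (fun _ : E ↦ u) univ (φ x) w = 0
    simp
  refine this.symm.trans ?_
  exact (congrArg (mfderiv 𝓘(ℝ, E) 𝓘(ℝ, E) φ x).inverse h0).trans (map_zero _)

end Smooth

end ChartFields

theorem contDiffAt_inverse_apply {X V W : Type*} [NormedAddCommGroup X] [NormedSpace ℝ X]
    [NormedAddCommGroup V] [NormedSpace ℝ V] [CompleteSpace V] [NormedAddCommGroup W]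
    [NormedSpace ℝ W] {n : ℕ∞ω} {A : X → V →L[ℝ] W} {b : X → W} {x : X} (hA : ContDiffAt ℝ n A x)
    (hi : ContinuousLinearMap.IsInvertible (A x)) (hb : ContDiffAt ℝ n b x) :
    ContDiffAt ℝ n (fun y ↦ (A y).inverse (b y)) x := by
  obtain ⟨e, he⟩ := hi
  have h1 : ContDiffAt ℝ n (fun y ↦ (A y).inverse) x := by
    refine ContDiffAt.comp (g := ContinuousLinearMap.inverse) x ?_ hA
    rw [← he]
    exact contDiffAt_map_inverse e
  exact h1.clm_apply hb

section Gradient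

variable {E : Type*} [NormedAddCommGroup E] [NormedSpace ℝ E]
  {M : Type*} [TopologicalSpace M] [ChartedSpace E M]
  [RiemannianBundle (fun x : M ↦ TangentSpace 𝓘(ℝ, E) x)]
  {φ : OpenPartialHomeomorph M E} {τ : M → ℝ}

/-- The metric in the chart `φ`: the bilinear form `w, u ↦ g(∂_w, ∂_u)` of the coordinate fields,
as a map from `E` to its dual. -/
def gram (φ : OpenPartialHomeomorph M E) (x : E) : E →L[ℝ] E →L[ℝ] ℝ :=
  let L : E →L[ℝ] TangentSpace 𝓘(ℝ, E) (φ.symm x) :=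
    (mfderiv 𝓘(ℝ, E) 𝓘(ℝ, E) φ (φ.symm x)).inverse
  (innerSL ℝ).bilinearComp L L

theorem gram_apply (x u w : E) :
    gram φ x u w = inner ℝ (coordField φ u (φ.symm x)) (coordField φ w (φ.symm x)) := rfl

/-- The components of the gradient of `τ` in the chart `φ`. -/
def gradCoord (φ : OpenPartialHomeomorph M E) (τ : M → ℝ) (x : E) : E :=
  (gram φ x).inverse (fderiv ℝ (τ ∘ φ.symm) x)

variable [FiniteDimensional ℝ E]

theorem inner_grad (τ : M → ℝ) (x : M) (w : TangentSpace 𝓘(ℝ, E) x) :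
    inner ℝ (grad E τ x) w = mvfderiv 𝓘(ℝ, E) τ x w := by
  have := complete_tangent (E := E) x
  exact InnerProductSpace.toDual_symm_apply

theorem grad_eq_zero_iff {x : M} : grad E τ x = 0 ↔ mvfderiv 𝓘(ℝ, E) τ x = 0 := by
  have := complete_tangent (E := E) x
  exact LinearIsometryEquiv.map_eq_zero_iff _

theorem mem_critSet_iff {x : M} : x ∈ critSet E τ ↔ grad E τ x = 0 :=
  grad_eq_zero_iff.symm

theorem gradSq_eq_zero_iff {x : M} : gradSq E τ x = 0 ↔ x ∈ critSet E τ := by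
  rw [mem_critSet_iff, gradSq, inner_self_eq_zero]

theorem gradSq_nonneg (x : M) : 0 ≤ gradSq E τ x := real_inner_self_nonneg

variable (hφ : φ ∈ IsManifold.maximalAtlas 𝓘(ℝ, E) ∞ M)

include hφ

theorem isInvertible_gram {x : E} (hx : x ∈ φ.target) : (gram φ x).IsInvertible := by
  have hinj : Function.Injective (gram φ x) := by
    rw [injective_iff_map_eq_zero]
    intro u hu
    have h1 : gram φ x u u = 0 := by rw [hu]; rfl
    rw [gram_apply, inner_self_eq_zero] at h1
    exact coordField_injective hφ (φ.map_target hx) h1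
  have hfr : Module.finrank ℝ E = Module.finrank ℝ (E →L[ℝ] ℝ) := by
    rw [← (LinearMap.toContinuousLinearMap (𝕜 := ℝ) (E := E) (F' := ℝ)).finrank_eq]
    exact (Subspace.dual_finrank_eq (K := ℝ) (V := E)).symm
  let e : E ≃ₗ[ℝ] (E →L[ℝ] ℝ) :=
    LinearEquiv.ofInjectiveOfFinrankEq (gram φ x : E →ₗ[ℝ] E →L[ℝ] ℝ) hinj hfr
  exact ⟨e.toContinuousLinearEquiv, by ext; rfl⟩

theorem gram_gradCoord {x : E} (hx : x ∈ φ.target) :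
    gram φ x (gradCoord φ τ x) = fderiv ℝ (τ ∘ φ.symm) x :=
  (isInvertible_gram hφ hx).self_apply_inverse _

theorem grad_eq_coordField (hτ : MDifferentiable 𝓘(ℝ, E) 𝓘(ℝ, ℝ) τ) {x : M} (hx : x ∈ φ.source) :
    grad E τ x = coordField φ (gradCoord φ τ (φ x)) x := by
  refine ext_inner_right ℝ fun w ↦ ?_
  obtain ⟨w, rfl⟩ := exists_coordField_eq hφ hx w
  rw [inner_grad, mvfderiv_coordField hφ hx (hτ x), ← gram_gradCoord hφ (φ.map_source hx),
    gram_apply, φ.left_inv hx]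

theorem gradCoord_eq_zero (hτ : MDifferentiable 𝓘(ℝ, E) 𝓘(ℝ, ℝ) τ) {x : M} (hx : x ∈ φ.source)
    (hc : x ∈ critSet E τ) : gradCoord φ τ (φ x) = 0 :=
  coordField_injective hφ hx <| by rw [← grad_eq_coordField hφ hτ hx, mem_critSet_iff.1 hc]

theorem gradSq_comp_chart_symm (hτ : MDifferentiable 𝓘(ℝ, E) 𝓘(ℝ, ℝ) τ) {x : E}
    (hx : x ∈ φ.target) :
    gradSq E τ (φ.symm x) = fderiv ℝ (τ ∘ φ.symm) x (gradCoord φ τ x) := by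
  rw [gradSq, inner_grad, grad_eq_coordField hφ hτ (φ.map_target hx), φ.right_inv hx,
    fderiv_comp_chart_symm_apply hφ hτ hx]

theorem gradSq_comp_chart_symm_eventuallyEq (hτ : MDifferentiable 𝓘(ℝ, E) 𝓘(ℝ, ℝ) τ) {x : E}
    (hx : x ∈ φ.target) :
    gradSq E τ ∘ φ.symm =ᶠ[𝓝 x] fun y ↦ fderiv ℝ (τ ∘ φ.symm) y (gradCoord φ τ y) := by
  filter_upwards [φ.open_target.mem_nhds hx] with y hy using gradSq_comp_chart_symm hφ hτ hy

variable [IsManifold 𝓘(ℝ, E) ∞ M]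
  [IsContMDiffRiemannianBundle 𝓘(ℝ, E) ∞ E (fun x : M ↦ TangentSpace 𝓘(ℝ, E) x)]

theorem contDiffAt_gram {x : E} (hx : x ∈ φ.target) : ContDiffAt ℝ ∞ (gram φ) x := by
  have h : ContDiffOn ℝ ∞ (gram φ) φ.target := by
    refine contDiffOn_clm_apply.2 fun u ↦ contDiffOn_clm_apply.2 fun w y hy ↦
      ContDiffAt.contDiffWithinAt ?_
    have hs := φ.map_target hy
    exact contDiffAt_comp_chart_symm hφ
      (g := fun p ↦ inner ℝ (coordField φ u p) (coordField φ w p)) hy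
      (ContMDiffAt.inner_bundle (IB := 𝓘(ℝ, E)) (F := E)
        (E := fun x : M ↦ TangentSpace 𝓘(ℝ, E) x) (b := fun p : M ↦ p)
        (contMDiffAt_chartField hφ hs contDiffAt_const)
        (contMDiffAt_chartField hφ hs contDiffAt_const))
  exact h.contDiffAt (φ.open_target.mem_nhds hx)

theorem contDiffAt_gradCoord {x : E} (hx : x ∈ φ.target)
    (hτ : ContMDiff 𝓘(ℝ, E) 𝓘(ℝ, ℝ) ∞ τ) : ContDiffAt ℝ ∞ (gradCoord φ τ) x := by
  have : CompleteSpace E := FiniteDimensional.complete ℝ E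
  exact contDiffAt_inverse_apply (contDiffAt_gram hφ hx) (isInvertible_gram hφ hx)
    ((contDiffAt_comp_chart_symm hφ hx hτ.contMDiffAt).fderiv_right (by simp))

omit hφ in
theorem contMDiff_grad (hτ : ContMDiff 𝓘(ℝ, E) 𝓘(ℝ, ℝ) ∞ τ) :
    ContMDiff 𝓘(ℝ, E) 𝓘(ℝ, E).tangent ∞ (T% (grad E τ)) := by
  intro x
  have hφ := IsManifold.chart_mem_maximalAtlas (I := 𝓘(ℝ, E)) (n := ∞) x
  have hx := mem_chart_source E x
  refine (contMDiffAt_chartField hφ hx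
    (contDiffAt_gradCoord hφ (OpenPartialHomeomorph.map_source _ hx) hτ)).congr_of_eventuallyEq ?_
  filter_upwards [(chartAt E x).open_source.mem_nhds hx] with y hy
  rw [grad_eq_coordField hφ (hτ.mdifferentiable (by simp)) hy, chartField_eq_coordField]

omit hφ in
theorem mdifferentiableAt_grad (hτ : ContMDiff 𝓘(ℝ, E) 𝓘(ℝ, ℝ) ∞ τ) (x : M) :
    MDiffAt (T% (grad E τ)) x :=
  (contMDiff_grad hτ).mdifferentiable (by simp) x

theorem contDiffAt_gradSq (hτ : ContMDiff 𝓘(ℝ, E) 𝓘(ℝ, ℝ) ∞ τ) {x : E} (hx : x ∈ φ.target) :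
    ContDiffAt ℝ ∞ (gradSq E τ ∘ φ.symm) x :=
  (((contDiffAt_comp_chart_symm hφ hx hτ.contMDiffAt).fderiv_right (by simp)).clm_apply
    (contDiffAt_gradCoord hφ hx hτ)).congr_of_eventuallyEq
    (gradSq_comp_chart_symm_eventuallyEq hφ (hτ.mdifferentiable (by simp)) hx)

theorem fderiv_fderiv_comp_chart_symm (hτ : ContMDiff 𝓘(ℝ, E) 𝓘(ℝ, ℝ) ∞ τ) {x : M}
    (hx : x ∈ φ.source) (u w : E) :
    fderiv ℝ (fderiv ℝ (τ ∘ φ.symm)) (φ x) u w =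
      inner ℝ (hess E τ x (coordField φ u x)) (coordField φ w x) +
      inner ℝ (grad E τ x) (leviCivita (coordField φ w) x (coordField φ u x)) := by
  have hgrad := mdifferentiableAt_grad (E := E) hτ x
  have hw := mdifferentiableAt_coordField hφ hx w
  have h : (fun y ↦ fderiv ℝ (τ ∘ φ.symm) y w) =ᶠ[𝓝 (φ x)]
      (fun p ↦ inner ℝ (grad E τ p) (coordField φ w p)) ∘ φ.symm := by
    filter_upwards [φ.open_target.mem_nhds (φ.map_source hx)] with y hy
    rw [fderiv_comp_chart_symm_apply hφ (hτ.mdifferentiable (by simp)) hy, Function.comp_apply,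
      inner_grad]
  rw [fderiv_fderiv_apply (contDiffAt_comp_chart_symm hφ (φ.map_source hx) hτ.contMDiffAt),
    h.fderiv_eq, ← mvfderiv_coordField hφ hx (mdiff_inner hgrad hw), hess,
    ← leviCivita_metric (mdifferentiableAt_coordField hφ hx u) hgrad hw]

theorem fderiv_fderiv_comp_chart_symm_of_mem_critSet (hτ : ContMDiff 𝓘(ℝ, E) 𝓘(ℝ, ℝ) ∞ τ) {x : M}
    (hx : x ∈ φ.source) (hc : x ∈ critSet E τ) (u w : E) :
    fderiv ℝ (fderiv ℝ (τ ∘ φ.symm)) (φ x) u w =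
      inner ℝ (hess E τ x (coordField φ u x)) (coordField φ w x) := by
  rw [fderiv_fderiv_comp_chart_symm hφ hτ hx, mem_critSet_iff.1 hc, inner_zero_left, add_zero]

theorem coordField_fderiv_gradCoord (hτ : ContMDiff 𝓘(ℝ, E) 𝓘(ℝ, ℝ) ∞ τ) {x : M}
    (hx : x ∈ φ.source) (hc : x ∈ critSet E τ) (w : E) :
    coordField φ (fderiv ℝ (gradCoord φ τ) (φ x) w) x = hess E τ x (coordField φ w x) := by
  have ht := φ.map_source hx
  refine ext_inner_right ℝ fun v ↦ ?_
  obtain ⟨v, rfl⟩ := exists_coordField_eq hφ hx v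
  have h : fderiv ℝ (τ ∘ φ.symm) =ᶠ[𝓝 (φ x)] fun y ↦ gram φ y (gradCoord φ τ y) := by
    filter_upwards [φ.open_target.mem_nhds ht] with y hy using (gram_gradCoord hφ hy).symm
  rw [← fderiv_fderiv_comp_chart_symm_of_mem_critSet hφ hτ hx hc, h.fderiv_eq,
    fderiv_clm_apply ((contDiffAt_gram hφ ht).differentiableAt (by simp))
      ((contDiffAt_gradCoord hφ ht hτ).differentiableAt (by simp)),
    gradCoord_eq_zero hφ (hτ.mdifferentiable (by simp)) hx hc]
  have hgram : ∀ u, gram φ (φ x) u v = inner ℝ (coordField φ u x) (coordField φ v x) := fun u ↦ by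
    rw [gram_apply, φ.left_inv hx]
  simp [hgram]

theorem fderiv_gradSq_comp_chart_symm_of_mem_critSet (hτ : ContMDiff 𝓘(ℝ, E) 𝓘(ℝ, ℝ) ∞ τ) {x : M}
    (hx : x ∈ φ.source) (hc : x ∈ critSet E τ) :
    fderiv ℝ (gradSq E τ ∘ φ.symm) (φ x) = 0 := by
  have ht := φ.map_source hx
  have hd := hτ.mdifferentiable (by simp)
  rw [(gradSq_comp_chart_symm_eventuallyEq hφ hd ht).fderiv_eq, fderiv_clm_apply_of_eq_zero
    ((contDiffAt_comp_chart_symm hφ ht hτ.contMDiffAt).fderiv_right (by simp))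
    (contDiffAt_gradCoord hφ ht hτ)
    ((fderiv_comp_chart_symm_eq_zero_iff hφ hd ht).2 (by rwa [φ.left_inv hx]))
    (gradCoord_eq_zero hφ hd hx hc)]

theorem fderiv_fderiv_gradSq_comp_chart_symm_of_mem_critSet
    (hτ : ContMDiff 𝓘(ℝ, E) 𝓘(ℝ, ℝ) ∞ τ) {x : M} (hx : x ∈ φ.source) (hc : x ∈ critSet E τ)
    (w u : E) :
    fderiv ℝ (fderiv ℝ (gradSq E τ ∘ φ.symm)) (φ x) w u =
      2 * inner ℝ (hess E τ x (coordField φ w x)) (hess E τ x (coordField φ u x)) := by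
  have ht := φ.map_source hx
  have hd := hτ.mdifferentiable (by simp)
  rw [(gradSq_comp_chart_symm_eventuallyEq hφ hd ht).fderiv.fderiv_eq,
    fderiv_fderiv_clm_apply_of_eq_zero
      ((contDiffAt_comp_chart_symm hφ ht hτ.contMDiffAt).fderiv_right (by simp))
      (contDiffAt_gradCoord hφ ht hτ)
      ((fderiv_comp_chart_symm_eq_zero_iff hφ hd ht).2 (by rwa [φ.left_inv hx]))
      (gradCoord_eq_zero hφ hd hx hc),
    fderiv_fderiv_comp_chart_symm_of_mem_critSet hφ hτ hx hc,
    fderiv_fderiv_comp_chart_symm_of_mem_critSet hφ hτ hx hc,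
    coordField_fderiv_gradCoord hφ hτ hx hc, coordField_fderiv_gradCoord hφ hτ hx hc,
    real_inner_comm (hess E τ x (coordField φ w x)), two_mul]

omit hφ

theorem inner_hess_comm (hτ : ContMDiff 𝓘(ℝ, E) 𝓘(ℝ, ℝ) ∞ τ) {x : M}
    (u w : TangentSpace 𝓘(ℝ, E) x) :
    inner ℝ (hess E τ x u) w = inner ℝ (hess E τ x w) u := by
  have : CompleteSpace E := FiniteDimensional.complete ℝ E
  have hφ := IsManifold.chart_mem_maximalAtlas (I := 𝓘(ℝ, E)) (n := ∞) x
  have hx := mem_chart_source E x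
  obtain ⟨u, rfl⟩ := exists_coordField_eq hφ hx u
  obtain ⟨w, rfl⟩ := exists_coordField_eq hφ hx w
  have hsymm := ((contDiffAt_comp_chart_symm hφ (OpenPartialHomeomorph.map_source _ hx)
    hτ.contMDiffAt).isSymmSndFDerivAt (by
      rw [minSmoothness_of_isRCLikeNormedField]; exact ENat.LEInfty.out)).eq u w
  have htorsion := (CovariantDerivative.torsion_eq_zero_iff _).1
    (leviCivita_torsion (E := E) (M := M))
    (mdifferentiableAt_coordField hφ hx u) (mdifferentiableAt_coordField hφ hx w)
  rw [mlieBracket_coordField hφ hx, sub_eq_zero] at htorsion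
  rw [fderiv_fderiv_comp_chart_symm hφ hτ hx, fderiv_fderiv_comp_chart_symm hφ hτ hx,
    htorsion] at hsymm
  exact add_right_cancel hsymm

theorem mdifferentiable_gradSq (hτ : ContMDiff 𝓘(ℝ, E) 𝓘(ℝ, ℝ) ∞ τ) :
    MDifferentiable 𝓘(ℝ, E) 𝓘(ℝ, ℝ) (gradSq E τ) :=
  fun x ↦ mdiff_inner (mdifferentiableAt_grad hτ x) (mdifferentiableAt_grad hτ x)

theorem mvfderiv_gradSq (hτ : ContMDiff 𝓘(ℝ, E) 𝓘(ℝ, ℝ) ∞ τ) {x : M}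
    (u : TangentSpace 𝓘(ℝ, E) x) :
    mvfderiv 𝓘(ℝ, E) (gradSq E τ) x u = 2 * inner ℝ (hess E τ x (grad E τ x)) u := by
  have hgrad := mdifferentiableAt_grad (E := E) hτ x
  have h := leviCivita_metric (FiberBundle.mdifferentiableAt_extend 𝓘(ℝ, E) E u) hgrad hgrad
  rw [FiberBundle.extend_apply_self, ← hess] at h
  refine h.trans ?_
  rw [real_inner_comm (grad E τ x), inner_hess_comm hτ, two_mul, real_inner_comm (grad E τ x)]

theorem exists_fderiv_gradSq_eq_smul (hφ : φ ∈ IsManifold.maximalAtlas 𝓘(ℝ, E) ∞ M)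
    (hτ : ContMDiff 𝓘(ℝ, E) 𝓘(ℝ, ℝ) ∞ τ) (hgeo : HasGeodesicGradient E τ) {x : E}
    (hx : x ∈ φ.target) :
    ∃ c : ℝ, fderiv ℝ (gradSq E τ ∘ φ.symm) x = c • fderiv ℝ (τ ∘ φ.symm) x := by
  obtain ⟨ψ, hψ⟩ := hgeo
  refine ⟨2 * ψ (φ.symm x), ContinuousLinearMap.ext fun u ↦ ?_⟩
  have hv : hess E τ (φ.symm x) (grad E τ (φ.symm x)) = ψ (φ.symm x) • grad E τ (φ.symm x) := by
    by_cases hc : grad E τ (φ.symm x) = 0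
    · simp [hc]
    · exact hψ _ hc
  rw [smul_apply, fderiv_comp_chart_symm_apply hφ (mdifferentiable_gradSq hτ) hx,
    fderiv_comp_chart_symm_apply hφ (hτ.mdifferentiable (by simp)) hx, mvfderiv_gradSq hτ, hv,
    real_inner_smul_left, inner_grad, smul_eq_mul, mul_assoc]

theorem exists_hess_hess_eq_smul (hτ : ContMDiff 𝓘(ℝ, E) 𝓘(ℝ, ℝ) ∞ τ)
    (hgeo : HasGeodesicGradient E τ) {x : M} (hc : x ∈ critSet E τ) :
    ∃ a : ℝ, ∀ w, hess E τ x (hess E τ x w) = a • hess E τ x w := by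
  have hφ := IsManifold.chart_mem_maximalAtlas (I := 𝓘(ℝ, E)) (n := ∞) x
  have hx := mem_chart_source E x
  have ht := (chartAt E x).map_source hx
  refine exists_apply_apply_eq_smul_of_isSymmetric
    (H := (hess E τ x : TangentSpace 𝓘(ℝ, E) x →ₗ[ℝ] _))
    (fun u w ↦ (inner_hess_comm hτ u w).trans (real_inner_comm _ _)) fun w u z ↦ ?_
  obtain ⟨w, rfl⟩ := exists_coordField_eq hφ hx w
  obtain ⟨u, rfl⟩ := exists_coordField_eq hφ hx u
  obtain ⟨z, rfl⟩ := exists_coordField_eq hφ hx z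
  have h := fderiv_fderiv_mul_comm_of_fderiv_eq_smul
    (contDiffAt_comp_chart_symm hφ ht hτ.contMDiffAt) (contDiffAt_gradSq hφ hτ ht)
    ((fderiv_comp_chart_symm_eq_zero_iff hφ (hτ.mdifferentiable (by simp)) ht).2
      (by rwa [(chartAt E x).left_inv hx]))
    (fderiv_gradSq_comp_chart_symm_of_mem_critSet hφ hτ hx hc)
    (((chartAt E x).open_target.eventually_mem ht).mono
      fun _ hy ↦ exists_fderiv_gradSq_eq_smul hφ hτ hgeo hy) w u z
  simp only [fderiv_fderiv_gradSq_comp_chart_symm_of_mem_critSet hφ hτ hx hc,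
    fderiv_fderiv_comp_chart_symm_of_mem_critSet hφ hτ hx hc, mul_assoc] at h
  exact mul_left_cancel₀ two_ne_zero h

end Gradient

section CriticalChart

theorem fderiv_fderiv_eq_zero_of_mem {E : Type*} [NormedAddCommGroup E] [NormedSpace ℝ E]
    {f : E → ℝ} {x : E} {F : Submodule ℝ E} (hf : ContDiffAt ℝ ∞ f x)
    (h : ∀ᶠ y in 𝓝 x, y - x ∈ F → fderiv ℝ f y = 0) {w : E} (hw : w ∈ F) :
    fderiv ℝ (fderiv ℝ f) x w = 0 := by
  ext u
  refine tendsto_nhds_unique_of_eventuallyEq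
    (tendsto_line_fderiv hf (h.self_of_nhds (by simp)) w u) tendsto_const_nhds ?_
  filter_upwards [((tendsto_line x w).mono_left nhdsWithin_le_nhds).eventually h] with r hr
  simp [hr (by simpa using F.smul_mem r hw)]

variable {E : Type*} [NormedAddCommGroup E] [NormedSpace ℝ E] [FiniteDimensional ℝ E]
  {M : Type*} [TopologicalSpace M] [ChartedSpace E M] [IsManifold 𝓘(ℝ, E) ∞ M]
  [RiemannianBundle (fun x : M ↦ TangentSpace 𝓘(ℝ, E) x)]
  [IsContMDiffRiemannianBundle 𝓘(ℝ, E) ∞ E (fun x : M ↦ TangentSpace 𝓘(ℝ, E) x)]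
  {τ : M → ℝ} {y : M} {φ : OpenPartialHomeomorph M E} {F : Submodule ℝ E} {a : ℝ}

/-- A chart around the critical point `y` in which the critical set of `τ` is, near `y`, the affine
subspace `φ y + F`, and in which `τ` is definite across it; `a` is the nonzero eigenvalue of the
Hessian of `τ` at `y`. -/
structure CriticalChart (τ : M → ℝ) (y : M) (φ : OpenPartialHomeomorph M E) (F : Submodule ℝ E)
    (a : ℝ) : Prop where
  mem_maximalAtlas : φ ∈ IsManifold.maximalAtlas 𝓘(ℝ, E) ∞ M
  mem_source : y ∈ φ.source
  isDefiniteCritical : IsDefiniteCritical (τ ∘ φ.symm) (φ y) F a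
  hess_hess : ∀ w, hess E τ y (hess E τ y w) = a • hess E τ y w

section Existence

omit [RiemannianBundle (fun x : M ↦ TangentSpace 𝓘(ℝ, E) x)]
  [IsContMDiffRiemannianBundle 𝓘(ℝ, E) ∞ E (fun x : M ↦ TangentSpace 𝓘(ℝ, E) x)]
  [FiniteDimensional ℝ E] [IsManifold 𝓘(ℝ, E) ∞ M] in
theorem eventually_fderiv_comp_chart_symm_eq_zero_iff {S : Set M}
    (hφ : φ ∈ IsManifold.maximalAtlas 𝓘(ℝ, E) ∞ M) (hτ : MDifferentiable 𝓘(ℝ, E) 𝓘(ℝ, ℝ) τ)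
    (hy : y ∈ φ.source) (hS : ∀ᶠ x in 𝓝 y, x ∈ critSet E τ ↔ x ∈ S)
    (hF : ∀ x ∈ φ.source, x ∈ S ↔ φ x - φ y ∈ F) :
    ∀ᶠ z in 𝓝 (φ y), fderiv ℝ (τ ∘ φ.symm) z = 0 ↔ z - φ y ∈ F := by
  filter_upwards [φ.open_target.eventually_mem (φ.map_source hy),
    (φ.tendsto_symm hy).eventually hS] with z hz hzS
  rw [fderiv_comp_chart_symm_eq_zero_iff hφ hτ hz, hzS, hF _ (φ.map_target hz), φ.right_inv hz]

theorem mem_of_hess_coordField_eq_zero (hφ : φ ∈ IsManifold.maximalAtlas 𝓘(ℝ, E) ∞ M)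
    (hy : y ∈ φ.source) (hF : ∀ w ∈ F, hess E τ y (coordField φ w y) = 0)
    (hrank : Module.finrank ℝ
        (LinearMap.range (hess E τ y : TangentSpace 𝓘(ℝ, E) y →ₗ[ℝ] TangentSpace 𝓘(ℝ, E) y)) =
      Module.finrank ℝ (E ⧸ F)) {w : E}
    (hw : hess E τ y (coordField φ w y) = 0) : w ∈ F := by
  let L : E →L[ℝ] TangentSpace 𝓘(ℝ, E) y := (mfderiv 𝓘(ℝ, E) 𝓘(ℝ, E) φ y).inverse
  let A : E →ₗ[ℝ] TangentSpace 𝓘(ℝ, E) y := L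
  let H : TangentSpace 𝓘(ℝ, E) y →ₗ[ℝ] TangentSpace 𝓘(ℝ, E) y := hess E τ y
  have hrange : LinearMap.range (H ∘ₗ A) = LinearMap.range H :=
    LinearMap.range_comp_of_range_eq_top _ (LinearMap.range_eq_top.2 (exists_coordField_eq hφ hy))
  have hker : F = LinearMap.ker (H ∘ₗ A) := by
    refine Submodule.eq_of_le_of_finrank_eq hF ?_
    have hquot := F.finrank_quotient_add_finrank
    have hsum := LinearMap.finrank_range_add_finrank_ker (H ∘ₗ A)
    rw [hrange] at hsum
    exact Nat.add_left_cancel ((hquot.trans hsum.symm).trans (by rw [hrank]))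
  rw [hker]
  exact hw

theorem exists_criticalChart (hMB : IsMorseBott E τ) (hgeo : HasGeodesicGradient E τ)
    (hy : y ∈ critSet E τ)
    (hcodim : ∀ k, IsSubmanifoldOfCodim E k (critComponent E τ y) → 1 < k) :
    ∃ (φ : OpenPartialHomeomorph M E) (F : Submodule ℝ E) (a : ℝ), CriticalChart τ y φ F a := by
  obtain ⟨hτ, hMB⟩ := hMB
  obtain ⟨⟨U, hU, hUC⟩, k, hk, hrank⟩ := hMB y hy
  have hyC : y ∈ critComponent E τ y := mem_connectedComponentIn hy
  obtain ⟨φ, hφ, hys, F, hFk, hF⟩ := hk y hyC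
  obtain ⟨a, ha⟩ := exists_hess_hess_eq_smul hτ hgeo hy
  have hf := contDiffAt_comp_chart_symm hφ (φ.map_source hys) hτ.contMDiffAt
  have hyU : y ∈ U := by
    rw [← hUC] at hyC
    exact hyC.1
  have hcrit := eventually_fderiv_comp_chart_symm_eq_zero_iff hφ (hτ.mdifferentiable (by simp)) hys
    ((hU.eventually_mem hyU).mono fun x hx ↦ by rw [← hUC]; exact ⟨.intro hx, And.right⟩) hF
  have hhess := fderiv_fderiv_comp_chart_symm_of_mem_critSet hφ hτ hys hy
  have hFker : ∀ w ∈ F, hess E τ y (coordField φ w y) = 0 := fun w hw ↦ by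
    refine ext_inner_right ℝ fun v ↦ ?_
    obtain ⟨v, rfl⟩ := exists_coordField_eq hφ hys v
    rw [← hhess, fderiv_fderiv_eq_zero_of_mem hf (hcrit.mono fun _ hz ↦ hz.2) hw, zero_apply,
      inner_zero_left]
  refine ⟨φ, F, a, hφ, hys, ⟨hf, ?_, hcrit, fun w hw ↦ ?_⟩, ha⟩
  · rw [← Module.finrank_eq_rank, hFk]
    exact_mod_cast hcodim k hk
  · rw [hhess, ← real_inner_smul_left, ← ha, inner_hess_comm hτ]
    exact real_inner_self_pos.2 fun h0 ↦
      hw (mem_of_hess_coordField_eq_zero hφ hys hFker ((hrank y hyC).trans hFk.symm) h0)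

end Existence

namespace CriticalChart

theorem isLocalMin (h : CriticalChart τ y φ F a) (ha : 0 < a) : IsLocalMin τ y := by
  filter_upwards [(φ.continuousAt h.mem_source).eventually (h.isDefiniteCritical.isLocalMin ha),
    φ.open_source.eventually_mem h.mem_source] with x hx hxs
  simpa [φ.left_inv h.mem_source, φ.left_inv hxs] using hx

theorem isLocalMax (h : CriticalChart τ y φ F a) (ha : a < 0) : IsLocalMax τ y := by
  filter_upwards [(φ.continuousAt h.mem_source).eventually (h.isDefiniteCritical.isLocalMax ha),
    φ.open_source.eventually_mem h.mem_source] with x hx hxs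
  simpa [φ.left_inv h.mem_source, φ.left_inv hxs] using hx

theorem isLocalMin_or_isLocalMax (h : CriticalChart τ y φ F a) :
    IsLocalMin τ y ∨ IsLocalMax τ y :=
  h.isDefiniteCritical.ne_zero.lt_or_gt.symm.imp h.isLocalMin h.isLocalMax

theorem sublevelConnectedAt (h : CriticalChart τ y φ F a) : SublevelConnectedAt τ y :=
  .of_openPartialHomeomorph φ h.mem_source (fun q hq ↦ by simp [φ.left_inv hq])
    h.isDefiniteCritical.sublevelConnectedAt

theorem sublevelConnectedAt_neg (h : CriticalChart τ y φ F a) :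
    SublevelConnectedAt (fun x ↦ -τ x) y :=
  .of_openPartialHomeomorph φ h.mem_source (fun q hq ↦ by simp [φ.left_inv hq])
    h.isDefiniteCritical.neg.sublevelConnectedAt

theorem tendsto_symm_line (h : CriticalChart τ y φ F a) (w : E) :
    Tendsto (fun r : ℝ ↦ φ.symm (φ y + r • w)) (𝓝[≠] 0) (𝓝 y) :=
  (φ.tendsto_symm h.mem_source).comp ((tendsto_line _ w).mono_left nhdsWithin_le_nhds)

theorem hasEigenvalue_iff (h : CriticalChart τ y φ F a) (hτ : ContMDiff 𝓘(ℝ, E) 𝓘(ℝ, ℝ) ∞ τ)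
    (hy : y ∈ critSet E τ) {b : ℝ} (hb : b ≠ 0) :
    Module.End.HasEigenvalue
      (hess E τ y : TangentSpace 𝓘(ℝ, E) y →ₗ[ℝ] TangentSpace 𝓘(ℝ, E) y) b ↔ b = a := by
  constructor
  · intro hev
    obtain ⟨v, hv⟩ := hev.exists_hasEigenvector
    have hb' : hess E τ y v = b • v := hv.apply_eq_smul
    have ha := h.hess_hess v
    rw [hb', map_smul, hb', smul_smul, smul_smul] at ha
    exact mul_right_cancel₀ hb (smul_left_injective ℝ hv.2 ha)
  · rintro rfl
    obtain ⟨w, hw⟩ := h.isDefiniteCritical.exists_notMem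
    refine Module.End.hasEigenvalue_of_hasEigenvector (x := hess E τ y (coordField φ w y))
      ⟨Module.End.mem_eigenspace_iff.2 (h.hess_hess _), fun h0 ↦ ?_⟩
    have hpos := h.isDefiniteCritical.definite w hw
    rw [fderiv_fderiv_comp_chart_symm_of_mem_critSet h.mem_maximalAtlas hτ h.mem_source hy, h0,
      inner_zero_left, mul_zero] at hpos
    exact hpos.false

variable (hτ : ContMDiff 𝓘(ℝ, E) 𝓘(ℝ, ℝ) ∞ τ)

include hτ

theorem mem_critSet (h : CriticalChart τ y φ F a) : y ∈ critSet E τ := by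
  simpa only [φ.left_inv h.mem_source] using
    (fderiv_comp_chart_symm_eq_zero_iff h.mem_maximalAtlas (hτ.mdifferentiable (by simp))
      (φ.map_source h.mem_source)).1 h.isDefiniteCritical.fderiv_eq_zero

theorem eventually_mem_critSet (h : CriticalChart τ y φ F a) :
    ∀ᶠ x in 𝓝 y, τ x = τ y → x ∈ critSet E τ := by
  filter_upwards [(φ.continuousAt h.mem_source).eventually
    h.isDefiniteCritical.eventually_fderiv_eq_zero_of_eq, φ.open_source.eventually_mem h.mem_source]
    with x hx hxs hxy
  simpa only [φ.left_inv hxs] using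
    (fderiv_comp_chart_symm_eq_zero_iff h.mem_maximalAtlas (hτ.mdifferentiable (by simp))
      (φ.map_source hxs)).1 (hx (by simp [φ.left_inv hxs, φ.left_inv h.mem_source, hxy]))

theorem fderiv_fderiv_gradSq (h : CriticalChart τ y φ F a) (w : E) :
    fderiv ℝ (fderiv ℝ (gradSq E τ ∘ φ.symm)) (φ y) w w =
      2 * (a * fderiv ℝ (fderiv ℝ (τ ∘ φ.symm)) (φ y) w w) := by
  rw [fderiv_fderiv_gradSq_comp_chart_symm_of_mem_critSet h.mem_maximalAtlas hτ h.mem_source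
      (h.mem_critSet hτ), fderiv_fderiv_comp_chart_symm_of_mem_critSet h.mem_maximalAtlas hτ
      h.mem_source (h.mem_critSet hτ), ← real_inner_smul_left _ _ a, ← h.hess_hess,
    inner_hess_comm hτ]

theorem tendsto_gradSq_div_sub (h : CriticalChart τ y φ F a) {w : E} (hw : w ∉ F) :
    Tendsto (fun r : ℝ ↦ gradSq E τ (φ.symm (φ y + r • w)) / (τ (φ.symm (φ y + r • w)) - τ y))
      (𝓝[≠] 0) (𝓝 (2 * a)) := by
  have hQ := tendsto_line_sub_div_sq
    (contDiffAt_gradSq h.mem_maximalAtlas hτ (φ.map_source h.mem_source))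
    (fderiv_gradSq_comp_chart_symm_of_mem_critSet h.mem_maximalAtlas hτ h.mem_source
      (h.mem_critSet hτ)) w
  have hlim := hQ.div (tendsto_line_sub_div_sq h.isDefiniteCritical.contDiffAt
    h.isDefiniteCritical.fderiv_eq_zero w)
    (div_ne_zero (right_ne_zero_of_mul (h.isDefiniteCritical.definite w hw).ne') two_ne_zero)
  rw [h.fderiv_fderiv_gradSq hτ, div_div_div_cancel_right₀ two_ne_zero, ← mul_assoc,
    mul_div_cancel_right₀ _ (right_ne_zero_of_mul (h.isDefiniteCritical.definite w hw).ne')] at hlim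
  refine hlim.congr' ?_
  filter_upwards [self_mem_nhdsWithin] with r hr
  simp only [Function.comp_apply, Pi.div_apply, φ.left_inv h.mem_source,
    gradSq_eq_zero_iff.2 (h.mem_critSet hτ), sub_zero]
  exact div_div_div_cancel_right₀ (pow_ne_zero 2 hr) _ _

theorem frequently_ne (h : CriticalChart τ y φ F a) : ∃ᶠ x in 𝓝 y, τ x ≠ τ y := by
  obtain ⟨w, hw⟩ := h.isDefiniteCritical.exists_notMem
  refine (h.tendsto_symm_line w).frequently (Eventually.frequently ?_)
  filter_upwards [(h.tendsto_gradSq_div_sub hτ hw).eventually_ne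
    (mul_ne_zero two_ne_zero h.isDefiniteCritical.ne_zero)] with r hr heq
  exact hr (by simp [heq])

theorem pos_of_isLocalMin (h : CriticalChart τ y φ F a) (hmin : IsLocalMin τ y) : 0 < a := by
  obtain ⟨w, hw⟩ := h.isDefiniteCritical.exists_notMem
  have hlim := ge_of_tendsto (h.tendsto_gradSq_div_sub hτ hw)
    (((h.tendsto_symm_line w).eventually hmin).mono fun r hr ↦
      div_nonneg (gradSq_nonneg _) (sub_nonneg.2 hr))
  exact (nonneg_of_mul_nonneg_right hlim two_pos).lt_of_ne' h.isDefiniteCritical.ne_zero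

theorem neg_of_isLocalMax (h : CriticalChart τ y φ F a) (hmax : IsLocalMax τ y) : a < 0 := by
  obtain ⟨w, hw⟩ := h.isDefiniteCritical.exists_notMem
  have hlim := le_of_tendsto (h.tendsto_gradSq_div_sub hτ hw)
    (((h.tendsto_symm_line w).eventually hmax).mono fun r hr ↦
      div_nonpos_of_nonneg_of_nonpos (gradSq_nonneg _) (sub_nonpos.2 hr))
  exact (nonpos_of_mul_nonpos_right hlim two_pos).lt_of_ne h.isDefiniteCritical.ne_zero

variable {χ : ℝ → ℝ} (hχ : ∀ x, gradSq E τ x = χ (τ x))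

include hχ

theorem contDiffWithinAt_Ici (h : CriticalChart τ y φ F a) (ha : 0 < a) :
    ContDiffWithinAt ℝ ∞ χ (Ici (τ y)) (τ y) := by
  obtain ⟨w, hw⟩ := h.isDefiniteCritical.exists_notMem
  simpa [φ.left_inv h.mem_source] using contDiffWithinAt_Ici_of_eventually_eq_comp
    h.isDefiniteCritical.contDiffAt
    (contDiffAt_gradSq h.mem_maximalAtlas hτ (φ.map_source h.mem_source))
    (.of_forall fun _ ↦ hχ _) h.isDefiniteCritical.fderiv_eq_zero
    (h.isDefiniteCritical.fderiv_fderiv_pos ha hw)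

theorem contDiffWithinAt_Iic (h : CriticalChart τ y φ F a) (ha : a < 0) :
    ContDiffWithinAt ℝ ∞ χ (Iic (τ y)) (τ y) := by
  obtain ⟨w, hw⟩ := h.isDefiniteCritical.exists_notMem
  simpa [φ.left_inv h.mem_source] using contDiffWithinAt_Iic_of_eventually_eq_comp
    h.isDefiniteCritical.contDiffAt
    (contDiffAt_gradSq h.mem_maximalAtlas hτ (φ.map_source h.mem_source))
    (.of_forall fun _ ↦ hχ _) h.isDefiniteCritical.fderiv_eq_zero
    (h.isDefiniteCritical.fderiv_fderiv_neg ha hw)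

theorem hasDerivWithinAt (h : CriticalChart τ y φ F a) {S : Set ℝ} (hS : ∀ x, τ x ∈ S)
    (hd : DifferentiableWithinAt ℝ χ S (τ y)) : HasDerivWithinAt χ (2 * a) S (τ y) := by
  obtain ⟨w, hw⟩ := h.isDefiniteCritical.exists_notMem
  have hlim := h.tendsto_gradSq_div_sub hτ hw
  have hτlim : Tendsto (fun r : ℝ ↦ τ (φ.symm (φ y + r • w))) (𝓝[≠] 0)
      (𝓝[S \ {τ y}] (τ y)) := by
    refine tendsto_nhdsWithin_iff.2
      ⟨(hτ.continuous.tendsto y).comp (h.tendsto_symm_line w), ?_⟩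
    filter_upwards [hlim.eventually_ne (mul_ne_zero two_ne_zero h.isDefiniteCritical.ne_zero)]
      with r hr
    exact ⟨hS _, fun heq ↦ hr (by simp [mem_singleton_iff.1 heq])⟩
  have hslope := (hasDerivWithinAt_iff_tendsto_slope.1 hd.hasDerivWithinAt).comp hτlim
  rw [← tendsto_nhds_unique hslope (hlim.congr fun r ↦ ?_)]
  · exact hd.hasDerivWithinAt
  · rw [Function.comp_apply, slope_def_field, ← hχ, ← hχ,
      gradSq_eq_zero_iff.2 (h.mem_critSet hτ), sub_zero]

end CriticalChart

end CriticalChart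

section ConnectedLevel

variable {M : Type*} [TopologicalSpace M] {τ : M → ℝ}

theorem le_of_forall_isLocalMin [PreconnectedSpace M] (hτ : Continuous τ) {y : M}
    (h : ∀ x, τ x = τ y → IsLocalMin τ x) (x : M) : τ y ≤ τ x := by
  have hopen : IsOpen {x | τ y ≤ τ x} := isOpen_iff_mem_nhds.2 fun x (hx : τ y ≤ τ x) ↦ by
    rcases hx.eq_or_lt with hx | hx
    · exact (h x hx.symm).mono fun z hz ↦ hx.trans_le hz
    · exact (hτ.continuousAt.eventually_const_lt hx).mono fun z hz ↦ hz.le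
  have huniv : {x | τ y ≤ τ x} = univ :=
    IsClopen.eq_univ ⟨isClosed_le continuous_const hτ, hopen⟩ ⟨y, le_refl (τ y)⟩
  exact eq_univ_iff_forall.1 huniv x

theorem ge_of_forall_isLocalMax [PreconnectedSpace M] (hτ : Continuous τ) {y : M}
    (h : ∀ x, τ x = τ y → IsLocalMax τ x) (x : M) : τ x ≤ τ y :=
  neg_le_neg_iff.1 (le_of_forall_isLocalMin hτ.neg (fun x hx ↦ (h x (neg_injective hx)).neg) x)

theorem forall_isLocalMin_or_forall_isLocalMax {t : ℝ} (ht : IsPreconnected {x | τ x = t})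
    (h : ∀ x, τ x = t → IsLocalExtr τ x) (hne : ∀ x, τ x = t → ∃ᶠ q in 𝓝 x, τ q ≠ τ x) :
    (∀ x, τ x = t → IsLocalMin τ x) ∨ ∀ x, τ x = t → IsLocalMax τ x := by
  have hnot : ∀ x, τ x = t → IsLocalMax τ x → ¬ IsLocalMin τ x := fun x hx hmax hmin ↦
    hne x hx ((hmax.and hmin).mono fun z hz ↦ not_not.2 (le_antisymm hz.1 hz.2))
  have hconst : ∀ x, τ x = t → ∀ᶠ z in 𝓝[{x | τ x = t}] x, IsLocalMin τ z = IsLocalMin τ x := by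
    refine fun x hx ↦ eventually_nhdsWithin_iff.2 ?_
    rcases h x hx with hmin | hmax
    · filter_upwards [eventually_eventually_nhds.2 hmin] with z hz hzt
      exact propext ⟨fun _ ↦ hmin, fun _ ↦ hz.mono fun q hq ↦ (hzt.trans hx.symm).trans_le hq⟩
    · filter_upwards [eventually_eventually_nhds.2 hmax] with z hz hzt
      have hzmax : IsLocalMax τ z := hz.mono fun q hq ↦ hq.trans_eq (hx.trans (Eq.symm hzt))
      exact propext (iff_of_false (hnot z hzt hzmax) (hnot x hx hmax))
  by_cases hmin : ∃ x, τ x = t ∧ IsLocalMin τ x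
  · obtain ⟨x, hx, hmin⟩ := hmin
    exact Or.inl fun z hz ↦ (eq_of_isPreconnected ht hconst hz hx).mpr hmin
  · exact Or.inr fun x hx ↦ (h x hx).resolve_left fun hx' ↦ hmin ⟨x, hx, hx'⟩

end ConnectedLevel

section ChartAt

variable {E : Type*} [NormedAddCommGroup E] [NormedSpace ℝ E]
  {M : Type*} [TopologicalSpace M] [ChartedSpace E M] [IsManifold 𝓘(ℝ, E) ∞ M]
  {τ : M → ℝ} (hτ : ContMDiff 𝓘(ℝ, E) 𝓘(ℝ, ℝ) ∞ τ)

include hτ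

theorem fderiv_comp_chartAt_symm_eq_zero_iff (x : M) :
    fderiv ℝ (τ ∘ (chartAt E x).symm) (chartAt E x x) = 0 ↔ x ∈ critSet E τ := by
  rw [fderiv_comp_chart_symm_eq_zero_iff (IsManifold.chart_mem_maximalAtlas x)
    (hτ.mdifferentiable (by simp)) (mem_chart_target E x),
    (chartAt E x).left_inv (mem_chart_source E x)]

theorem mem_critSet_of_isLocalExtr {x : M} (h : IsLocalExtr τ x) : x ∈ critSet E τ := by
  refine (fderiv_comp_chartAt_symm_eq_zero_iff hτ x).1 (IsLocalExtr.fderiv_eq_zero ?_)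
  have hx := (chartAt E x).left_inv (mem_chart_source E x)
  rw [← hx] at h
  exact h.comp_tendsto
    (by simpa only [hx] using (chartAt E x).tendsto_symm (mem_chart_source E x))

theorem hasStrictFDerivAt_comp_chartAt_symm (x : M) :
    HasStrictFDerivAt (τ ∘ (chartAt E x).symm)
      (fderiv ℝ (τ ∘ (chartAt E x).symm) (chartAt E x x)) (chartAt E x x) :=
  (contDiffAt_comp_chart_symm (IsManifold.chart_mem_maximalAtlas x) (mem_chart_target E x)
    hτ.contMDiffAt).hasStrictFDerivAt (by simp)

variable [FiniteDimensional ℝ E]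

theorem sublevelConnectedAt_of_notMem_critSet {x : M} (hx : x ∉ critSet E τ) :
    SublevelConnectedAt τ x :=
  .of_openPartialHomeomorph (chartAt E x) (mem_chart_source E x)
    (fun q hq ↦ by simp [(chartAt E x).left_inv hq])
    (sublevelConnectedAt_of_hasStrictFDerivAt (hasStrictFDerivAt_comp_chartAt_symm hτ x)
      ((fderiv_comp_chartAt_symm_eq_zero_iff hτ x).not.2 hx))

theorem sublevelConnectedAt_neg_of_notMem_critSet {x : M} (hx : x ∉ critSet E τ) :
    SublevelConnectedAt (fun z ↦ -τ z) x :=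
  .of_openPartialHomeomorph (chartAt E x) (mem_chart_source E x)
    (fun q hq ↦ by simp [(chartAt E x).left_inv hq])
    (sublevelConnectedAt_of_hasStrictFDerivAt (hasStrictFDerivAt_comp_chartAt_symm hτ x).neg
      (neg_ne_zero.2 ((fderiv_comp_chartAt_symm_eq_zero_iff hτ x).not.2 hx)))

end ChartAt

section Levels

variable {E : Type*} [NormedAddCommGroup E] [NormedSpace ℝ E] [FiniteDimensional ℝ E]
  {M : Type*} [TopologicalSpace M] [ChartedSpace E M] [IsManifold 𝓘(ℝ, E) ∞ M]
  [RiemannianBundle (fun x : M ↦ TangentSpace 𝓘(ℝ, E) x)]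
  [IsContMDiffRiemannianBundle 𝓘(ℝ, E) ∞ E (fun x : M ↦ TangentSpace 𝓘(ℝ, E) x)]
  {τ : M → ℝ} (hτ : ContMDiff 𝓘(ℝ, E) 𝓘(ℝ, ℝ) ∞ τ)

include hτ

theorem eventually_gradSq_eq_of_notMem_critSet (hgeo : HasGeodesicGradient E τ) {x : M}
    (hx : x ∉ critSet E τ) : ∀ᶠ y in 𝓝 x, τ y = τ x → gradSq E τ y = gradSq E τ x := by
  have : CompleteSpace E := FiniteDimensional.complete ℝ E
  have hφ := IsManifold.chart_mem_maximalAtlas (I := 𝓘(ℝ, E)) (n := ∞) x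
  have hs := mem_chart_source E x
  have htarget := (chartAt E x).open_target.eventually_mem (mem_chart_target E x)
  have hev := eventually_eq_of_fderiv_eq_smul
    (contDiffAt_comp_chart_symm hφ (mem_chart_target E x) hτ.contMDiffAt)
    ((fderiv_comp_chartAt_symm_eq_zero_iff hτ x).not.2 hx)
    (htarget.mono fun z hz ↦ (contDiffAt_gradSq hφ hτ hz).differentiableAt (by simp))
    (htarget.mono fun z hz ↦ exists_fderiv_gradSq_eq_smul hφ hτ hgeo hz)
  filter_upwards [((chartAt E x).continuousAt hs).eventually hev,
    (chartAt E x).open_source.eventually_mem hs] with y hy hys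
  simpa [(chartAt E x).left_inv hs, (chartAt E x).left_inv hys] using hy

theorem contDiffAt_of_gradSq_eq_comp {χ : ℝ → ℝ} (hχ : ∀ x, gradSq E τ x = χ (τ x)) {x : M}
    (hx : x ∉ critSet E τ) : ContDiffAt ℝ ∞ χ (τ x) := by
  have hφ := IsManifold.chart_mem_maximalAtlas (I := 𝓘(ℝ, E)) (n := ∞) x
  simpa [(chartAt E x).left_inv (mem_chart_source E x)] using contDiffAt_of_eventually_eq_comp
    (contDiffAt_comp_chart_symm hφ (mem_chart_target E x) hτ.contMDiffAt)
    (contDiffAt_gradSq hφ hτ (mem_chart_target E x)) (.of_forall fun z ↦ hχ _)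
    ((fderiv_comp_chartAt_symm_eq_zero_iff hτ x).not.2 hx)

variable (hcrit : ∀ y ∈ critSet E τ, ∃ φ F a, CriticalChart (E := E) τ y φ F a)

include hcrit

theorem sublevelConnectedAt (x : M) : SublevelConnectedAt τ x := by
  by_cases hx : x ∈ critSet E τ
  · obtain ⟨φ, F, a, h⟩ := hcrit x hx
    exact h.sublevelConnectedAt
  · exact sublevelConnectedAt_of_notMem_critSet hτ hx

theorem sublevelConnectedAt_neg (x : M) : SublevelConnectedAt (fun z ↦ -τ z) x := by
  by_cases hx : x ∈ critSet E τ
  · obtain ⟨φ, F, a, h⟩ := hcrit x hx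
    exact h.sublevelConnectedAt_neg
  · exact sublevelConnectedAt_neg_of_notMem_critSet hτ hx

theorem eventually_gradSq_eq_of_eq (hgeo : HasGeodesicGradient E τ) (x : M) :
    ∀ᶠ y in 𝓝 x, τ y = τ x → gradSq E τ y = gradSq E τ x := by
  by_cases hx : x ∈ critSet E τ
  · obtain ⟨φ, F, a, h⟩ := hcrit x hx
    filter_upwards [h.eventually_mem_critSet hτ] with y hy hyx
    rw [gradSq_eq_zero_iff.2 hx, gradSq_eq_zero_iff.2 (hy hyx)]
  · exact eventually_gradSq_eq_of_notMem_critSet hτ hgeo hx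

variable [CompactSpace M] [T2Space M] [ConnectedSpace M]

theorem isPreconnected_level_of_criticalChart (t : ℝ) : IsPreconnected {x | τ x = t} :=
  isPreconnected_level hτ.continuous (sublevelConnectedAt hτ hcrit)
    (sublevelConnectedAt_neg hτ hcrit) t

theorem gradSq_eq_of_eq (hgeo : HasGeodesicGradient E τ) {x y : M} (hxy : τ x = τ y) :
    gradSq E τ x = gradSq E τ y := by
  refine eq_of_isPreconnected (isPreconnected_level_of_criticalChart hτ hcrit (τ y))
    (fun z hz ↦ eventually_nhdsWithin_iff.2 ?_) hxy rfl
  filter_upwards [eventually_gradSq_eq_of_eq hτ hcrit hgeo z] with q hq hqy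
  exact hq (hqy.trans (Eq.symm hz))

theorem isMin_or_isMax_of_mem_critSet (hgeo : HasGeodesicGradient E τ) {y : M}
    (hy : y ∈ critSet E τ) : (∀ x, τ y ≤ τ x) ∨ ∀ x, τ x ≤ τ y := by
  have hlevel : ∀ x, τ x = τ y → x ∈ critSet E τ := fun x hx ↦
    gradSq_eq_zero_iff.1 ((gradSq_eq_of_eq hτ hcrit hgeo hx).trans (gradSq_eq_zero_iff.2 hy))
  have hextr : ∀ x, τ x = τ y → IsLocalExtr τ x := fun x hx ↦ by
    obtain ⟨φ, F, a, h⟩ := hcrit x (hlevel x hx)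
    exact h.isLocalMin_or_isLocalMax
  have hne : ∀ x, τ x = τ y → ∃ᶠ q in 𝓝 x, τ q ≠ τ x := fun x hx ↦ by
    obtain ⟨φ, F, a, h⟩ := hcrit x (hlevel x hx)
    exact h.frequently_ne hτ
  exact (forall_isLocalMin_or_forall_isLocalMax
    (isPreconnected_level_of_criticalChart hτ hcrit (τ y)) hextr hne).imp
    (le_of_forall_isLocalMin hτ.continuous) (ge_of_forall_isLocalMax hτ.continuous)

theorem exists_gradSq_eq_comp (hgeo : HasGeodesicGradient E τ) :
    ∃ χ : ℝ → ℝ, ∀ x, gradSq E τ x = χ (τ x) := by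
  have hfac : Function.FactorsThrough (gradSq E τ) τ := fun x y h ↦
    gradSq_eq_of_eq hτ hcrit hgeo h
  exact ⟨Function.extend τ (gradSq E τ) 0, fun x ↦ (hfac.extend_apply 0 x).symm⟩

theorem contDiffOn_range_of_gradSq_eq_comp (hgeo : HasGeodesicGradient E τ) {χ : ℝ → ℝ}
    (hχ : ∀ x, gradSq E τ x = χ (τ x)) : ContDiffOn ℝ ∞ χ (range τ) := by
  rintro _ ⟨x, rfl⟩
  by_cases hx : x ∈ critSet E τ
  · obtain ⟨φ, F, a, h⟩ := hcrit x hx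
    rcases isMin_or_isMax_of_mem_critSet hτ hcrit hgeo hx with hmin | hmax
    · exact (h.contDiffWithinAt_Ici hτ hχ (h.pos_of_isLocalMin hτ (.of_forall hmin))).mono
        (range_subset_iff.2 hmin)
    · exact (h.contDiffWithinAt_Iic hτ hχ (h.neg_of_isLocalMax hτ (.of_forall hmax))).mono
        (range_subset_iff.2 hmax)
  · exact (contDiffAt_of_gradSq_eq_comp hτ hχ hx).contDiffWithinAt

end Levels

section Primitive

open MeasureTheory

variable {f : ℝ → ℝ} {a b : ℝ}

theorem hasDerivAt_integral_of_continuousOn_Ioo (hc : ContinuousOn f (Ioo a b))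
    (hint : IntervalIntegrable f volume a b) {t : ℝ} (ht : t ∈ Ioo a b) :
    HasDerivAt (fun t ↦ ∫ u in a..t, f u) (f t) t :=
  intervalIntegral.integral_hasDerivAt_right
    (hint.mono_set (uIcc_subset_uIcc_left (Icc_subset_uIcc (Ioo_subset_Icc_self ht))))
    (hc.stronglyMeasurableAtFilter isOpen_Ioo t ht) (hc.continuousAt (Ioo_mem_nhds ht.1 ht.2))

theorem continuousOn_integral_Icc (hab : a ≤ b) (hint : IntervalIntegrable f volume a b) :
    ContinuousOn (fun t ↦ ∫ u in a..t, f u) (Icc a b) :=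
  uIcc_of_le hab ▸ intervalIntegral.continuousOn_primitive_interval
    ((intervalIntegrable_iff' (μ := volume)).1 hint)

theorem strictMonoOn_integral_Icc (hab : a ≤ b) (hc : ContinuousOn f (Ioo a b))
    (hpos : ∀ t ∈ Ioo a b, 0 < f t) (hint : IntervalIntegrable f volume a b) :
    StrictMonoOn (fun t ↦ ∫ u in a..t, f u) (Icc a b) := by
  refine strictMonoOn_of_deriv_pos (convex_Icc a b) (continuousOn_integral_Icc hab hint)
    fun t ht ↦ ?_
  rw [interior_Icc] at ht
  rw [(hasDerivAt_integral_of_continuousOn_Ioo hc hint ht).deriv]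
  exact hpos t ht

theorem contDiff_one_integral (hf : Continuous f) (a : ℝ) :
    ContDiff ℝ 1 (fun t ↦ ∫ u in a..t, f u) := by
  refine contDiff_one_iff_deriv.2 ⟨fun t ↦
    (hf.integral_hasStrictDerivAt a t).hasDerivAt.differentiableAt, ?_⟩
  rwa [funext (hf.deriv_integral f a)]

end Primitive

section Inverse

theorem continuousOn_image_of_leftInvOn {X Y : Type*} [TopologicalSpace X] [TopologicalSpace Y]
    [T2Space Y] {f : X → Y} {g : Y → X} {K : Set X} (hK : IsCompact K) (hf : ContinuousOn f K)
    (hg : LeftInvOn g f K) : ContinuousOn g (f '' K) := by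
  refine continuousOn_iff_isClosed.2 fun C hC ↦ ⟨f '' (C ∩ K),
    ((hK.inter_left hC).image_of_continuousOn (hf.mono inter_subset_right)).isClosed, ?_⟩
  ext y
  constructor
  · rintro ⟨hy, x, hx, rfl⟩
    exact ⟨⟨x, ⟨by simpa [hg hx] using hy, hx⟩, rfl⟩, x, hx, rfl⟩
  · rintro ⟨⟨x, ⟨hxC, hx⟩, rfl⟩, hy⟩
    exact ⟨by simpa [hg hx] using hxC, hy⟩

variable {s : ℝ → ℝ} {a b : ℝ}

theorem isHomeoOn_Icc_of_strictMonoOn (hab : a ≤ b) (hc : ContinuousOn s (Icc a b))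
    (hm : StrictMonoOn s (Icc a b)) : IsHomeoOn s (Icc a b) (Icc (s a) (s b)) := by
  have ha := left_mem_Icc.2 hab
  have hb := right_mem_Icc.2 hab
  have hbij : BijOn s (Icc a b) (Icc (s a) (s b)) :=
    ⟨hm.monotoneOn.mapsTo_Icc, hm.injOn, hc.surjOn_Icc ha hb⟩
  refine ⟨Function.invFunOn s (Icc a b), hbij.mapsTo, hbij.surjOn.mapsTo_invFunOn,
    hbij.invOn_invFunOn, hc, ?_⟩
  rw [← hbij.image_eq]
  exact continuousOn_image_of_leftInvOn isCompact_Icc hc hbij.invOn_invFunOn.1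

theorem isDiffeoOn_Ioo_of_strictMonoOn (hab : a ≤ b) (hc : ContinuousOn s (Icc a b))
    (hm : StrictMonoOn s (Icc a b)) (hs : ContDiffOn ℝ ∞ s (Ioo a b))
    (hd : ∀ t ∈ Ioo a b, deriv s t ≠ 0) : IsDiffeoOn s (Ioo a b) (Ioo (s a) (s b)) := by
  obtain ⟨h, -, hIcc, hinv, -, hhc⟩ := isHomeoOn_Icc_of_strictMonoOn hab hc hm
  have ha := left_mem_Icc.2 hab
  have hb := right_mem_Icc.2 hab
  have hmaps : MapsTo s (Ioo a b) (Ioo (s a) (s b)) := fun t ht ↦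
    ⟨hm ha (Ioo_subset_Icc_self ht) ht.1, hm (Ioo_subset_Icc_self ht) hb ht.2⟩
  have hmaps' : MapsTo h (Ioo (s a) (s b)) (Ioo a b) := fun r hr ↦ by
    have hr' := Ioo_subset_Icc_self hr
    exact ⟨(hm.lt_iff_lt ha (hIcc hr')).1 (by rw [hinv.2 hr']; exact hr.1),
      (hm.lt_iff_lt (hIcc hr') hb).1 (by rw [hinv.2 hr']; exact hr.2)⟩
  refine ⟨h, hmaps, hmaps', hinv.mono Ioo_subset_Icc_self Ioo_subset_Icc_self, hs, fun r hr ↦ ?_⟩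
  let e : OpenPartialHomeomorph ℝ ℝ :=
    { toFun := s, invFun := h, source := Ioo a b, target := Ioo (s a) (s b)
      map_source' := hmaps
      map_target' := hmaps'
      left_inv' := fun t ht ↦ hinv.1 (Ioo_subset_Icc_self ht)
      right_inv' := fun t ht ↦ hinv.2 (Ioo_subset_Icc_self ht)
      open_source := isOpen_Ioo
      open_target := isOpen_Ioo
      continuousOn_toFun := hs.continuousOn
      continuousOn_invFun := hhc.mono Ioo_subset_Icc_self }
  have hsr : ContDiffAt ℝ ∞ s (h r) := hs.contDiffAt (isOpen_Ioo.mem_nhds (hmaps' hr))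
  exact (e.contDiffAt_symm_deriv (hd _ (hmaps' hr)) hr
    (hsr.differentiableAt (by simp)).hasDerivAt hsr).contDiffWithinAt

end Inverse

section Profile

open MeasureTheory

variable {χ : ℝ → ℝ} {a b : ℝ}

theorem eventually_mul_sub_lt_sub_of_hasDerivWithinAt {c p : ℝ}
    (hd : HasDerivWithinAt χ p (Ioi a) a) (hc : c < p) :
    ∀ᶠ t in 𝓝[>] a, c * (t - a) < χ t - χ a := by
  have hslope := (hasDerivWithinAt_iff_tendsto_slope' self_notMem_Ioi).1 hd
  filter_upwards [hslope.eventually_const_lt hc, self_mem_nhdsWithin] with t ht (hat : a < t)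
  rwa [slope_def_field, lt_div_iff₀ (sub_pos.2 hat)] at ht

theorem intervalIntegrable_rpow_of_mul_sub_le {c r : ℝ} (hab : a ≤ b)
    (hχ : ContinuousOn χ (Ioc a b)) (hc : 0 < c) (hle : ∀ t ∈ Ioc a b, c * (t - a) ≤ χ t)
    (hr : -1 < r) (hr0 : r ≤ 0) : IntervalIntegrable (fun t ↦ χ t ^ r) volume a b := by
  have hpos : ∀ t ∈ Ioc a b, 0 < c * (t - a) := fun t ht ↦ mul_pos hc (sub_pos.2 ht.1)
  have hbound : IntervalIntegrable (fun t ↦ (c * (t - a)) ^ r) volume a b := by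
    have hshift :=
      (intervalIntegral.intervalIntegrable_rpow' (a := 0) (b := b - a) hr).comp_sub_right a
    rw [zero_add, sub_add_cancel] at hshift
    refine (hshift.const_mul (c ^ r)).congr fun t ht ↦ ?_
    rw [uIoc_of_le hab] at ht
    exact (Real.mul_rpow hc.le (sub_pos.2 ht.1).le).symm
  refine hbound.mono_fun' ?_ ?_ <;> rw [uIoc_of_le hab]
  · exact (hχ.rpow_const fun t ht ↦ .inl ((hpos t ht).trans_le (hle t ht)).ne').aestronglyMeasurable
      measurableSet_Ioc
  · filter_upwards [ae_restrict_mem measurableSet_Ioc] with t ht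
    rw [Real.norm_of_nonneg (Real.rpow_nonneg ((hpos t ht).le.trans (hle t ht)) _)]
    exact Real.rpow_le_rpow_of_nonpos (hpos t ht) (hle t ht) hr0

/-- The shape of `Q` as a function of `τ`: continuous on `[a, b]`, positive inside, with a simple
zero at either end. -/
structure IsProfile (χ : ℝ → ℝ) (a b : ℝ) : Prop where
  lt : a < b
  continuousOn : ContinuousOn χ (Icc a b)
  pos : ∀ t ∈ Ioo a b, 0 < χ t
  left_eq_zero : χ a = 0
  right_eq_zero : χ b = 0
  exists_hasDerivWithinAt_left : ∃ p > 0, HasDerivWithinAt χ p (Icc a b) a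
  exists_hasDerivWithinAt_right : ∃ q < 0, HasDerivWithinAt χ q (Icc a b) b

namespace IsProfile

theorem nonneg (h : IsProfile χ a b) {t : ℝ} (ht : t ∈ Icc a b) : 0 ≤ χ t := by
  rcases eq_endpoints_or_mem_Ioo_of_mem_Icc ht with rfl | rfl | ht
  · exact h.left_eq_zero.ge
  · exact h.right_eq_zero.ge
  · exact (h.pos t ht).le

theorem comp_neg (h : IsProfile χ a b) : IsProfile (fun t ↦ χ (-t)) (-b) (-a) := by
  have hmaps : MapsTo Neg.neg (Icc (-b) (-a)) (Icc a b) := fun t ht ↦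
    ⟨le_neg.1 ht.2, neg_le.1 ht.1⟩
  have hderiv {p t : ℝ} (hd : HasDerivWithinAt χ p (Icc a b) t) :
      HasDerivWithinAt (fun t ↦ χ (-t)) (-p) (Icc (-b) (-a)) (-t) := by
    rw [← neg_neg t] at hd
    simpa [Function.comp_def] using hd.comp (-t) (hasDerivAt_neg (-t)).hasDerivWithinAt hmaps
  obtain ⟨p, hp, hdp⟩ := h.exists_hasDerivWithinAt_left
  obtain ⟨q, hq, hdq⟩ := h.exists_hasDerivWithinAt_right
  exact ⟨neg_lt_neg h.lt, h.continuousOn.comp continuous_neg.continuousOn hmaps,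
    fun t ht ↦ h.pos _ ⟨lt_neg.1 ht.2, neg_lt.1 ht.1⟩, by simpa using h.right_eq_zero,
    by simpa using h.left_eq_zero, ⟨-q, neg_pos.2 hq, hderiv hdq⟩,
    ⟨-p, neg_neg_iff_pos.2 hp, hderiv hdp⟩⟩

theorem continuousOn_rpow (h : IsProfile χ a b) (r : ℝ) :
    ContinuousOn (fun t ↦ χ t ^ r) (Ioo a b) :=
  (h.continuousOn.mono Ioo_subset_Icc_self).rpow_const fun t ht ↦ .inl (h.pos t ht).ne'

theorem exists_intervalIntegrable_left (h : IsProfile χ a b) :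
    ∃ c ∈ Ioo a b, IntervalIntegrable (fun t ↦ χ t ^ (-(1 / 2) : ℝ)) volume a c := by
  obtain ⟨p, hp, hd⟩ := h.exists_hasDerivWithinAt_left
  have hd' : HasDerivWithinAt χ p (Ioi a) a :=
    (hasDerivWithinAt_inter (Iic_mem_nhds h.lt)).1 (hd.mono fun t ht ↦ ⟨le_of_lt ht.1, ht.2⟩)
  obtain ⟨u, hu, hlt⟩ := (mem_nhdsGT_iff_exists_mem_Ioc_Ioo_subset h.lt).1
    (eventually_mul_sub_lt_sub_of_hasDerivWithinAt hd' (half_lt_self hp))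
  obtain ⟨c, hac, hcu⟩ := exists_between hu.1
  have hcb := hcu.trans_le hu.2
  have hlower : ∀ t ∈ Ioc a c, p / 2 * (t - a) ≤ χ t := fun t ht ↦ by
    have hlt' : p / 2 * (t - a) < χ t - χ a := hlt ⟨ht.1, ht.2.trans_lt hcu⟩
    rw [h.left_eq_zero, sub_zero] at hlt'
    exact hlt'.le
  exact ⟨c, ⟨hac, hcb⟩, intervalIntegrable_rpow_of_mul_sub_le hac.le
    (h.continuousOn.mono fun t ht ↦ ⟨ht.1.le, ht.2.trans hcb.le⟩) (half_pos hp)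
    hlower (by norm_num) (by norm_num)⟩

theorem intervalIntegrable (h : IsProfile χ a b) :
    IntervalIntegrable (fun t ↦ χ t ^ (-(1 / 2) : ℝ)) volume a b := by
  obtain ⟨c, hc, hleft⟩ := h.exists_intervalIntegrable_left
  obtain ⟨d, hd, hd'⟩ := h.comp_neg.exists_intervalIntegrable_left
  have hright : IntervalIntegrable (fun t ↦ χ t ^ (-(1 / 2) : ℝ)) volume (-d) b := by
    simpa using ((IntervalIntegrable.iff_comp_neg).1 hd').symm
  have hsub : uIcc c (-d) ⊆ Ioo a b :=
    ordConnected_Ioo.uIcc_subset hc ⟨lt_neg.1 hd.2, neg_lt.1 hd.1⟩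
  exact (hleft.trans ((h.continuousOn_rpow _).mono hsub).intervalIntegrable).trans hright

end IsProfile

/-- The primitive `s` of `Q ^ (-1/2)` that vanishes at `a`. -/
def arcLength (χ : ℝ → ℝ) (a t : ℝ) : ℝ := ∫ u in a..t, χ u ^ (-(1 / 2) : ℝ)

@[simp]
theorem arcLength_self (χ : ℝ → ℝ) (a : ℝ) : arcLength χ a a = 0 :=
  intervalIntegral.integral_same

theorem arcLength_eq_setIntegral (h : a ≤ b) :
    arcLength χ a b = ∫ t in Icc a b, χ t ^ (-(1 / 2) : ℝ) := by
  rw [arcLength, integral_Icc_eq_integral_Ioc, intervalIntegral.integral_of_le h]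

namespace IsProfile

theorem integrableOn (h : IsProfile χ a b) :
    IntegrableOn (fun t ↦ χ t ^ (-(1 / 2) : ℝ)) (Icc a b) :=
  (intervalIntegrable_iff_integrableOn_Icc_of_le h.lt.le).1 h.intervalIntegrable

theorem hasDerivAt_arcLength (h : IsProfile χ a b) {t : ℝ} (ht : t ∈ Ioo a b) :
    HasDerivAt (arcLength χ a) (χ t ^ (-(1 / 2) : ℝ)) t :=
  hasDerivAt_integral_of_continuousOn_Ioo (h.continuousOn_rpow _) h.intervalIntegrable ht

theorem continuousOn_arcLength (h : IsProfile χ a b) : ContinuousOn (arcLength χ a) (Icc a b) :=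
  continuousOn_integral_Icc h.lt.le h.intervalIntegrable

theorem strictMonoOn_arcLength (h : IsProfile χ a b) : StrictMonoOn (arcLength χ a) (Icc a b) :=
  strictMonoOn_integral_Icc h.lt.le (h.continuousOn_rpow _)
    (fun t ht ↦ Real.rpow_pos_of_pos (h.pos t ht) _) h.intervalIntegrable

theorem arcLength_nonneg (h : IsProfile χ a b) {t : ℝ} (ht : t ∈ Icc a b) :
    0 ≤ arcLength χ a t := by
  simpa using h.strictMonoOn_arcLength.monotoneOn (left_mem_Icc.2 h.lt.le) ht ht.1

theorem isHomeoOn_arcLength (h : IsProfile χ a b) :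
    IsHomeoOn (arcLength χ a) (Icc a b) (Icc 0 (arcLength χ a b)) := by
  simpa using isHomeoOn_Icc_of_strictMonoOn h.lt.le h.continuousOn_arcLength
    h.strictMonoOn_arcLength

theorem isDiffeoOn_arcLength (h : IsProfile χ a b) (hχ : ContDiffOn ℝ ∞ χ (Ioo a b)) :
    IsDiffeoOn (arcLength χ a) (Ioo a b) (Ioo 0 (arcLength χ a b)) := by
  have hderiv : ∀ t ∈ Ioo a b, deriv (arcLength χ a) t = χ t ^ (-(1 / 2) : ℝ) := fun t ht ↦
    (h.hasDerivAt_arcLength ht).deriv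
  have hsmooth : ContDiffOn ℝ ∞ (arcLength χ a) (Ioo a b) :=
    (contDiffOn_infty_iff_deriv_of_isOpen isOpen_Ioo).2
      ⟨fun t ht ↦ (h.hasDerivAt_arcLength ht).differentiableAt.differentiableWithinAt,
        (hχ.rpow_const_of_ne fun t ht ↦ (h.pos t ht).ne').congr hderiv⟩
  simpa using isDiffeoOn_Ioo_of_strictMonoOn h.lt.le h.continuousOn_arcLength
    h.strictMonoOn_arcLength hsmooth fun t ht ↦
      (hderiv t ht).trans_ne (Real.rpow_pos_of_pos (h.pos t ht) _).ne'

end IsProfile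

theorem rpow_neg_half_eq_inv_sqrt {x : ℝ} (hx : 0 ≤ x) : x ^ (-(1 / 2) : ℝ) = (√x)⁻¹ := by
  rw [Real.rpow_neg hx, Real.sqrt_eq_rpow]

theorem tendsto_integral_inv_sqrt_add (hχ : Continuous χ) (hχ0 : ∀ t, 0 ≤ χ t)
    (hpos : ∀ t ∈ Ioo a b, 0 < χ t)
    (hint : IntervalIntegrable (fun t ↦ χ t ^ (-(1 / 2) : ℝ)) volume a b) {t : ℝ}
    (ht : t ∈ Icc a b) :
    Tendsto (fun ε ↦ ∫ u in a..t, (√(χ u + ε))⁻¹) (𝓝[>] 0) (𝓝 (arcLength χ a t)) := by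
  have hae : ∀ᵐ u : ℝ, u ∈ uIoc a t → 0 < χ u := by
    filter_upwards [(countable_singleton b).ae_notMem volume] with u hub hu
    rw [uIoc_of_le ht.1] at hu
    exact hpos u ⟨hu.1, (hu.2.trans ht.2).lt_of_ne hub⟩
  refine intervalIntegral.tendsto_integral_filter_of_dominated_convergence
    (fun u ↦ χ u ^ (-(1 / 2) : ℝ)) ?_ ?_
    (hint.mono_set (uIcc_subset_uIcc_left (Icc_subset_uIcc ht))) ?_
  · filter_upwards [self_mem_nhdsWithin] with ε (hε : 0 < ε)
    exact ((hχ.add continuous_const).sqrt.inv₀ fun u ↦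
      (Real.sqrt_pos.2 (add_pos_of_nonneg_of_pos (hχ0 u) hε)).ne').aestronglyMeasurable
  · filter_upwards [self_mem_nhdsWithin] with ε (hε : 0 < ε)
    filter_upwards [hae] with u hu hut
    rw [Real.norm_of_nonneg (by positivity), rpow_neg_half_eq_inv_sqrt (hχ0 u)]
    exact inv_anti₀ (Real.sqrt_pos.2 (hu hut)) (Real.sqrt_le_sqrt (le_add_of_nonneg_right hε.le))
  · filter_upwards [hae] with u hu hut
    have hlim : Tendsto (fun ε ↦ (√(χ u + ε))⁻¹) (𝓝 0) (𝓝 (√(χ u + 0))⁻¹) :=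
      ((continuous_const.add continuous_id).sqrt.tendsto 0).inv₀
        (by simpa using (Real.sqrt_pos.2 (hu hut)).ne')
    rw [rpow_neg_half_eq_inv_sqrt (hχ0 u)]
    simpa using hlim.mono_left nhdsWithin_le_nhds

end Profile

theorem infDist_le_of_forall_exists_lt {X : Type*} [MetricSpace X] [CompactSpace X] {f : X → ℝ}
    (hf : Continuous f) (hf0 : ∀ x, 0 ≤ f x) {S : Set X} {x : X}
    (h : ∀ k > 1, ∀ y ∉ S, f y ≤ f x → ∃ z, k * f z + dist y z < k * f y) :
    Metric.infDist x S ≤ f x := by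
  have hk : ∀ k > 1, Metric.infDist x S ≤ k * f x := fun k hk ↦ by
    -- A minimum point of `k * f + dist x` admits no descent, hence lies in `S`.
    obtain ⟨y, -, hy⟩ := isCompact_univ.exists_isMinOn (f := fun y ↦ k * f y + dist x y)
      ⟨x, mem_univ x⟩ (by fun_prop)
    have hmin : ∀ z, k * f y + dist x y ≤ k * f z + dist x z := fun z ↦ hy (mem_univ z)
    have hyx : k * f y + dist x y ≤ k * f x := by simpa using hmin x
    have hle : f y ≤ f x := le_of_mul_le_mul_left
      ((le_add_of_nonneg_right dist_nonneg).trans hyx) (zero_lt_one.trans hk)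
    have hyS : y ∈ S := by
      by_contra hyS
      obtain ⟨z, hz⟩ := h k hk y hyS hle
      linarith [hmin z, dist_triangle x y z]
    have := mul_nonneg (zero_lt_one.trans hk).le (hf0 y)
    linarith [Metric.infDist_le_dist_of_mem (x := x) hyS]
  have hlim : Tendsto (fun k ↦ k * f x) (𝓝[>] 1) (𝓝 (f x)) := by
    simpa using ((continuous_mul_const (f x)).tendsto 1).mono_left nhdsWithin_le_nhds
  exact ge_of_tendsto hlim (eventually_nhdsWithin_of_forall hk)

section RiemannianDistance

open Manifold MeasureTheory

variable {E : Type*} [NormedAddCommGroup E] [NormedSpace ℝ E]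

theorem mvfderiv_comp_of_hasDerivAt {M : Type*} [TopologicalSpace M] [ChartedSpace E M]
    {h : ℝ → ℝ} {τ : M → ℝ} {x : M} {h' : ℝ}
    (hh : HasDerivAt h h' (τ x)) (hτ : MDifferentiableAt 𝓘(ℝ, E) 𝓘(ℝ, ℝ) τ x)
    (w : TangentSpace 𝓘(ℝ, E) x) :
    mvfderiv 𝓘(ℝ, E) (h ∘ τ) x w = h' * mvfderiv 𝓘(ℝ, E) τ x w := by
  have hcomp := (hh.hasFDerivAt.hasMFDerivAt.comp x hτ.hasMFDerivAt).mfderiv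
  refine (congrArg (fun L ↦ L w) hcomp).trans ?_
  exact mul_comm (mvfderiv 𝓘(ℝ, E) τ x w) h'

variable {M : Type*} [MetricSpace M] [ChartedSpace E M]
  [RiemannianBundle (fun x : M ↦ TangentSpace 𝓘(ℝ, E) x)]

theorem edist_comp_le_pathELength {f : M → ℝ} (hf : ContMDiff 𝓘(ℝ, E) 𝓘(ℝ, ℝ) 1 f)
    (h : ∀ x (w : TangentSpace 𝓘(ℝ, E) x), |mvfderiv 𝓘(ℝ, E) f x w| ≤ ‖w‖) {γ : ℝ → M}
    (hγ : ContMDiffOn 𝓘(ℝ, ℝ) 𝓘(ℝ, E) 1 γ (Icc 0 1)) :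
    edist (f (γ 0)) (f (γ 1)) ≤ pathELength 𝓘(ℝ, E) γ 0 1 := by
  have hfγ : ContDiffOn ℝ 1 (f ∘ γ) (Icc 0 1) :=
    contMDiffOn_iff_contDiffOn.1 (hf.comp_contMDiffOn hγ)
  rw [edist_comm, edist_eq_enorm_sub, pathELength_eq_lintegral_mfderivWithin_Icc]
  refine (enorm_sub_le_lintegral_derivWithin_Icc_of_contDiffOn_Icc hfγ zero_le_one).trans
    (setLIntegral_mono' measurableSet_Icc fun t ht ↦ ?_)
  have hchain := mfderiv_comp_mfderivWithin t (hf.mdifferentiable one_ne_zero (γ t))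
    (hγ.mdifferentiableOn one_ne_zero t ht)
    (uniqueMDiffWithinAt_iff_uniqueDiffWithinAt.2 (uniqueDiffOn_Icc zero_lt_one t ht))
  have hderiv : derivWithin (f ∘ γ) (Icc 0 1) t =
      mvfderiv 𝓘(ℝ, E) f (γ t) (mfderivWithin 𝓘(ℝ, ℝ) 𝓘(ℝ, E) γ (Icc 0 1) t 1) := by
    rw [← fderivWithin_derivWithin, ← mfderivWithin_eq_fderivWithin]
    exact congrArg (fun L ↦ L 1) hchain
  rw [hderiv, ← ofReal_norm, ← ofReal_norm]
  exact ENNReal.ofReal_le_ofReal (h _ _)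

variable [IsRiemannianManifold 𝓘(ℝ, E) M]

theorem abs_sub_le_dist_of_abs_mvfderiv_le {f : M → ℝ} (hf : ContMDiff 𝓘(ℝ, E) 𝓘(ℝ, ℝ) 1 f)
    (h : ∀ x (w : TangentSpace 𝓘(ℝ, E) x), |mvfderiv 𝓘(ℝ, E) f x w| ≤ ‖w‖) (x y : M) :
    |f x - f y| ≤ dist x y := by
  have hedist : edist (f x) (f y) ≤ edist x y := by
    rw [IsRiemannianManifold.out (I := 𝓘(ℝ, E)) x y]
    refine le_of_forall_gt fun r hr ↦ ?_
    obtain ⟨γ, rfl, rfl, hγ, hlen⟩ := exists_lt_of_riemannianEDist_lt hr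
    exact (edist_comp_le_pathELength hf h hγ).trans_lt hlen
  rw [← Real.dist_eq, dist_edist, dist_edist]
  exact ENNReal.toReal_mono (edist_ne_top x y) hedist

theorem dist_le_mul_of_norm_mfderiv_le {γ : ℝ → M} {a b K : ℝ} (hab : a ≤ b)
    (hγ : ∀ t ∈ Icc a b, ContMDiffAt 𝓘(ℝ, ℝ) 𝓘(ℝ, E) 1 γ t)
    (hK : ∀ t ∈ Icc a b, ‖mfderiv 𝓘(ℝ, ℝ) 𝓘(ℝ, E) γ t 1‖ ≤ K) :
    dist (γ a) (γ b) ≤ K * (b - a) := by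
  have hK0 : 0 ≤ K := (norm_nonneg _).trans (hK a (left_mem_Icc.2 hab))
  have hlen : pathELength 𝓘(ℝ, E) γ a b ≤ ENNReal.ofReal (K * (b - a)) := by
    rw [pathELength_eq_lintegral_mfderiv_Icc, ENNReal.ofReal_mul hK0, ← Real.volume_Icc,
      ← setLIntegral_const]
    refine setLIntegral_mono' measurableSet_Icc fun t ht ↦ ?_
    rw [← ofReal_norm]
    exact ENNReal.ofReal_le_ofReal (hK t ht)
  have hedist := (riemannianEDist_le_pathELength (I := 𝓘(ℝ, E))
    (fun t ht ↦ (hγ t ht).contMDiffWithinAt) rfl rfl hab).trans hlen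
  rw [← IsRiemannianManifold.out] at hedist
  rw [dist_edist]
  exact ENNReal.toReal_le_of_le_ofReal (mul_nonneg hK0 (sub_nonneg.2 hab)) hedist

end RiemannianDistance

section ChartLine

variable {E : Type*} [NormedAddCommGroup E] [NormedSpace ℝ E]
  {M : Type*} [MetricSpace M] [ChartedSpace E M] {φ : OpenPartialHomeomorph M E}
  (hφ : φ ∈ IsManifold.maximalAtlas 𝓘(ℝ, E) ∞ M)

include hφ

theorem contMDiffAt_chart_symm_line {x w : E} {t : ℝ} (ht : x + t • w ∈ φ.target) :
    ContMDiffAt 𝓘(ℝ, ℝ) 𝓘(ℝ, E) ∞ (fun r : ℝ ↦ φ.symm (x + r • w)) t :=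
  (contMDiffAt_chart_symm hφ ht).comp t
    (ContDiffAt.contMDiffAt (f := fun r : ℝ ↦ x + r • w) (by fun_prop))

theorem mfderiv_chart_symm_line {x w : E} {t : ℝ} (ht : x + t • w ∈ φ.target) :
    mfderiv 𝓘(ℝ, ℝ) 𝓘(ℝ, E) (fun r : ℝ ↦ φ.symm (x + r • w)) t 1 =
      coordField φ w (φ.symm (x + t • w)) := by
  have hline : HasDerivAt (fun r : ℝ ↦ x + r • w) w t := by
    simpa using ((hasDerivAt_id t).smul_const w).const_add x
  have hsymm := ((contMDiffAt_chart_symm hφ ht).mdifferentiableAt (by simp)).hasMFDerivAt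
  have hcomp := (hsymm.comp t hline.hasFDerivAt.hasMFDerivAt).mfderiv
  have hcoord := mfderiv_chart_symm hφ (φ.map_target ht) w
  rw [φ.right_inv ht] at hcoord
  refine (congrArg (fun L ↦ L 1) hcomp).trans (Eq.trans ?_ hcoord)
  exact congrArg (mfderiv 𝓘(ℝ, E) 𝓘(ℝ, E) φ.symm (x + t • w)) (one_smul ℝ w)

variable [FiniteDimensional ℝ E] [IsManifold 𝓘(ℝ, E) ∞ M]
  [RiemannianBundle (fun x : M ↦ TangentSpace 𝓘(ℝ, E) x)]
  [IsContMDiffRiemannianBundle 𝓘(ℝ, E) ∞ E (fun x : M ↦ TangentSpace 𝓘(ℝ, E) x)]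

theorem eventually_norm_coordField_line_lt {y : M} (hy : y ∈ φ.source) {w : E} {K : ℝ}
    (hK : ‖coordField φ w y‖ < K) :
    ∀ᶠ t in 𝓝 (0 : ℝ), ‖coordField φ w (φ.symm (φ y + t • w))‖ < K := by
  have hnorm (x : E) : gram φ x w w = ‖coordField φ w (φ.symm x)‖ ^ 2 := by
    rw [gram_apply, real_inner_self_eq_norm_sq]
  have hK0 : 0 ≤ K := (norm_nonneg _).trans hK.le
  have hcont : ContinuousAt (fun x ↦ gram φ x w w) (φ y) :=
    (((contDiffAt_gram hφ (φ.map_source hy)).clm_apply contDiffAt_const).clm_apply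
      contDiffAt_const).continuousAt
  have hlt : gram φ (φ y) w w < K ^ 2 := by
    rw [hnorm, φ.left_inv hy]
    exact pow_lt_pow_left₀ hK (norm_nonneg _) two_ne_zero
  filter_upwards [(tendsto_line (φ y) w).eventually (hcont.eventually_lt_const hlt)] with t ht
  rw [hnorm] at ht
  exact lt_of_pow_lt_pow_left₀ 2 hK0 ht

variable [IsRiemannianManifold 𝓘(ℝ, E) M]

theorem eventually_dist_chart_symm_line_le {y : M} (hy : y ∈ φ.source) {w : E} {K : ℝ}
    (hK : ‖coordField φ w y‖ < K) :
    ∀ᶠ r in 𝓝[>] (0 : ℝ), dist y (φ.symm (φ y + r • w)) ≤ K * r := by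
  have htarget : ∀ᶠ t in 𝓝 (0 : ℝ), φ y + t • w ∈ φ.target :=
    (tendsto_line (φ y) w).eventually (φ.open_target.mem_nhds (φ.map_source hy))
  obtain ⟨δ, hδ, hball⟩ := Metric.eventually_nhds_iff.1
    (htarget.and (eventually_norm_coordField_line_lt hφ hy hK))
  filter_upwards [Ioo_mem_nhdsGT hδ] with r hr
  have hmem : ∀ t ∈ Icc 0 r, dist t 0 < δ := fun t ht ↦ by
    rw [Real.dist_eq, sub_zero, abs_of_nonneg ht.1]
    exact ht.2.trans_lt hr.2
  have hdist := dist_le_mul_of_norm_mfderiv_le (γ := fun t ↦ φ.symm (φ y + t • w)) (K := K)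
    hr.1.le (fun t ht ↦ (contMDiffAt_chart_symm_line hφ (hball (hmem t ht)).1).of_le (by simp))
    fun t ht ↦ by
      rw [mfderiv_chart_symm_line hφ (hball (hmem t ht)).1]
      exact (hball (hmem t ht)).2.le
  simpa [φ.left_inv hy] using hdist

omit hφ in
theorem exists_add_dist_lt_of_mvfderiv_lt {f : M → ℝ} {y : M}
    (hf : MDifferentiableAt 𝓘(ℝ, E) 𝓘(ℝ, ℝ) f y) {u : TangentSpace 𝓘(ℝ, E) y}
    (hu : mvfderiv 𝓘(ℝ, E) f y u < -‖u‖) : ∃ z, f z + dist y z < f y := by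
  have hφ : chartAt E y ∈ IsManifold.maximalAtlas 𝓘(ℝ, E) ∞ M :=
    IsManifold.chart_mem_maximalAtlas y
  set φ := chartAt E y
  have hy : y ∈ φ.source := mem_chart_source E y
  obtain ⟨w, rfl⟩ := exists_coordField_eq hφ hy u
  obtain ⟨K, hfK, hKw⟩ := exists_between hu
  have hdiff : DifferentiableAt ℝ (f ∘ φ.symm) (φ y + (0 : ℝ) • w) := by
    have hsymm := (contMDiffAt_chart_symm hφ (φ.map_source hy)).mdifferentiableAt (by simp)
    rw [← φ.left_inv hy] at hf
    simpa using (hf.comp (φ y) hsymm).differentiableAt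
  have hderiv := (hasDerivAt_line hdiff).neg.hasDerivWithinAt (s := Ioi 0)
  rw [zero_smul, add_zero, ← mvfderiv_coordField hφ hy hf] at hderiv
  obtain ⟨r, hfr, hdr⟩ := ((eventually_mul_sub_lt_sub_of_hasDerivWithinAt hderiv
    (neg_lt_neg hfK)).and (eventually_dist_chart_symm_line_le hφ hy (lt_neg.1 hKw))).exists
  refine ⟨φ.symm (φ y + r • w), ?_⟩
  simp only [Pi.neg_apply, sub_zero, Function.comp_apply, zero_smul, add_zero, φ.left_inv hy] at hfr
  linarith

end ChartLine

section ArcLengthDistance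

open Manifold

variable {E : Type*} [NormedAddCommGroup E] [NormedSpace ℝ E] [FiniteDimensional ℝ E]
  {M : Type*} {τ : M → ℝ} {χ : ℝ → ℝ} {a b : ℝ}

theorem abs_mvfderiv_le [TopologicalSpace M] [ChartedSpace E M]
    [RiemannianBundle (fun x : M ↦ TangentSpace 𝓘(ℝ, E) x)] (x : M)
    (w : TangentSpace 𝓘(ℝ, E) x) :
    |mvfderiv 𝓘(ℝ, E) τ x w| ≤ √(gradSq E τ x) * ‖w‖ := by
  rw [← inner_grad, gradSq, ← norm_eq_sqrt_real_inner]
  exact abs_real_inner_le_norm _ _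

variable [MetricSpace M] [ChartedSpace E M]
  [RiemannianBundle (fun x : M ↦ TangentSpace 𝓘(ℝ, E) x)]
  [IsRiemannianManifold 𝓘(ℝ, E) M]

theorem abs_integral_inv_sqrt_add_sub_le_dist (hτ : ContMDiff 𝓘(ℝ, E) 𝓘(ℝ, ℝ) ∞ τ)
    (hχ : ∀ x, gradSq E τ x = χ (τ x)) (hcont : Continuous χ) (hχ0 : ∀ t, 0 ≤ χ t) {ε : ℝ}
    (hε : 0 < ε) (c : ℝ) (x y : M) :
    |(∫ u in c..τ x, (√(χ u + ε))⁻¹) - ∫ u in c..τ y, (√(χ u + ε))⁻¹| ≤ dist x y := by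
  have hpos : ∀ u, 0 < √(χ u + ε) := fun u ↦
    Real.sqrt_pos.2 (add_pos_of_nonneg_of_pos (hχ0 u) hε)
  have hint : Continuous fun u ↦ (√(χ u + ε))⁻¹ :=
    (hcont.add continuous_const).sqrt.inv₀ fun u ↦ (hpos u).ne'
  refine abs_sub_le_dist_of_abs_mvfderiv_le (E := E)
    (f := (fun t ↦ ∫ u in c..t, (√(χ u + ε))⁻¹) ∘ τ)
    ((contDiff_one_integral hint c).contMDiff.comp (hτ.of_le (by simp))) (fun z w ↦ ?_) x y
  rw [mvfderiv_comp_of_hasDerivAt (hint.integral_hasStrictDerivAt c (τ z)).hasDerivAt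
    (hτ.mdifferentiable (by simp) z), abs_mul, abs_of_pos (inv_pos.2 (hpos _)),
    inv_mul_le_iff₀ (hpos _)]
  refine (abs_mvfderiv_le z w).trans (mul_le_mul_of_nonneg_right ?_ (norm_nonneg w))
  rw [hχ]
  exact Real.sqrt_le_sqrt (le_add_of_nonneg_right hε.le)

theorem abs_arcLength_sub_le_dist (hτ : ContMDiff 𝓘(ℝ, E) 𝓘(ℝ, ℝ) ∞ τ)
    (hmem : ∀ x, τ x ∈ Icc a b) (hχ : ∀ x, gradSq E τ x = χ (τ x)) (h : IsProfile χ a b)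
    (x y : M) : |arcLength χ a (τ x) - arcLength χ a (τ y)| ≤ dist x y := by
  -- Outside `[a, b]` the values of `χ` are arbitrary.
  set X : ℝ → ℝ := IccExtend h.lt.le ((Icc a b).domRestrict χ)
  have hX : ∀ t ∈ Icc a b, X t = χ t := fun t ht ↦ IccExtend_of_mem h.lt.le _ ht
  have hXcont : Continuous X := h.continuousOn.domRestrict.Icc_extend'
  have hX0 : ∀ t, 0 ≤ X t := fun t ↦ h.nonneg (Subtype.coe_prop _)
  have hint : IntervalIntegrable (fun t ↦ X t ^ (-(1 / 2) : ℝ)) MeasureTheory.volume a b :=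
    h.intervalIntegrable.congr fun t ht ↦ by
      rw [uIoc_of_le h.lt.le] at ht
      simp only [hX t (Ioc_subset_Icc_self ht)]
  have harc : ∀ t ∈ Icc a b, arcLength X a t = arcLength χ a t := fun t ht ↦
    intervalIntegral.integral_congr fun u hu ↦ by
      rw [uIcc_of_le ht.1] at hu
      simp only [hX u ⟨hu.1, hu.2.trans ht.2⟩]
  have hlim (z : M) := tendsto_integral_inv_sqrt_add hXcont hX0
    (fun t ht ↦ (h.pos t ht).trans_eq (hX t (Ioo_subset_Icc_self ht)).symm) hint (hmem z)
  rw [← harc _ (hmem x), ← harc _ (hmem y)]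
  refine le_of_tendsto ((hlim x).sub (hlim y)).abs (eventually_nhdsWithin_of_forall fun ε hε ↦ ?_)
  exact abs_integral_inv_sqrt_add_sub_le_dist hτ (fun z ↦ (hχ z).trans (hX _ (hmem z)).symm)
    hXcont hX0 hε a x y

variable [IsManifold 𝓘(ℝ, E) ∞ M]
  [IsContMDiffRiemannianBundle 𝓘(ℝ, E) ∞ E (fun x : M ↦ TangentSpace 𝓘(ℝ, E) x)]

theorem exists_mul_arcLength_add_dist_lt (hτ : ContMDiff 𝓘(ℝ, E) 𝓘(ℝ, ℝ) ∞ τ)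
    (hχ : ∀ x, gradSq E τ x = χ (τ x)) (h : IsProfile χ a b) {y : M} (hy : τ y ∈ Ioo a b)
    {k : ℝ} (hk : 1 < k) :
    ∃ z, k * arcLength χ a (τ z) + dist y z < k * arcLength χ a (τ y) := by
  have hχy : χ (τ y) = ‖grad E τ y‖ ^ 2 := by
    rw [← hχ, gradSq, real_inner_self_eq_norm_sq]
  have hgrad : 0 < ‖grad E τ y‖ :=
    (norm_nonneg _).lt_of_ne' (pow_ne_zero_iff two_ne_zero |>.1 (hχy ▸ (h.pos _ hy).ne'))
  have hderiv := (h.hasDerivAt_arcLength hy).const_mul k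
  rw [rpow_neg_half_eq_inv_sqrt (h.pos _ hy).le, hχy, Real.sqrt_sq hgrad.le] at hderiv
  have hτy := hτ.mdifferentiable (by simp) y
  refine exists_add_dist_lt_of_mvfderiv_lt (f := (fun t ↦ k * arcLength χ a t) ∘ τ)
    (hderiv.differentiableAt.mdifferentiableAt.comp y hτy) (u := -grad E τ y) ?_
  rw [mvfderiv_comp_of_hasDerivAt hderiv hτy, ← inner_grad, inner_neg_right,
    real_inner_self_eq_norm_sq, norm_neg]
  calc k * ‖grad E τ y‖⁻¹ * -‖grad E τ y‖ ^ 2 = -(k * ‖grad E τ y‖) := by field_simp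
    _ < -‖grad E τ y‖ := neg_lt_neg (lt_mul_of_one_lt_left hgrad hk)

variable [CompactSpace M]

theorem infDist_le_arcLength_of_lt (hτ : ContMDiff 𝓘(ℝ, E) 𝓘(ℝ, ℝ) ∞ τ)
    (hmem : ∀ x, τ x ∈ Icc a b) (hχ : ∀ x, gradSq E τ x = χ (τ x)) (h : IsProfile χ a b)
    {x : M} (hx : τ x < b) : Metric.infDist x {z | τ z = a} ≤ arcLength χ a (τ x) := by
  refine infDist_le_of_forall_exists_lt (f := fun z ↦ arcLength χ a (τ z))
    (h.continuousOn_arcLength.comp_continuous hτ.continuous hmem)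
    (fun z ↦ h.arcLength_nonneg (hmem z)) fun k hk y hya hyx ↦ ?_
  have hle := (h.strictMonoOn_arcLength.le_iff_le (hmem y) (hmem x)).1 hyx
  exact exists_mul_arcLength_add_dist_lt hτ hχ h
    ⟨(hmem y).1.lt_of_ne' hya, hle.trans_lt hx⟩ hk

theorem infDist_eq_arcLength (hτ : ContMDiff 𝓘(ℝ, E) 𝓘(ℝ, ℝ) ∞ τ)
    (hmem : ∀ x, τ x ∈ Icc a b) (hχ : ∀ x, gradSq E τ x = χ (τ x)) (h : IsProfile χ a b)
    (ha : ∃ x, τ x = a) (hb : ∀ x, τ x = b → ∃ᶠ z in 𝓝 x, τ z ≠ b) (x : M) :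
    Metric.infDist x {z | τ z = a} = arcLength χ a (τ x) := by
  refine le_antisymm ?_ ((Metric.le_infDist ha).2 fun z (hz : τ z = a) ↦ ?_)
  · have hclosed : IsClosed {x | Metric.infDist x {z | τ z = a} ≤ arcLength χ a (τ x)} :=
      isClosed_le (Metric.continuous_infDist_pt _)
        (h.continuousOn_arcLength.comp_continuous hτ.continuous hmem)
    refine closure_minimal (s := {x | τ x < b})
      (fun z ↦ infDist_le_arcLength_of_lt hτ hmem hχ h) hclosed ?_
    rcases (hmem x).2.lt_or_eq with hx | hx
    · exact subset_closure hx
    · exact mem_closure_iff_frequently.2 ((hb x hx).mono fun z hz ↦ (hmem z).2.lt_of_ne hz)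
  · have habs := abs_arcLength_sub_le_dist hτ hmem hχ h x z
    rw [hz, arcLength_self, sub_zero] at habs
    exact (le_abs_self _).trans habs

end ArcLengthDistance

theorem isGLB_dist_levels {X : Type*} [MetricSpace X] [CompactSpace X] {f : X → ℝ} {a b l : ℝ}
    (hf : Continuous f) (ha : ∃ x, f x = a) (hb : ∃ x, f x = b)
    (hl : ∀ x, f x = b → Metric.infDist x {z | f z = a} = l) :
    IsGLB {d : ℝ | ∃ x y : X, f x = a ∧ f y = b ∧ d = dist x y} l := by
  constructor
  · rintro _ ⟨x, y, hx, hy, rfl⟩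
    rw [← hl y hy, dist_comm]
    exact Metric.infDist_le_dist_of_mem hx
  · intro d hd
    obtain ⟨y, hy⟩ := hb
    obtain ⟨x, hx, hxy⟩ :=
      (isClosed_eq hf continuous_const).isCompact.exists_infDist_eq_dist ha y
    rw [← hl y hy, hxy, dist_comm]
    exact hd ⟨x, y, hx, hy, rfl⟩

theorem range_eq_Icc_of_isLeast_of_isGreatest {X : Type*} [TopologicalSpace X]
    [PreconnectedSpace X] {f : X → ℝ} (hf : Continuous f) {a b : ℝ} (ha : IsLeast (range f) a)
    (hb : IsGreatest (range f) b) : range f = Icc a b := by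
  refine Subset.antisymm (fun t ht ↦ ⟨ha.2 ht, hb.2 ht⟩) ?_
  obtain ⟨⟨x, rfl⟩, -⟩ := ha
  obtain ⟨⟨y, rfl⟩, -⟩ := hb
  exact intermediate_value_univ x y hf

section MorseBottProfile

variable {E : Type*} [NormedAddCommGroup E] [NormedSpace ℝ E] [FiniteDimensional ℝ E]
  {M : Type*} [TopologicalSpace M] [ChartedSpace E M] [IsManifold 𝓘(ℝ, E) ∞ M]
  [RiemannianBundle (fun x : M ↦ TangentSpace 𝓘(ℝ, E) x)]
  [IsContMDiffRiemannianBundle 𝓘(ℝ, E) ∞ E (fun x : M ↦ TangentSpace 𝓘(ℝ, E) x)]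
  {τ : M → ℝ} (hτ : ContMDiff 𝓘(ℝ, E) 𝓘(ℝ, ℝ) ∞ τ)
  (hcrit : ∀ y ∈ critSet E τ, ∃ φ F a, CriticalChart (E := E) τ y φ F a)

include hτ hcrit

theorem exists_hasDerivWithinAt_of_mem_critSet {χ : ℝ → ℝ} (hχ : ∀ x, gradSq E τ x = χ (τ x))
    (hd : DifferentiableOn ℝ χ (range τ)) {y : M} (hy : y ∈ critSet E τ) :
    ∃ a : ℝ, a ≠ 0 ∧ (∀ b : ℝ, b ≠ 0 → (Module.End.HasEigenvalue
      (hess E τ y : TangentSpace 𝓘(ℝ, E) y →ₗ[ℝ] TangentSpace 𝓘(ℝ, E) y) b ↔ b = a)) ∧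
      HasDerivWithinAt χ (2 * a) (range τ) (τ y) := by
  obtain ⟨φ, F, a, h⟩ := hcrit y hy
  exact ⟨a, h.isDefiniteCritical.ne_zero, fun b hb ↦ h.hasEigenvalue_iff hτ hy hb,
    h.hasDerivWithinAt hτ hχ mem_range_self (hd _ (mem_range_self y))⟩

theorem frequently_ne_of_isLocalExtr {x : M} (hx : IsLocalExtr τ x) :
    ∃ᶠ z in 𝓝 x, τ z ≠ τ x := by
  obtain ⟨φ, F, a, h⟩ := hcrit x (mem_critSet_of_isLocalExtr hτ hx)
  exact h.frequently_ne hτ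

theorem frequently_ne_of_isGreatest {b : ℝ} (hb : IsGreatest (range τ) b) (x : M)
    (hx : τ x = b) : ∃ᶠ z in 𝓝 x, τ z ≠ b := by
  subst hx
  exact frequently_ne_of_isLocalExtr hτ hcrit (.inr (.of_forall (forall_mem_range.1 hb.2)))

theorem exists_hasDerivWithinAt_pos_of_isLocalMin {χ : ℝ → ℝ}
    (hχ : ∀ x, gradSq E τ x = χ (τ x)) (hd : DifferentiableOn ℝ χ (range τ)) {y : M}
    (hy : IsLocalMin τ y) : ∃ p > 0, HasDerivWithinAt χ p (range τ) (τ y) := by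
  obtain ⟨φ, F, a, h⟩ := hcrit y (mem_critSet_of_isLocalExtr hτ (.inl hy))
  exact ⟨2 * a, mul_pos two_pos (h.pos_of_isLocalMin hτ hy),
    h.hasDerivWithinAt hτ hχ mem_range_self (hd _ (mem_range_self y))⟩

theorem exists_hasDerivWithinAt_neg_of_isLocalMax {χ : ℝ → ℝ}
    (hχ : ∀ x, gradSq E τ x = χ (τ x)) (hd : DifferentiableOn ℝ χ (range τ)) {y : M}
    (hy : IsLocalMax τ y) : ∃ q < 0, HasDerivWithinAt χ q (range τ) (τ y) := by
  obtain ⟨φ, F, a, h⟩ := hcrit y (mem_critSet_of_isLocalExtr hτ (.inr hy))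
  exact ⟨2 * a, mul_neg_of_pos_of_neg two_pos (h.neg_of_isLocalMax hτ hy),
    h.hasDerivWithinAt hτ hχ mem_range_self (hd _ (mem_range_self y))⟩

theorem lt_of_isLeast_of_isGreatest {a b : ℝ} (ha : IsLeast (range τ) a)
    (hb : IsGreatest (range τ) b) : a < b := by
  obtain ⟨⟨x, rfl⟩, hx⟩ := ha
  obtain ⟨z, hz⟩ := (frequently_ne_of_isLocalExtr hτ hcrit
    (.inl (.of_forall (forall_mem_range.1 hx)))).exists
  exact ((hx (mem_range_self z)).lt_of_ne' hz).trans_le (hb.2 (mem_range_self z))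

variable [CompactSpace M] [T2Space M] [ConnectedSpace M]

theorem gradSq_pos_of_lt_of_lt (hgeo : HasGeodesicGradient E τ) {x y z : M} (hyx : τ y < τ x)
    (hxz : τ x < τ z) : 0 < gradSq E τ x := by
  refine (gradSq_nonneg x).lt_of_ne' fun h0 ↦ ?_
  rcases isMin_or_isMax_of_mem_critSet hτ hcrit hgeo (gradSq_eq_zero_iff.1 h0) with h | h
  · exact hyx.not_ge (h y)
  · exact hxz.not_ge (h z)

theorem isProfile_of_gradSq_eq_comp (hgeo : HasGeodesicGradient E τ) {χ : ℝ → ℝ}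
    (hχ : ∀ x, gradSq E τ x = χ (τ x)) {a b : ℝ} (ha : IsLeast (range τ) a)
    (hb : IsGreatest (range τ) b) : IsProfile χ a b := by
  have hlt := lt_of_isLeast_of_isGreatest hτ hcrit ha hb
  have hrange := range_eq_Icc_of_isLeast_of_isGreatest hτ.continuous ha hb
  have hsmooth := contDiffOn_range_of_gradSq_eq_comp hτ hcrit hgeo hχ
  have hd := hsmooth.differentiableOn (by simp)
  obtain ⟨⟨y, rfl⟩, hy⟩ := ha
  obtain ⟨⟨z, rfl⟩, hz⟩ := hb
  have hymin : IsLocalMin τ y := .of_forall (forall_mem_range.1 hy)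
  have hzmax : IsLocalMax τ z := .of_forall (forall_mem_range.1 hz)
  refine ⟨hlt, hrange ▸ hsmooth.continuousOn, fun t ht ↦ ?_, ?_, ?_, ?_, ?_⟩
  · obtain ⟨x, rfl⟩ := hrange.symm.subset (Ioo_subset_Icc_self ht)
    exact hχ x ▸ gradSq_pos_of_lt_of_lt hτ hcrit hgeo ht.1 ht.2
  · rw [← hχ, gradSq_eq_zero_iff.2 (mem_critSet_of_isLocalExtr hτ (.inl hymin))]
  · rw [← hχ, gradSq_eq_zero_iff.2 (mem_critSet_of_isLocalExtr hτ (.inr hzmax))]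
  · exact hrange ▸ exists_hasDerivWithinAt_pos_of_isLocalMin hτ hcrit hχ hd hymin
  · exact hrange ▸ exists_hasDerivWithinAt_neg_of_isLocalMax hτ hcrit hχ hd hzmax

end MorseBottProfile

end RiemGeom

end

theorem theorem9p2
    {E : Type*} [NormedAddCommGroup E] [NormedSpace ℝ E] [FiniteDimensional ℝ E]
    {M : Type*} [MetricSpace M] [CompactSpace M] [ConnectedSpace M]
    [ChartedSpace E M] [IsManifold 𝓘(ℝ, E) ∞ M]
    [RiemannianBundle (fun x : M ↦ TangentSpace 𝓘(ℝ, E) x)]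
    [IsContMDiffRiemannianBundle 𝓘(ℝ, E) ∞ E (fun x : M ↦ TangentSpace 𝓘(ℝ, E) x)]
    [IsRiemannianManifold 𝓘(ℝ, E) M]
    (τ : M → ℝ) (hMB : IsMorseBott E τ) (hgeo : HasGeodesicGradient E τ)
    (hcodim : ∀ y ∈ critSet E τ, ∀ k : ℕ,
      IsSubmanifoldOfCodim E k (critComponent E τ y) → 1 < k)
    (tmin tmax : ℝ) (hmin : IsLeast (Set.range τ) tmin) (hmax : IsGreatest (Set.range τ) tmax) :
    tmin < tmax ∧ Set.range τ = Set.Icc tmin tmax ∧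
    ∃ χ : ℝ → ℝ,
      -- (i) `Q` is a smooth function of `τ`
      (ContDiffOn ℝ ∞ χ (Set.Icc tmin tmax) ∧ ∀ x : M, gradSq E τ x = χ (τ x)) ∧
      -- (ii) `dQ/dτ = 2a` at each critical point, `a` being the nonzero Hessian eigenvalue there
      (∀ y ∈ critSet E τ, ∃ a : ℝ, a ≠ 0 ∧
        (∀ b : ℝ, b ≠ 0 →
          (Module.End.HasEigenvalue
            (hess E τ y : TangentSpace 𝓘(ℝ, E) y →ₗ[ℝ] TangentSpace 𝓘(ℝ, E) y) b ↔ b = a)) ∧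
        HasDerivWithinAt χ (2 * a) (Set.Icc tmin tmax) (τ y)) ∧
      -- (iii) the integral `lam` of `Q ^ (-1/2)` is finite
      (∀ t ∈ Set.Ioo tmin tmax, 0 < χ t) ∧
      MeasureTheory.IntegrableOn (fun t ↦ χ t ^ (-(1 / 2) : ℝ)) (Set.Icc tmin tmax) ∧
      ∃ lam : ℝ, lam = (∫ t in Set.Icc tmin tmax, χ t ^ (-(1 / 2) : ℝ)) ∧
        -- (iv) `lam` is the distance between the extreme levels
        IsGLB {d : ℝ | ∃ x y : M, τ x = tmin ∧ τ y = tmax ∧ d = dist x y} lam ∧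
        -- (v) the function `s` with `ds/dτ = Q ^ (-1/2)` and `s = 0` at `tmin`
        ∃ s : ℝ → ℝ, s tmin = 0 ∧
          (∀ t ∈ Set.Ioo tmin tmax, HasDerivAt s (χ t ^ (-(1 / 2) : ℝ)) t) ∧
          IsHomeoOn s (Set.Icc tmin tmax) (Set.Icc 0 lam) ∧
          IsDiffeoOn s (Set.Ioo tmin tmax) (Set.Ioo 0 lam) ∧
          -- (vi) `s` is the distance from the minimum level
          ∀ x : M, s (τ x) = Metric.infDist x {z : M | τ z = tmin} := by
  have hτ : ContMDiff 𝓘(ℝ, E) 𝓘(ℝ, ℝ) ∞ τ := hMB.1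
  have hcrit := fun y hy ↦ exists_criticalChart hMB hgeo hy (hcodim y hy)
  have hrange := range_eq_Icc_of_isLeast_of_isGreatest hτ.continuous hmin hmax
  obtain ⟨χ, hχ⟩ := exists_gradSq_eq_comp hτ hcrit hgeo
  have hsmooth : ContDiffOn ℝ ∞ χ (Set.Icc tmin tmax) :=
    hrange ▸ contDiffOn_range_of_gradSq_eq_comp hτ hcrit hgeo hχ
  have hprofile : IsProfile χ tmin tmax := isProfile_of_gradSq_eq_comp hτ hcrit hgeo hχ hmin hmax
  have hdist : ∀ x, Metric.infDist x {z | τ z = tmin} = arcLength χ tmin (τ x) :=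
    infDist_eq_arcLength hτ (fun x ↦ hrange ▸ Set.mem_range_self x) hχ hprofile hmin.1
      (frequently_ne_of_isGreatest hτ hcrit hmax)
  refine ⟨hprofile.lt, hrange, χ, ⟨hsmooth, hχ⟩, fun y hy ↦ ?_, hprofile.pos,
    hprofile.integrableOn, arcLength χ tmin tmax, arcLength_eq_setIntegral hprofile.lt.le, ?_,
    arcLength χ tmin, arcLength_self χ tmin, fun t ↦ hprofile.hasDerivAt_arcLength,
    hprofile.isHomeoOn_arcLength, ?_, fun x ↦ (hdist x).symm⟩
  · have hdiff := hsmooth.differentiableOn (by simp)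
    rw [← hrange] at hdiff ⊢
    exact exists_hasDerivWithinAt_of_mem_critSet hτ hcrit hχ hdiff hy
  · exact isGLB_dist_levels hτ.continuous hmin.1 hmax.1 fun x hx ↦ hx ▸ hdist x
  · exact hprofile.isDiffeoOn_arcLength (hsmooth.mono Set.Ioo_subset_Icc_self)
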